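/- Let $d\ge 1$, let $\mathbb T^d=\mathbb R^d/\mathbb Z^d$ be the $d$-dimensional torus, identified with $[0,1)^d$ (functions on $\mathbb T^d$ being regarded as $\mathbb Z^d$-periodic functions on $\mathbb R^d$), let $\mathcal Y^d=[0,1)^d$, let $P\in\mathbb R^d$, and let $V:\mathbb T^d\times\mathbb R^d\to\mathbb R$ be smooth and $\mathcal Y^d$-periodic in its second variable. Let $\epsilon$ range over a sequence of positive numbers converging to $0$ and, for each such $\epsilon$, let $(u_\epsilon,m_\epsilon,\overline H_\epsilon(P))\in C^\infty(\mathbb T^d)\times C^\infty(\mathbb T^d)\times\mathbb R$ with $m_\epsilon>0$ solve $$\begin{cases}\frac{|P+\nabla u_\epsilon(x)|^2}{2}+V\big(x,\frac{x}{\epsilon}\big)=\ln m_\epsilon(x)+\overline H_\epsilon(P)&\text{in }\mathbb T^d,\\ -\operatorname{div}\big(m_\epsilon(x)(P+\nabla u_\epsilon(x))\big)=0&\text{in }\mathbb T^d,\\ \int_{\mathbb T^d}u_\epsilon\,dx=0,\quad\int_{\mathbb T^d}m_\epsilon\,dx=1.\end{cases}$$ Let $q\in[1,\infty)$. Let $C^\infty_\#(\mathcal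 Y^d)$ be the set of smooth $\mathcal Y^d$-periodic functions on $\mathbb R^d$ and $W^{1,q}_\#(\mathcal Y^d)$ its closure in the $W^{1,q}(\mathcal Y^d)$-norm. For $r\in[1,\infty]$, a sequence $(w_\epsilon)_\epsilon$ in $L^r(\mathbb T^d)$ is said to (weakly) two-scale converge to $w\in L^r(\mathbb T^d\times\mathcal Y^d)$ in $L^r(\mathbb T^d\times\mathcal Y^d)$, written $w_\epsilon\overset{2}{\rightharpoonup}w$, if for all $\psi\in C^\infty(\mathbb T^d;C^\infty_\#(\mathcal Y^d))$ $$\lim_{\epsilon\to0}\int_{\mathbb T^d}w_\epsilon(x)\,\psi\Big(x,\frac x\epsilon\Big)dx=\int_{\mathbb T^d}\int_{\mathcal Y^d}w(x,y)\,\psi(x,y)\,dy\,dx;$$ for vector-valued sequences this is understood componentwise. Then there exist $\alpha\in(0,1)$, $u_0\in C^{0,\alpha}(\mathbb T^d)\cap W^{1,q}(\mathbb T^d)$ with $\int_{\mathbb T^d}u_0\,dx=0$, $u_1\in L^q(\mathbb T^d;W^{1,q}_\#(\mathcal Y^d)/\mathbb R)$, $m\in L^1(\mathbb T^d\times\mathcal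 Y^d)$ with $\int_{\mathbb T^d}\int_{\mathcal Y^d}m(x,y)\,dy\,dx=1$, and $\overline H(P)\in\mathbb R$ such that, along a common subsequence of $\epsilon\to0$, $$u_\epsilon\to u_0\ \text{in }L^\infty(\mathbb T^d),\qquad u_\epsilon\rightharpoonup u_0\ \text{weakly in }W^{1,q}(\mathbb T^d),$$ $$\nabla u_\epsilon\overset{2}{\rightharpoonup}\nabla u_0+\nabla_yu_1\ \text{in }[L^q(\mathbb T^d\times\mathcal Y^d)]^d,$$ $$m_\epsilon\overset{2}{\rightharpoonup}m\ \text{in }L^1(\mathbb T^d\times\mathcal Y^d),\qquad m_\epsilon\rightharpoonup\int_{\mathcal Y^d}m(\cdot,y)\,dy\ \text{weakly in }L^1(\mathbb T^d),$$ $$\overline H_\epsilon(P)\to\overline H(P)\ \text{in }\mathbb R.$$ -/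

import Mathlib

open MeasureTheory Filter Topology
open scoped ENNReal NNReal ContDiff

noncomputable section

namespace TwoScaleMFG

/-- `ℝ^d` with its Euclidean norm. Functions on the torus `𝕋^d = ℝ^d / ℤ^d` are regarded as
`ℤ^d`-periodic functions on `ℝ^d`. -/
abbrev Euc (d : ℕ) := EuclideanSpace ℝ (Fin d)

/-- The cell `[0,1)^d`. It is both the reference cell `𝒴^d` and the fundamental domain
used for integration over `𝕋^d`. -/
def cell (d : ℕ) : Set (Euc d) := {x | ∀ i, x i ∈ Set.Ico (0 : ℝ) 1}

/-- Lebesgue measure on the unit cell. -/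
def cellVol (d : ℕ) : Measure (Euc d) := volume.restrict (cell d)

/-- `ℤ^d`-periodicity. -/
def IsPeriodic {d : ℕ} {β : Type*} (f : Euc d → β) : Prop :=
  ∀ (i : Fin d) (x : Euc d), f (x + EuclideanSpace.single i 1) = f x

/-- Smooth `ℤ^d`-periodic functions: `C^∞(𝕋^d)`, equivalently `C^∞_#(𝒴^d)`. -/
structure SmoothPeriodic {d : ℕ} (f : Euc d → ℝ) : Prop where
  smooth : ContDiff ℝ ∞ f
  periodic : IsPeriodic f

/-- Functions of `(x, y)` that are smooth and periodic in each of the two variables: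
`C^∞(𝕋^d; C^∞_#(𝒴^d))`. -/
structure SmoothPeriodic₂ {d : ℕ} (ψ : Euc d × Euc d → ℝ) : Prop where
  smooth : ContDiff ℝ ∞ ψ
  periodic_fst : ∀ y, IsPeriodic fun x => ψ (x, y)
  periodic_snd : ∀ x, IsPeriodic fun y => ψ (x, y)

/-- Divergence of a vector field on `ℝ^d`. -/
def divergence {d : ℕ} (F : Euc d → Euc d) (x : Euc d) : ℝ :=
  ∑ i, fderiv ℝ (fun z => F z i) x (EuclideanSpace.single i 1)

/-- `(u, m, H)` is a smooth solution, with `m > 0`, of the mean-field game on the torus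
`|P + ∇u|²/2 + V(x, x/ε) = ln m + H`, `-div (m (P + ∇u)) = 0`, `∫ u = 0`, `∫ m = 1`.
The first equation is imposed on the fundamental domain `[0,1)^d`, since `x/ε` depends on the
representative of a point of the torus when `1/ε` is not an integer. -/
structure SolvesMFG {d : ℕ} (V : Euc d × Euc d → ℝ) (P : Euc d) (ε : ℝ)
    (u m : Euc d → ℝ) (H : ℝ) : Prop where
  smooth_u : SmoothPeriodic u
  smooth_m : SmoothPeriodic m
  m_pos : ∀ x, 0 < m x
  hamilton_jacobi : ∀ x ∈ cell d,
    ‖P + gradient u x‖ ^ 2 / 2 + V (x, ε⁻¹ • x) = Real.log (m x) + H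
  fokker_planck : ∀ x, -divergence (fun z => m z • (P + gradient u z)) x = 0
  integral_u : ∫ x, u x ∂cellVol d = 0
  integral_m : ∫ x, m x ∂cellVol d = 1

/-- `u ∈ W^{1,q}(𝕋^d)` with weak gradient `g`. -/
structure MemSobolev {d : ℕ} (q : ℝ≥0∞) (u : Euc d → ℝ) (g : Euc d → Euc d) : Prop where
  memLp : MemLp u q (cellVol d)
  memLp_grad : MemLp g q (cellVol d)
  weak_grad : ∀ φ : Euc d → ℝ, SmoothPeriodic φ → ∀ i,
    ∫ x, u x * gradient φ x i ∂cellVol d = -∫ x, g x i * φ x ∂cellVol d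

/-- `w ∈ W^{1,q}_#(𝒴^d)` with gradient `G`: the pair `(w, G)` lies in the closure of
`{(φ, ∇φ) : φ ∈ C^∞_#(𝒴^d)}` with respect to the `W^{1,q}(𝒴^d)`-norm. -/
structure MemSobolevPer {d : ℕ} (q : ℝ≥0∞) (w : Euc d → ℝ) (G : Euc d → Euc d) : Prop where
  memLp : MemLp w q (cellVol d)
  memLp_grad : MemLp G q (cellVol d)
  approx : ∃ φ : ℕ → Euc d → ℝ, (∀ n, SmoothPeriodic (φ n)) ∧
    Tendsto (fun n => eLpNorm (fun y => φ n y - w y) q (cellVol d)) atTop (𝓝 0) ∧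
    Tendsto (fun n => eLpNorm (fun y => gradient (φ n) y - G y) q (cellVol d)) atTop (𝓝 0)

/-- `w ∈ L^q(𝕋^d; W^{1,q}_#(𝒴^d)/ℝ)` with `∇_y w = G`. The class of `w(x, ·)` modulo constants
is represented by its element of mean zero. -/
structure MemLpSobolevPer {d : ℕ} (q : ℝ≥0∞) (w : Euc d × Euc d → ℝ)
    (G : Euc d × Euc d → Euc d) : Prop where
  memLp : MemLp w q ((cellVol d).prod (cellVol d))
  memLp_grad : MemLp G q ((cellVol d).prod (cellVol d))
  sobolev : ∀ᵐ x ∂cellVol d, MemSobolevPer q (fun y => w (x, y)) (fun y => G (x, y))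
  mean_zero : ∀ᵐ x ∂cellVol d, ∫ y, w (x, y) ∂cellVol d = 0

/-- Weak convergence `f_n ⇀ f` in `L^q(𝕋^d)`, `1 ≤ q < ∞`: convergence of the pairings with
all functions in `L^{q'}(𝕋^d)`, `1/q + 1/q' = 1`. -/
structure WeakLp {d : ℕ} (q : ℝ≥0∞) (f : ℕ → Euc d → ℝ) (f₀ : Euc d → ℝ) : Prop where
  memLp : ∀ n, MemLp (f n) q (cellVol d)
  memLp_lim : MemLp f₀ q (cellVol d)
  tendsto : ∀ q' : ℝ≥0∞, q.HolderConjugate q' → ∀ g : Euc d → ℝ, MemLp g q' (cellVol d) →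
    Tendsto (fun n => ∫ x, f n x * g x ∂cellVol d) atTop (𝓝 (∫ x, f₀ x * g x ∂cellVol d))

/-- Weak convergence in `W^{1,q}(𝕋^d)` of smooth functions `u_n` to a function `u₀` with weak
gradient `g₀`: weak convergence in `L^q` of the functions and of their first derivatives. -/
structure WeakSobolev {d : ℕ} (q : ℝ≥0∞) (u : ℕ → Euc d → ℝ) (u₀ : Euc d → ℝ)
    (g₀ : Euc d → Euc d) : Prop where
  memSobolev : MemSobolev q u₀ g₀
  fn : WeakLp q u u₀
  grad : ∀ i, WeakLp q (fun n x => gradient (u n) x i) (fun x => g₀ x i)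

/-- Weak two-scale convergence of `w_n` (along the scales `ε_n`) to `w` in
`L^q(𝕋^d × 𝒴^d)`. -/
structure TwoScale {d : ℕ} (q : ℝ≥0∞) (ε : ℕ → ℝ) (w : ℕ → Euc d → ℝ)
    (w₀ : Euc d × Euc d → ℝ) : Prop where
  memLp : ∀ n, MemLp (w n) q (cellVol d)
  memLp_lim : MemLp w₀ q ((cellVol d).prod (cellVol d))
  tendsto : ∀ ψ : Euc d × Euc d → ℝ, SmoothPeriodic₂ ψ →
    Tendsto (fun n => ∫ x, w n x * ψ (x, (ε n)⁻¹ • x) ∂cellVol d) atTop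
      (𝓝 (∫ x, ∫ y, w₀ (x, y) * ψ (x, y) ∂cellVol d ∂cellVol d))

end TwoScaleMFG

end

open TwoScaleMFG

/-! Everything rests on bounds uniform in `ε` that use only a bound `M` of `|V|`. Testing the
continuity equation with `u` gives `∫ m (P + ∇u)·∇u = 0`, hence `∫ m |P + ∇u|² ≤ |P|²`. Multiplying
the Hamilton–Jacobi equation by `m` then bounds the entropy `∫ m ln m` in terms of `H`. The
inequalities `ln t ≤ t - 1` and `t ln t ≥ t - 1`, with `∫ m = 1`, confine `H` to a compact interval.
Exponentiating the equation gives `exp (|P + ∇u|²/2) = m exp (H - V)`, whose integral is bounded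
(`SolvesMFG.integral_exp_le`). So every moment of `∇u` is bounded. Morrey's inequality with exponent
`2d` (`abs_sub_le_sqrt`) yields a uniform Hölder-1/2 bound, and Arzelà–Ascoli gives uniform
convergence of `u`.

For two-scale compactness (`exists_subseq_tsConv`), each sequence is truncated at integer heights. A
truncated sequence defines, along a subsequence, a limit functional on continuous functions of `(x,
y)`. Because `∫ Ψ(x, x/ε) → ∫∫ Ψ` (`tendsto_integral_oscillating`), this functional is bounded in
the `L¹` norm, and Hahn–Banach with the Riesz theorem represents it by an `L²` function. Uniformly
small tails make the limits at different heights Cauchy in `L¹`. The tails are controlled by second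
moments for `∇u` and by the entropy for `m`. A convexity argument (`TSConv.memLp`) puts the limit
`W` of `∇u` in every `L^p` with `p < ∞`.

It remains to see that `W` minus its `y`-mean is a `y`-gradient. Integration by parts against `η(x)
θ(x/ε)` shows that `W(x, ·)` is weakly curl free for almost every `x` (`ae_curl_eq`). Convolution
with powers of a trigonometric peak turns it into smooth curl-free fields while involving only
countably many test functions, so one null set of `x` suffices (`exists_mollifier`). A mean-zero
smooth curl-free field has as potential its line integrals averaged over starting points in the cell
(`hasFDerivAt_rayIntegral`). This operator is bounded on `L^q` and makes sense on `(x, y)` jointly,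
so it yields a measurable `u₁` (`exists_memLpSobolevPer`). The `y`-mean of `W` is the weak gradient
of `u₀`. -/

namespace TwoScaleMFG

variable {d : ℕ}

/-! ### The torus as a compact group, and its fundamental domain -/

/-- The torus `ℝ^d / ℤ^d` as a compact group. -/
abbrev Tor (d : ℕ) := Fin d → UnitAddCircle

instance isProbabilityMeasure_unitAddCircle :
    IsProbabilityMeasure (volume : Measure UnitAddCircle) := ⟨UnitAddCircle.measure_univ⟩

instance isProbabilityMeasure_tor (d : ℕ) : IsProbabilityMeasure (volume : Measure (Tor d)) :=
  inferInstanceAs (IsProbabilityMeasure (Measure.pi fun _ => volume))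

instance regular_tor_prod (d : ℕ) :
    ((volume : Measure (Tor d)).prod (volume : Measure (Tor d))).WeaklyRegular := by
  have : IsFiniteMeasure ((volume : Measure (Tor d)).prod (volume : Measure (Tor d))) :=
    inferInstance
  have : BorelSpace (Tor d × Tor d) := inferInstance
  have : TopologicalSpace.PseudoMetrizableSpace (Tor d × Tor d) := inferInstance
  infer_instance

/-- The projection `ℝ^d → 𝕋^d`. -/
def pr (x : Euc d) : Tor d := fun i => (x i : UnitAddCircle)

theorem pr_add (x y : Euc d) : pr (x + y) = pr x + pr y := by
  ext i; simp [pr]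

theorem pr_sub (x y : Euc d) : pr (x - y) = pr x - pr y := by
  ext i; simp [pr]

theorem isOpenQuotientMap_pr : IsOpenQuotientMap (pr : Euc d → Tor d) := by
  have h1 : IsOpenQuotientMap (Pi.map (fun (_ : Fin d) (t : ℝ) => (t : UnitAddCircle))) :=
    IsOpenQuotientMap.piMap fun _ => QuotientAddGroup.isOpenQuotientMap_mk
  exact h1.comp (PiLp.homeomorph 2 (fun _ : Fin d => ℝ)).isOpenQuotientMap

@[fun_prop]
theorem continuous_pr : Continuous (pr : Euc d → Tor d) := isOpenQuotientMap_pr.continuous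

theorem measurable_pr : Measurable (pr : Euc d → Tor d) := continuous_pr.measurable

theorem pr_surjective : Function.Surjective (pr : Euc d → Tor d) := isOpenQuotientMap_pr.surjective

theorem cell_eq_preimage :
    cell d = WithLp.ofLp ⁻¹' (Set.univ.pi fun _ : Fin d => Set.Ico (0 : ℝ) 1) := by
  ext x; simp [cell]

theorem measurableSet_cell : MeasurableSet (cell d) := by
  rw [cell_eq_preimage]
  exact (PiLp.volume_preserving_ofLp (Fin d)).measurable
    (MeasurableSet.univ_pi fun _ => measurableSet_Ico)

theorem measurePreserving_pr : MeasurePreserving (pr : Euc d → Tor d) (cellVol d) volume := by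
  have h1 : MeasurePreserving (WithLp.ofLp : Euc d → Fin d → ℝ) (cellVol d)
      (Measure.pi fun _ => volume.restrict (Set.Ioc (0 : ℝ) (0 + 1))) := by
    have := (PiLp.volume_preserving_ofLp (Fin d)).restrict_preimage
      (MeasurableSet.univ_pi fun _ : Fin d => measurableSet_Ico (a := (0 : ℝ)) (b := 1))
    rw [← cell_eq_preimage, volume_pi, Measure.restrict_pi_pi] at this
    -- The cell is closed on the left, while the fundamental interval of the circle is `Ioc`; they
    -- differ by a null set.
    simp only [restrict_Ico_eq_restrict_Ioc] at this
    rw [zero_add]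
    exact this
  have h2 := measurePreserving_pi (fun _ : Fin d => volume.restrict (Set.Ioc (0 : ℝ) (0 + 1)))
    (fun _ => (volume : Measure UnitAddCircle)) fun _ => UnitAddCircle.measurePreserving_mk 0
  exact h2.comp h1

instance isProbabilityMeasure_cellVol : IsProbabilityMeasure (cellVol d) := by
  refine ⟨?_⟩
  have := (measurePreserving_pr (d := d)).measure_preimage (s := Set.univ) nullMeasurableSet_univ
  simpa using this

theorem measurePreserving_pr_prod :
    MeasurePreserving (Prod.map pr pr : Euc d × Euc d → Tor d × Tor d)
      ((cellVol d).prod (cellVol d)) (volume.prod volume) :=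
  measurePreserving_pr.prod measurePreserving_pr

theorem measurePreserving_pr_add (a : Tor d) :
    MeasurePreserving (fun x : Euc d => pr x + a) (cellVol d) volume :=
  (measurePreserving_add_right volume a).comp measurePreserving_pr

instance isNegInvariant_tor : (volume : Measure (Tor d)).IsNegInvariant := by
  have : (volume : Measure (Tor d)).Regular := inferInstance
  exact Measure.IsAddHaarMeasure.isNegInvariant_of_regular _

theorem measurePreserving_sub_pr (a : Tor d) :
    MeasurePreserving (fun x : Euc d => a - pr x) (cellVol d) volume :=
  (Measure.measurePreserving_sub_left volume a).comp measurePreserving_pr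

theorem _root_.MeasureTheory.MeasurePreserving.integral_comp_of_aesm {α β E : Type*}
    [MeasurableSpace α] [MeasurableSpace β] [NormedAddCommGroup E] [NormedSpace ℝ E]
    {μ : Measure α} {ν : Measure β} {φ : α → β} (h : MeasurePreserving φ μ ν) {f : β → E}
    (hf : AEStronglyMeasurable f ν) : ∫ x, f (φ x) ∂μ = ∫ y, f y ∂ν := by
  rw [← h.map_eq, integral_map h.aemeasurable (by rwa [h.map_eq])]

/-! ### Periodic functions -/

/-- `IsPeriodic` only gives unit shifts along one axis. Induction on integers gives multiples of one
basis vector, induction on sets of coordinates gives every lattice vector, and points with the same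
projection differ by a lattice vector. -/
theorem IsPeriodic.eq_of_pr_eq {β : Type*} {f : Euc d → β} (hf : IsPeriodic f) {x y : Euc d}
    (h : pr x = pr y) : f x = f y := by
  have hz : ∀ (i : Fin d) (n : ℤ) (x : Euc d),
      f (x + (n : ℝ) • EuclideanSpace.single i 1) = f x := by
    intro i n
    induction n using Int.induction_on with
    | zero => intro x; simp
    | succ n ih =>
      intro x
      rw [show x + (((n : ℤ) + 1 : ℤ) : ℝ) • EuclideanSpace.single i (1 : ℝ)
        = (x + ((n : ℤ) : ℝ) • EuclideanSpace.single i (1 : ℝ)) + EuclideanSpace.single i 1 by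
          push_cast; rw [add_smul, one_smul, add_assoc], hf, ih]
    | pred n ih =>
      intro x
      rw [← hf i, ← ih x]
      congr 1
      push_cast
      rw [sub_smul, one_smul]
      abel
  have hfin : ∀ (n : Fin d → ℤ) (s : Finset (Fin d)) (x : Euc d),
      f (x + ∑ i ∈ s, (n i : ℝ) • EuclideanSpace.single i 1) = f x := by
    intro n s
    induction s using Finset.induction_on with
    | empty => intro x; simp
    | insert i s hi ih =>
      intro x
      rw [Finset.sum_insert hi, ← add_assoc, ih, hz]
  have hn : ∀ i, ∃ n : ℤ, y i = x i + n := by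
    intro i
    have h1 : ((x i : ℝ) : UnitAddCircle) = (y i : ℝ) := congrFun h i
    rw [eq_comm, QuotientAddGroup.eq_iff_sub_mem, AddSubgroup.mem_zmultiples_iff] at h1
    obtain ⟨k, hk⟩ := h1
    exact ⟨k, by simp at hk; linarith⟩
  choose n hn using hn
  rw [← hfin n Finset.univ x]
  congr 1
  ext j
  simp [hn, Pi.single_apply]

theorem IsPeriodic.comp_pr {β : Type*} (F : Tor d → β) : IsPeriodic fun x => F (pr x) := by
  intro i x
  show F _ = F _
  congr 1
  ext j
  by_cases h : j = i
  · subst h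
    simp only [pr, PiLp.add_apply, PiLp.single_apply, if_true, AddCircle.coe_add,
      AddCircle.coe_period, add_zero]
  · simp [pr, h]

theorem IsPeriodic.exists_lift {f : Euc d → ℝ} (hf : IsPeriodic f) (hc : Continuous f) :
    ∃ F : C(Tor d, ℝ), ∀ x, F (pr x) = f x := by
  obtain ⟨F, hF⟩ : ∃ F : Tor d → ℝ, ∀ x, F (pr x) = f x := by
    choose s hs using pr_surjective (d := d)
    exact ⟨fun a => f (s a), fun x => hf.eq_of_pr_eq (hs _)⟩
  refine ⟨⟨F, ?_⟩, hF⟩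
  rw [isOpenQuotientMap_pr.isQuotientMap.continuous_iff]
  exact hc.congr fun x => (hF x).symm

theorem exists_lift₂ {f : Euc d × Euc d → ℝ} (hc : Continuous f)
    (h₁ : ∀ y, IsPeriodic fun x => f (x, y)) (h₂ : ∀ x, IsPeriodic fun y => f (x, y)) :
    ∃ F : C(Tor d × Tor d, ℝ), ∀ x y, F (pr x, pr y) = f (x, y) := by
  obtain ⟨F, hF⟩ : ∃ F : Tor d × Tor d → ℝ, ∀ x y, F (pr x, pr y) = f (x, y) := by
    choose s hs using pr_surjective (d := d)
    refine ⟨fun a => f (s a.1, s a.2), fun x y => ?_⟩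
    exact ((h₁ (s (pr y))).eq_of_pr_eq (hs (pr x))).trans ((h₂ x).eq_of_pr_eq (hs (pr y)))
  refine ⟨⟨F, ?_⟩, hF⟩
  rw [(isOpenQuotientMap_pr.prodMap isOpenQuotientMap_pr).isQuotientMap.continuous_iff]
  exact hc.congr fun x => (hF x.1 x.2).symm

theorem IsPeriodic.exists_bound {f : Euc d → ℝ} (hf : IsPeriodic f) (hc : Continuous f) :
    ∃ C, ∀ x, |f x| ≤ C := by
  obtain ⟨F, hF⟩ := hf.exists_lift hc
  exact ⟨‖F‖, fun x => by rw [← hF]; exact F.norm_coe_le_norm _⟩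

/-- The cell itself is not translation invariant; the integral is moved to the torus, where Haar
measure is. -/
theorem IsPeriodic.integral_shift {f : Euc d → ℝ} (hf : IsPeriodic f) (hc : Continuous f)
    (s : Euc d) : ∫ x, f (x + s) ∂cellVol d = ∫ x, f x ∂cellVol d := by
  obtain ⟨F, hF⟩ := hf.exists_lift hc
  have h1 := (measurePreserving_pr_add (pr s)).integral_comp_of_aesm
    F.continuous.aestronglyMeasurable
  have h2 := (measurePreserving_pr (d := d)).integral_comp_of_aesm
    F.continuous.aestronglyMeasurable
  simp only [← pr_add, hF] at h1 h2
  rw [h1, h2]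

theorem IsPeriodic.integral_sub {f : Euc d → ℝ} (hf : IsPeriodic f) (hc : Continuous f)
    (s : Euc d) : ∫ x, f (s - x) ∂cellVol d = ∫ x, f x ∂cellVol d := by
  obtain ⟨F, hF⟩ := hf.exists_lift hc
  have h1 := (measurePreserving_sub_pr (pr s)).integral_comp_of_aesm
    F.continuous.aestronglyMeasurable
  have h2 := (measurePreserving_pr (d := d)).integral_comp_of_aesm
    F.continuous.aestronglyMeasurable
  simp only [← pr_sub, hF] at h1 h2
  rw [h1, h2]

theorem norm_le_of_mem_cell {x : Euc d} (hx : x ∈ cell d) (i : Fin d) : |x i| ≤ 1 := by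
  have := hx i
  rw [abs_of_nonneg this.1]; exact this.2.le

theorem norm_cell_le {x : Euc d} (hx : x ∈ cell d) : ‖x‖ ≤ √d := by
  rw [EuclideanSpace.norm_eq]
  apply Real.sqrt_le_sqrt
  calc ∑ i, ‖x i‖ ^ 2 ≤ ∑ _i : Fin d, (1 : ℝ) := Finset.sum_le_sum fun i _ => by
        have := norm_le_of_mem_cell hx i
        rw [Real.norm_eq_abs]; nlinarith [abs_nonneg (x i)]
    _ = d := by simp

theorem ae_mem_cell : ∀ᵐ x ∂cellVol d, x ∈ cell d := ae_restrict_mem measurableSet_cell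

theorem _root_.Continuous.memLp_cellVol {E : Type*} [NormedAddCommGroup E] {f : Euc d → E}
    (hf : Continuous f) (p : ℝ≥0∞) : MemLp f p (cellVol d) := by
  have hK : IsCompact (Metric.closedBall (0 : Euc d) (√d)) := isCompact_closedBall _ _
  obtain ⟨C, hC⟩ := hK.exists_bound_of_continuousOn hf.continuousOn
  refine MemLp.of_bound hf.aestronglyMeasurable C ?_
  filter_upwards [ae_mem_cell] with x hx
  exact hC x (by simpa using norm_cell_le hx)

theorem _root_.Continuous.integrable_cellVol {E : Type*} [NormedAddCommGroup E] {f : Euc d → E}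
    (hf : Continuous f) : Integrable f (cellVol d) :=
  memLp_one_iff_integrable.1 (hf.memLp_cellVol 1)

/-! ### Derivatives of periodic functions -/

/-- The `i`-th partial derivative. -/
noncomputable def pd (i : Fin d) (f : Euc d → ℝ) (x : Euc d) : ℝ :=
  fderiv ℝ f x (EuclideanSpace.single i 1)

theorem gradient_apply (f : Euc d → ℝ) (x : Euc d) (i : Fin d) : gradient f x i = pd i f x := by
  have h : inner ℝ (gradient f x) (EuclideanSpace.single i (1 : ℝ)) = pd i f x := by
    simp [gradient, pd]
  rw [← h, EuclideanSpace.inner_single_right]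
  simp

theorem contDiff_pd {f : Euc d → ℝ} (hf : ContDiff ℝ ∞ f) (i : Fin d) : ContDiff ℝ ∞ (pd i f) :=
  (hf.fderiv_right (m := ∞) (by simp)).clm_apply contDiff_const

theorem IsPeriodic.pd {f : Euc d → ℝ} (hf : IsPeriodic f) (i : Fin d) : IsPeriodic (pd i f) := by
  intro j x
  unfold TwoScaleMFG.pd
  rw [← fderiv_comp_add_right]
  congr 2
  ext y
  exact hf j y

theorem SmoothPeriodic.pd {f : Euc d → ℝ} (hf : SmoothPeriodic f) (i : Fin d) :
    SmoothPeriodic (pd i f) := ⟨contDiff_pd hf.smooth i, hf.periodic.pd i⟩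

theorem SmoothPeriodic.continuous {f : Euc d → ℝ} (hf : SmoothPeriodic f) : Continuous f :=
  hf.smooth.continuous

theorem SmoothPeriodic.differentiable {f : Euc d → ℝ} (hf : SmoothPeriodic f) :
    Differentiable ℝ f := hf.smooth.differentiable (by simp)

theorem SmoothPeriodic.mul {f g : Euc d → ℝ} (hf : SmoothPeriodic f) (hg : SmoothPeriodic g) :
    SmoothPeriodic fun x => f x * g x :=
  ⟨hf.smooth.mul hg.smooth, fun i x => by rw [hf.periodic, hg.periodic]⟩

theorem SmoothPeriodic.add {f g : Euc d → ℝ} (hf : SmoothPeriodic f) (hg : SmoothPeriodic g) :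
    SmoothPeriodic fun x => f x + g x :=
  ⟨hf.smooth.add hg.smooth, fun i x => by rw [hf.periodic, hg.periodic]⟩

theorem SmoothPeriodic.const (c : ℝ) : SmoothPeriodic fun _ : Euc d => c :=
  ⟨contDiff_const, fun _ _ => rfl⟩

theorem pd_mul {f g : Euc d → ℝ} {x : Euc d} (hf : DifferentiableAt ℝ f x)
    (hg : DifferentiableAt ℝ g x) (i : Fin d) :
    pd i (fun x => f x * g x) x = pd i f x * g x + f x * pd i g x := by
  unfold pd
  rw [fderiv_fun_mul hf hg]
  simp
  ring

/-- Fundamental theorem of calculus along a segment. -/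
theorem sub_eq_integral_fderiv {f : Euc d → ℝ} (hf : ContDiff ℝ 1 f) (x v : Euc d) :
    f (x + v) - f x = ∫ t in (0 : ℝ)..1, fderiv ℝ f (x + t • v) v := by
  have hd : ∀ t : ℝ, HasDerivAt (fun t : ℝ => f (x + t • v)) (fderiv ℝ f (x + t • v) v) t := by
    intro t
    have h1 : HasDerivAt (fun t : ℝ => x + t • v) v t := by
      simpa using ((hasDerivAt_id t).smul_const v).const_add x
    exact ((hf.differentiable (by simp)) _).hasFDerivAt.comp_hasDerivAt t h1
  rw [intervalIntegral.integral_eq_sub_of_hasDerivAt (fun t _ => hd t)]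
  · simp
  · apply Continuous.intervalIntegrable
    exact ((hf.continuous_fderiv (by simp)).comp (by fun_prop)).clm_apply continuous_const

/-- No boundary terms are needed: `0 = f (x + e) - f x` is the integral of the partial derivative
along a unit segment. After integrating in `x` and exchanging integrals, every time `t` contributes
the same amount by shift invariance. -/
theorem integral_pd_eq_zero {f : Euc d → ℝ} (hf : SmoothPeriodic f) (i : Fin d) :
    ∫ x, pd i f x ∂cellVol d = 0 := by
  set e : Euc d := EuclideanSpace.single i 1
  have h0 : ∫ x, (f (x + e) - f x) ∂cellVol d = 0 := by
    simp [e, hf.periodic i]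
  have hcont : Continuous (Function.uncurry fun (x : Euc d) (t : ℝ) => pd i f (x + t • e)) :=
    (hf.pd i).continuous.comp (by fun_prop)
  have h1 : ∫ x, (f (x + e) - f x) ∂cellVol d
      = ∫ x, (∫ t in (0 : ℝ)..1, pd i f (x + t • e)) ∂cellVol d := by
    congr 1; ext x
    exact sub_eq_integral_fderiv (hf.smooth.of_le (by simp)) x e
  rw [h0] at h1
  simp only [intervalIntegral.integral_of_le zero_le_one] at h1
  rw [integral_integral_swap] at h1
  · simp only [(hf.pd i).periodic.integral_shift (hf.pd i).continuous] at h1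
    simpa using h1.symm
  · obtain ⟨C, hC⟩ := (hf.pd i).periodic.exists_bound (hf.pd i).continuous
    exact Integrable.of_bound hcont.aestronglyMeasurable C (ae_of_all _ fun z => hC _)

theorem integral_mul_pd {f g : Euc d → ℝ} (hf : SmoothPeriodic f) (hg : SmoothPeriodic g)
    (i : Fin d) : ∫ x, f x * pd i g x ∂cellVol d = -∫ x, pd i f x * g x ∂cellVol d := by
  have h := integral_pd_eq_zero (hf.mul hg) i
  simp only [pd_mul (hf.differentiable _) (hg.differentiable _)] at h
  rw [integral_add ((hf.pd i).mul hg).continuous.integrable_cellVol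
    (hf.mul (hg.pd i)).continuous.integrable_cellVol] at h
  linarith

/-! ### A priori bounds -/

theorem continuous_gradient {u : Euc d → ℝ} (hu : ContDiff ℝ ∞ u) : Continuous (gradient u) := by
  unfold gradient
  exact (LinearIsometryEquiv.continuous _).comp (hu.continuous_fderiv (by simp))

theorem SmoothPeriodic₂.exists_bound {V : Euc d × Euc d → ℝ} (hV : SmoothPeriodic₂ V) :
    ∃ M, ∀ z, |V z| ≤ M := by
  obtain ⟨F, hF⟩ := exists_lift₂ hV.smooth.continuous hV.periodic_fst hV.periodic_snd
  exact ⟨‖F‖, fun z => by rw [← hF z.1 z.2]; exact F.norm_coe_le_norm _⟩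

namespace SolvesMFG

variable {V : Euc d × Euc d → ℝ} {P : Euc d} {ε : ℝ} {u m : Euc d → ℝ} {H : ℝ}

/-- This is the continuity equation tested with `u` itself. -/
theorem integral_flux_inner_gradient (h : SolvesMFG V P ε u m H) :
    ∫ x, m x * inner ℝ (P + gradient u x) (gradient u x) ∂cellVol d = 0 := by
  have hF : ∀ i, SmoothPeriodic fun x => m x * (P i + pd i u x) := fun i =>
    h.smooth_m.mul ((SmoothPeriodic.const (P i)).add (h.smooth_u.pd i))
  have hdiv : ∀ x, ∑ i, pd i (fun x => m x * (P i + pd i u x)) x = 0 := by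
    intro x
    have := h.fokker_planck x
    simpa only [divergence, neg_eq_zero, PiLp.smul_apply, PiLp.add_apply, gradient_apply,
      smul_eq_mul, pd] using this
  have hgi : ∀ i, Integrable (fun x => pd i u x * (m x * (P i + pd i u x))) (cellVol d) :=
    fun i => ((h.smooth_u.pd i).mul (hF i)).continuous.integrable_cellVol
  have hgi' : ∀ i, Integrable (fun x => u x * pd i (fun x => m x * (P i + pd i u x)) x)
      (cellVol d) := fun i => (h.smooth_u.mul ((hF i).pd i)).continuous.integrable_cellVol
  calc ∫ x, m x * inner ℝ (P + gradient u x) (gradient u x) ∂cellVol d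
      = ∫ x, ∑ i, pd i u x * (m x * (P i + pd i u x)) ∂cellVol d := by
        congr 1; ext x
        simp only [PiLp.inner_apply, PiLp.add_apply, gradient_apply, Finset.mul_sum]
        refine Finset.sum_congr rfl fun i _ => ?_
        simp
        ring
    _ = ∑ i, ∫ x, pd i u x * (m x * (P i + pd i u x)) ∂cellVol d :=
        integral_finsetSum _ fun i _ => hgi i
    _ = -∑ i, ∫ x, u x * pd i (fun x => m x * (P i + pd i u x)) x ∂cellVol d := by
        rw [← Finset.sum_neg_distrib]
        refine Finset.sum_congr rfl fun i _ => ?_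
        rw [integral_mul_pd h.smooth_u (hF i), neg_neg]
    _ = -∫ x, u x * ∑ i, pd i (fun x => m x * (P i + pd i u x)) x ∂cellVol d := by
        simp only [Finset.mul_sum]
        rw [integral_finsetSum _ fun i _ => hgi' i]
    _ = 0 := by simp [hdiv]

/-- By the orthogonality just proved the left side equals `∫ m (P + ∇u)·P`. Young's inequality
absorbs half of it, and `∫ m = 1` evaluates the rest. -/
theorem integral_mul_norm_sq_le (h : SolvesMFG V P ε u m H) :
    ∫ x, m x * ‖P + gradient u x‖ ^ 2 ∂cellVol d ≤ ‖P‖ ^ 2 := by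
  have hm := h.smooth_m.continuous
  have hg := continuous_gradient h.smooth_u.smooth
  have hQ : Integrable (fun x => m x * ‖P + gradient u x‖ ^ 2) (cellVol d) :=
    Continuous.integrable_cellVol (by fun_prop)
  have h1 : ∫ x, m x * ‖P + gradient u x‖ ^ 2 ∂cellVol d
      = ∫ x, m x * inner ℝ (P + gradient u x) P ∂cellVol d := by
    have h2 : ∫ x, m x * inner ℝ (P + gradient u x) P ∂cellVol d
        + ∫ x, m x * inner ℝ (P + gradient u x) (gradient u x) ∂cellVol d
        = ∫ x, m x * ‖P + gradient u x‖ ^ 2 ∂cellVol d := by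
      rw [← integral_add (Continuous.integrable_cellVol (by fun_prop))
        (Continuous.integrable_cellVol (by fun_prop))]
      congr 1; ext x
      rw [← mul_add, ← inner_add_right, real_inner_self_eq_norm_sq]
    rw [h.integral_flux_inner_gradient, add_zero] at h2
    exact h2.symm
  have h3 : ∫ x, m x * inner ℝ (P + gradient u x) P ∂cellVol d
      ≤ ∫ x, (2⁻¹ * (m x * ‖P + gradient u x‖ ^ 2) + 2⁻¹ * ‖P‖ ^ 2 * m x) ∂cellVol d := by
    refine integral_mono (Continuous.integrable_cellVol (by fun_prop))
      (Continuous.integrable_cellVol (by fun_prop)) fun x => ?_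
    have h4 := real_inner_le_norm (P + gradient u x) P
    have h5 : inner ℝ (P + gradient u x) P ≤ 2⁻¹ * ‖P + gradient u x‖ ^ 2 + 2⁻¹ * ‖P‖ ^ 2 := by
      nlinarith [sq_nonneg (‖P + gradient u x‖ - ‖P‖)]
    have := mul_le_mul_of_nonneg_left h5 (h.m_pos x).le
    simp only
    linarith
  rw [integral_add (hQ.const_mul _) (hm.integrable_cellVol.const_mul _), integral_const_mul,
    integral_const_mul, h.integral_m] at h3
  linarith

/-- Drop the square in the equation and use `ln m ≤ m - 1`, whose right side has integral zero. -/
theorem neg_le_H (h : SolvesMFG V P ε u m H) {M : ℝ} (hM : ∀ z, |V z| ≤ M) : -M ≤ H := by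
  have hm := h.smooth_m.continuous
  have h1 : ∫ x, (-M + 1 - m x) ∂cellVol d ≤ ∫ _, H ∂cellVol d := by
    refine integral_mono_ae (Continuous.integrable_cellVol (by fun_prop))
      (Continuous.integrable_cellVol (by fun_prop)) ?_
    filter_upwards [ae_mem_cell] with x hx
    have h2 := h.hamilton_jacobi x hx
    have h3 := Real.log_le_sub_one_of_pos (h.m_pos x)
    have h4 := (abs_le.1 (hM (x, ε⁻¹ • x))).1
    nlinarith [sq_nonneg ‖P + gradient u x‖]
  rw [integral_sub (integrable_const _) hm.integrable_cellVol, h.integral_m] at h1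
  simp at h1
  linarith

theorem integral_mul_log_le (h : SolvesMFG V P ε u m H) {M : ℝ} (hM : ∀ z, |V z| ≤ M) :
    ∫ x, m x * Real.log (m x) ∂cellVol d ≤ ‖P‖ ^ 2 / 2 + M - H := by
  have hm := h.smooth_m.continuous
  have hg := continuous_gradient h.smooth_u.smooth
  have hlog : Continuous fun x => Real.log (m x) := hm.log fun x => (h.m_pos x).ne'
  have hQ : Integrable (fun x => m x * ‖P + gradient u x‖ ^ 2) (cellVol d) :=
    Continuous.integrable_cellVol (by fun_prop)
  have h1 : ∫ x, m x * Real.log (m x) ∂cellVol d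
      ≤ ∫ x, (2⁻¹ * (m x * ‖P + gradient u x‖ ^ 2) + (M - H) * m x) ∂cellVol d := by
    refine integral_mono_ae (Continuous.integrable_cellVol (by fun_prop))
      (Continuous.integrable_cellVol (by fun_prop)) ?_
    filter_upwards [ae_mem_cell] with x hx
    have h2 := h.hamilton_jacobi x hx
    have h4 := (abs_le.1 (hM (x, ε⁻¹ • x))).2
    have h5 : Real.log (m x) ≤ 2⁻¹ * ‖P + gradient u x‖ ^ 2 + (M - H) := by linarith
    have := mul_le_mul_of_nonneg_left h5 (h.m_pos x).le
    linarith
  rw [integral_add (hQ.const_mul _) (hm.integrable_cellVol.const_mul _), integral_const_mul,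
    integral_const_mul, h.integral_m] at h1
  linarith [h.integral_mul_norm_sq_le]

/-- The entropy is nonnegative because `t ln t ≥ t - 1` and `∫ m = 1`; compare with its upper bound.
-/
theorem H_le (h : SolvesMFG V P ε u m H) {M : ℝ} (hM : ∀ z, |V z| ≤ M) :
    H ≤ ‖P‖ ^ 2 / 2 + M := by
  have hm := h.smooth_m.continuous
  have hlog : Continuous fun x => Real.log (m x) := hm.log fun x => (h.m_pos x).ne'
  have h1 : ∫ x, (m x - 1) ∂cellVol d ≤ ∫ x, m x * Real.log (m x) ∂cellVol d := by
    refine integral_mono (Continuous.integrable_cellVol (by fun_prop))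
      (Continuous.integrable_cellVol (by fun_prop)) fun x => ?_
    have h2 := Real.one_sub_inv_le_log_of_pos (h.m_pos x)
    have h3 := mul_le_mul_of_nonneg_left h2 (h.m_pos x).le
    rwa [mul_sub, mul_inv_cancel₀ (h.m_pos x).ne', mul_one] at h3
  rw [integral_sub hm.integrable_cellVol (integrable_const _), h.integral_m] at h1
  simp at h1
  linarith [h.integral_mul_log_le hM]

/-- The exponential of the equation is linear in `m`, so the mass constraint alone controls the
integral. The constant collects the upper bound of `H` and one more `M` from `-V`. -/
theorem integral_exp_le (h : SolvesMFG V P ε u m H) {M : ℝ} (hM : ∀ z, |V z| ≤ M) :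
    ∫ x, Real.exp (‖P + gradient u x‖ ^ 2 / 2) ∂cellVol d ≤ Real.exp (‖P‖ ^ 2 / 2 + 2 * M) := by
  have hm := h.smooth_m.continuous
  have hg := continuous_gradient h.smooth_u.smooth
  calc ∫ x, Real.exp (‖P + gradient u x‖ ^ 2 / 2) ∂cellVol d
      ≤ ∫ x, Real.exp (‖P‖ ^ 2 / 2 + 2 * M) * m x ∂cellVol d := by
        refine integral_mono_ae (Continuous.integrable_cellVol (by fun_prop))
          (Continuous.integrable_cellVol (by fun_prop)) ?_
        filter_upwards [ae_mem_cell] with x hx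
        have h2 := h.hamilton_jacobi x hx
        have h4 := (abs_le.1 (hM (x, ε⁻¹ • x))).1
        have h5 := h.H_le hM
        calc Real.exp (‖P + gradient u x‖ ^ 2 / 2)
            ≤ Real.exp ((‖P‖ ^ 2 / 2 + 2 * M) + Real.log (m x)) :=
              Real.exp_le_exp.2 (by linarith)
          _ = _ := by rw [Real.exp_add, Real.exp_log (h.m_pos x)]
    _ = _ := by rw [integral_const_mul, h.integral_m, mul_one]

theorem integral_norm_gradient_pow_le (h : SolvesMFG V P ε u m H) {M : ℝ}
    (hM : ∀ z, |V z| ≤ M) (r : ℕ) :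
    ∫ x, ‖gradient u x‖ ^ (2 * r) ∂cellVol d
      ≤ 2 ^ (2 * r - 1) *
        (2 ^ r * r.factorial * Real.exp (‖P‖ ^ 2 / 2 + 2 * M) + ‖P‖ ^ (2 * r)) := by
  have hg := continuous_gradient h.smooth_u.smooth
  have hexp : Integrable (fun x => Real.exp (‖P + gradient u x‖ ^ 2 / 2)) (cellVol d) :=
    Continuous.integrable_cellVol (by fun_prop)
  calc ∫ x, ‖gradient u x‖ ^ (2 * r) ∂cellVol d
      ≤ ∫ x, 2 ^ (2 * r - 1) * (2 ^ r * r.factorial * Real.exp (‖P + gradient u x‖ ^ 2 / 2)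
          + ‖P‖ ^ (2 * r)) ∂cellVol d := by
        refine integral_mono (Continuous.integrable_cellVol (by fun_prop))
          (Continuous.integrable_cellVol (by fun_prop)) fun x => ?_
        have h1 : ‖gradient u x‖ ≤ ‖P + gradient u x‖ + ‖P‖ := by
          have := norm_sub_le (P + gradient u x) P
          simpa using this
        have h2 : ‖P + gradient u x‖ ^ (2 * r)
            ≤ 2 ^ r * r.factorial * Real.exp (‖P + gradient u x‖ ^ 2 / 2) := by
          -- One term of the exponential series, `s ^ r / r! ≤ exp s` with `s = |P + ∇u|² / 2`,
          -- bounds the moment of order `2r`.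
          have h3 := Real.pow_div_factorial_le_exp (‖P + gradient u x‖ ^ 2 / 2) (by positivity) r
          rw [div_le_iff₀ (by positivity), div_pow, div_le_iff₀ (by positivity), ← pow_mul] at h3
          linarith
        calc ‖gradient u x‖ ^ (2 * r) ≤ (‖P + gradient u x‖ + ‖P‖) ^ (2 * r) := by gcongr
          _ ≤ 2 ^ (2 * r - 1) * (‖P + gradient u x‖ ^ (2 * r) + ‖P‖ ^ (2 * r)) :=
            add_pow_le (norm_nonneg _) (norm_nonneg _) _
          _ ≤ _ := by gcongr
    _ = 2 ^ (2 * r - 1) * (2 ^ r * r.factorial *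
          ∫ x, Real.exp (‖P + gradient u x‖ ^ 2 / 2) ∂cellVol d + ‖P‖ ^ (2 * r)) := by
        rw [integral_const_mul, integral_add (hexp.const_mul _) (integrable_const _),
          integral_const_mul]
        simp
    _ ≤ _ := by gcongr; exact h.integral_exp_le hM

end SolvesMFG

section

open scoped Pointwise

/-! ### Morrey's inequality on the torus -/

theorem norm_gradient (f : Euc d → ℝ) (x : Euc d) : ‖gradient f x‖ = ‖fderiv ℝ f x‖ := by
  simp [gradient]

theorem abs_fderiv_le (f : Euc d → ℝ) (x v : Euc d) :
    |fderiv ℝ f x v| ≤ ‖v‖ * ‖gradient f x‖ := by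
  rw [norm_gradient, mul_comm]
  exact (fderiv ℝ f x).le_opNorm v

theorem IsPeriodic.norm_gradient {f : Euc d → ℝ} (hf : IsPeriodic f) :
    IsPeriodic fun x => ‖gradient f x‖ := by
  intro i x
  simp only [TwoScaleMFG.norm_gradient]
  rw [← fderiv_comp_add_right]
  congr 2
  ext y
  exact hf i y

/-- Jensen with the power `2d`, then rescaling: since `r ≤ 1`, the scaled cell lies in the cell, at
the cost of the Jacobian `r⁻ᵈ`. Its `2d`-th root is `1 / √r`, the source of the Hölder exponent `1 -
d/(2d) = 1/2`. -/
theorem integral_scaled_le (hd : 0 < d) {g : Euc d → ℝ} (hg : Continuous g) (hg0 : ∀ x, 0 ≤ g x)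
    (hper : IsPeriodic g) {B : ℝ} (hB : 0 ≤ B) (hgi : ∫ x, g x ^ (2 * d) ∂cellVol d ≤ B ^ (2 * d))
    {r : ℝ} (hr : 0 < r) (hr1 : r ≤ 1) (c : Euc d) :
    ∫ s, g (c - r • s) ∂cellVol d ≤ B / √r := by
  have hp : 2 * d ≠ 0 := by omega
  refine le_of_pow_le_pow_left₀ hp (by positivity) ?_
  calc (∫ s, g (c - r • s) ∂cellVol d) ^ (2 * d)
      ≤ ∫ s, g (c - r • s) ^ (2 * d) ∂cellVol d :=
        (convexOn_pow (2 * d)).map_integral_le (continuousOn_pow _) isClosed_Ici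
          (ae_of_all _ fun s => hg0 _) (Continuous.integrable_cellVol (by fun_prop))
          (Continuous.integrable_cellVol (by fun_prop))
    _ = (r ^ d)⁻¹ * ∫ z in r • cell d, g (c - z) ^ (2 * d) := by
        unfold cellVol
        rw [Measure.setIntegral_comp_smul_of_pos volume (fun z => g (c - z) ^ (2 * d)) _ hr]
        simp
    _ ≤ (r ^ d)⁻¹ * ∫ z, g (c - z) ^ (2 * d) ∂cellVol d := by
        refine mul_le_mul_of_nonneg_left ?_ (by positivity)
        refine setIntegral_mono_set (f := fun z => g (c - z) ^ (2 * d)) ?_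
          (ae_of_all _ fun z => pow_nonneg (hg0 _) _) (LE.le.eventuallyLE ?_)
        · exact (Continuous.integrable_cellVol (by fun_prop) :
            Integrable (fun z => g (c - z) ^ (2 * d)) (cellVol d))
        · rintro _ ⟨x, hx, rfl⟩ i
          have := hx i
          simp only [PiLp.smul_apply, smul_eq_mul, Set.mem_Ico]
          exact ⟨mul_nonneg hr.le this.1, by nlinarith [this.1, this.2]⟩
    _ = (r ^ d)⁻¹ * ∫ z, g z ^ (2 * d) ∂cellVol d := by
        rw [IsPeriodic.integral_sub (f := fun z => g z ^ (2 * d)) (fun i x => by simp only [hper i x])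
          (by fun_prop)]
    _ ≤ (r ^ d)⁻¹ * B ^ (2 * d) := by gcongr
    _ = (B / √r) ^ (2 * d) := by
        rw [div_pow, pow_mul (√r), Real.sq_sqrt hr.le]; field_simp

/-- Integrate the gradient along the segments from `p s` to `p s + v s` and exchange integrals.
Variable `v` compares a value with an average, and constant `v` compares two averages. -/
theorem abs_integral_sub_le {u : Euc d → ℝ} (hu : SmoothPeriodic u) {p v : Euc d → Euc d}
    (hp : Continuous p) (hv : Continuous v) {k : ℝ → ℝ}
    (hk : IntegrableOn k (Set.Ioc 0 1))
    (hb : ∀ t ∈ Set.Ioc (0 : ℝ) 1, ∫ s, ‖v s‖ * ‖gradient u (p s + t • v s)‖ ∂cellVol d ≤ k t) :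
    |∫ s, (u (p s + v s) - u (p s)) ∂cellVol d| ≤ ∫ t in Set.Ioc (0 : ℝ) 1, k t := by
  have hg := continuous_gradient hu.smooth
  obtain ⟨C, hC⟩ := hu.periodic.norm_gradient.exists_bound (by fun_prop)
  have hI : Integrable (Function.uncurry fun (s : Euc d) (t : ℝ) =>
      ‖v s‖ * ‖gradient u (p s + t • v s)‖)
      ((cellVol d).prod (volume.restrict (Set.Ioc (0 : ℝ) 1))) := by
    have h1 : Integrable (fun z : Euc d × ℝ => ‖v z.1‖ * C)
        ((cellVol d).prod (volume.restrict (Set.Ioc (0 : ℝ) 1))) :=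
      ((hv.norm.mul continuous_const).integrable_cellVol).comp_fst _
    refine h1.mono' (Continuous.aestronglyMeasurable (by fun_prop)) (ae_of_all _ fun z => ?_)
    simp only [Function.uncurry, norm_mul, norm_norm]
    gcongr
    simpa using hC (p z.1 + z.2 • v z.1)
  calc |∫ s, (u (p s + v s) - u (p s)) ∂cellVol d|
      ≤ ∫ s, |u (p s + v s) - u (p s)| ∂cellVol d := abs_integral_le_integral_abs
    _ ≤ ∫ s, ∫ t in Set.Ioc (0 : ℝ) 1, ‖v s‖ * ‖gradient u (p s + t • v s)‖ ∂volume ∂cellVol d := by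
        refine integral_mono (Continuous.integrable_cellVol ?_) hI.integral_prod_left fun s => ?_
        · have := hu.continuous; fun_prop
        · simp only
          rw [sub_eq_integral_fderiv (hu.smooth.of_le (by simp)),
            intervalIntegral.integral_of_le zero_le_one]
          have hi : IntegrableOn (fun t : ℝ => ‖v s‖ * ‖gradient u (p s + t • v s)‖)
              (Set.Ioc 0 1) := Continuous.integrableOn_Ioc (by fun_prop)
          exact norm_integral_le_of_norm_le (f := fun t : ℝ => fderiv ℝ u (p s + t • v s) (v s)) hi
            (ae_of_all _ fun t => abs_fderiv_le u _ _)
    _ = ∫ t in Set.Ioc (0 : ℝ) 1, ∫ s, ‖v s‖ * ‖gradient u (p s + t • v s)‖ ∂cellVol d :=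
        integral_integral_swap hI
    _ ≤ ∫ t in Set.Ioc (0 : ℝ) 1, k t :=
        setIntegral_mono_on hI.integral_prod_right hk measurableSet_Ioc hb

/-- At time `t` the segments from `y` to `y - r s` sweep a cube of side `t r`, so the averaged
gradient is at most `B / √(t r)`. The singularity `t^(-1/2)` is integrable with integral `2`. -/
theorem abs_sub_average_le (hd : 0 < d) {u : Euc d → ℝ} (hu : SmoothPeriodic u) {B : ℝ} (hB : 0 ≤ B)
    (hgi : ∫ x, ‖gradient u x‖ ^ (2 * d) ∂cellVol d ≤ B ^ (2 * d))
    {r : ℝ} (hr : 0 < r) (hr1 : r ≤ 1) (y : Euc d) :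
    |∫ s, (u (y - r • s) - u y) ∂cellVol d| ≤ 2 * √d * B * √r := by
  have hg := continuous_gradient hu.smooth
  have h0 : ∫ t in Set.Ioc (0 : ℝ) 1, √d * B * √r * t ^ (-(1 / 2) : ℝ) = 2 * √d * B * √r := by
    rw [integral_const_mul, ← intervalIntegral.integral_of_le zero_le_one,
      integral_rpow (Or.inl (by norm_num))]
    norm_num
    ring
  have hi : IntegrableOn (fun t : ℝ => √d * B * √r * t ^ (-(1 / 2) : ℝ)) (Set.Ioc 0 1) := by
    refine Integrable.const_mul ?_ _
    have := (intervalIntegral.intervalIntegrable_rpow' (a := 0) (b := 1) (r := -(1 / 2))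
      (by norm_num))
    rwa [intervalIntegrable_iff_integrableOn_Ioc_of_le zero_le_one] at this
  have := abs_integral_sub_le hu (p := fun _ => y) (v := fun s => -(r • s)) (by fun_prop)
    (by fun_prop) hi ?_
  · simpa only [h0, ← sub_eq_add_neg] using this
  · intro t ht
    have htr : 0 < t * r := mul_pos ht.1 hr
    calc ∫ s, ‖-(r • s)‖ * ‖gradient u (y + t • -(r • s))‖ ∂cellVol d
        ≤ ∫ s, r * √d * ‖gradient u (y - (t * r) • s)‖ ∂cellVol d := by
          refine integral_mono_ae (Continuous.integrable_cellVol (by fun_prop))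
            (Continuous.integrable_cellVol (by fun_prop)) ?_
          filter_upwards [ae_mem_cell] with s hs
          rw [norm_neg, norm_smul, Real.norm_of_nonneg hr.le, smul_neg, smul_smul,
            ← sub_eq_add_neg]
          gcongr
          exact norm_cell_le hs
      _ ≤ r * √d * (B / √(t * r)) := by
          rw [integral_const_mul]
          gcongr
          exact integral_scaled_le hd (by fun_prop) (fun _ => norm_nonneg _)
            hu.periodic.norm_gradient hB hgi htr (by nlinarith [ht.1, ht.2]) y
      _ = √d * B * √r * t ^ (-(1 / 2) : ℝ) := by
          rw [Real.rpow_neg ht.1.le, ← Real.sqrt_eq_rpow, Real.sqrt_mul ht.1.le]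
          have h1 : √r ≠ 0 := (Real.sqrt_pos.2 hr).ne'
          have h2 : √t ≠ 0 := (Real.sqrt_pos.2 ht.1).ne'
          field_simp
          rw [Real.sq_sqrt hr.le, mul_comm]

theorem abs_average_sub_average_le (hd : 0 < d) {u : Euc d → ℝ} (hu : SmoothPeriodic u) {B : ℝ} (hB : 0 ≤ B)
    (hgi : ∫ x, ‖gradient u x‖ ^ (2 * d) ∂cellVol d ≤ B ^ (2 * d))
    {r : ℝ} (hr : 0 < r) (hr1 : r ≤ 1) (y v : Euc d) :
    |∫ s, (u (y - r • s + v) - u (y - r • s)) ∂cellVol d| ≤ ‖v‖ * (B / √r) := by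
  have hg := continuous_gradient hu.smooth
  have := abs_integral_sub_le hu (p := fun s => y - r • s) (v := fun _ => v) (by fun_prop)
    (by fun_prop) (k := fun _ => ‖v‖ * (B / √r)) (integrable_const _) ?_
  · simpa using this
  · intro t ht
    rw [integral_const_mul]
    gcongr
    have := integral_scaled_le hd (g := fun x => ‖gradient u x‖) (by fun_prop)
      (fun _ => norm_nonneg _) hu.periodic.norm_gradient hB hgi hr hr1 (y + t • v)
    simpa only [sub_add_eq_add_sub] using this

theorem abs_le_of_integral_eq_zero (hd : 0 < d) {u : Euc d → ℝ} (hu : SmoothPeriodic u) {B : ℝ} (hB : 0 ≤ B)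
    (hgi : ∫ x, ‖gradient u x‖ ^ (2 * d) ∂cellVol d ≤ B ^ (2 * d))
    (hmean : ∫ x, u x ∂cellVol d = 0) (y : Euc d) :
    |u y| ≤ 2 * √d * B := by
  -- At scale `r = 1` the average runs over a whole period and vanishes.
  have h1 := abs_sub_average_le hd hu hB hgi one_pos le_rfl y
  have huc := hu.continuous
  rw [integral_sub (Continuous.integrable_cellVol (by fun_prop)) (integrable_const _)] at h1
  simp only [one_smul, hu.periodic.integral_sub huc, hmean] at h1
  simpa using h1

/-- For `r = ‖y - z‖ ≤ 1`, pass from `u y` to its average at scale `r`, to the average at `z`, to `u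
z`. The two outer steps cost `2 √d B √r` each and the middle one `B √r`. For larger distances the
sup bound suffices. -/
theorem abs_sub_le_sqrt (hd : 0 < d) {u : Euc d → ℝ} (hu : SmoothPeriodic u) {B : ℝ} (hB : 0 ≤ B)
    (hgi : ∫ x, ‖gradient u x‖ ^ (2 * d) ∂cellVol d ≤ B ^ (2 * d))
    (hmean : ∫ x, u x ∂cellVol d = 0) (y z : Euc d) :
    |u y - u z| ≤ (4 * √d + 1) * B * √‖y - z‖ := by
  have huc := hu.continuous
  rcases eq_or_ne y z with rfl | hyz
  · simp
  have hr : 0 < ‖y - z‖ := norm_pos_iff.2 (sub_ne_zero.2 hyz)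
  rcases le_or_gt ‖y - z‖ 1 with hr1 | hr1
  · have h1 := abs_sub_average_le hd hu hB hgi hr hr1 y
    have h2 := abs_sub_average_le hd hu hB hgi hr hr1 z
    have h3 := abs_average_sub_average_le hd hu hB hgi hr hr1 z (y - z)
    have hi : ∀ c : Euc d, Integrable (fun s => u (c - ‖y - z‖ • s)) (cellVol d) := fun c =>
      Continuous.integrable_cellVol (by fun_prop)
    have h4 : ∀ s, z - ‖y - z‖ • s + (y - z) = y - ‖y - z‖ • s := fun s => by abel
    simp only [h4] at h3
    rw [integral_sub (hi _) (hi _)] at h3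
    rw [integral_sub (hi _) (integrable_const _)] at h1 h2
    simp only [integral_const, probReal_univ, one_smul] at h1 h2
    have h5 : ‖y - z‖ * (B / √‖y - z‖) = B * √‖y - z‖ := by
      have h1 : √‖y - z‖ ≠ 0 := (Real.sqrt_pos.2 hr).ne'
      field_simp
      rw [Real.sq_sqrt hr.le, mul_comm]
    rw [h5] at h3
    rw [abs_le] at *
    constructor <;> nlinarith
  · have h1 := abs_le_of_integral_eq_zero hd hu hB hgi hmean y
    have h2 := abs_le_of_integral_eq_zero hd hu hB hgi hmean z
    have h3 : 1 ≤ √‖y - z‖ := Real.one_le_sqrt.2 hr1.le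
    have h4 : |u y - u z| ≤ 4 * √d * B := by
      rw [abs_le] at *
      constructor <;> linarith
    have h5 : 0 ≤ (4 * √d + 1) * B := by positivity
    nlinarith

end

/-! ### Rapidly oscillating test functions -/

theorem abs_setIntegral_sub_setIntegral_le {α : Type*} [MeasurableSpace α] {μ : Measure α}
    {A B : Set α} (hA : MeasurableSet A) (hB : MeasurableSet B) (hAμ : μ A ≠ ⊤) (hBμ : μ B ≠ ⊤)
    {F : α → ℝ} {M : ℝ} (hF : AEStronglyMeasurable F μ) (hM : ∀ x, |F x| ≤ M) :
    |∫ x in A, F x ∂μ - ∫ x in B, F x ∂μ| ≤ 2 * M * (μ (symmDiff A B)).toReal := by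
  have hi : ∀ S, μ S ≠ ⊤ → IntegrableOn F S μ := fun S hS =>
    IntegrableOn.of_bound hS.lt_top hF.restrict M (ae_of_all _ hM)
  have h1 := integral_inter_add_sdiff (μ := μ) (f := F) hB (hi A hAμ)
  have h2 := integral_inter_add_sdiff (μ := μ) (f := F) hA (hi B hBμ)
  rw [Set.inter_comm] at h2
  have hs : μ (symmDiff A B) ≠ ⊤ :=
    measure_ne_top_of_subset Set.symmDiff_subset_union (measure_union_lt_top hAμ.lt_top
      hBμ.lt_top).ne
  have hb : ∀ S, S ⊆ symmDiff A B → |∫ x in S, F x ∂μ| ≤ M * (μ (symmDiff A B)).toReal := by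
    intro S hS
    rcases isEmpty_or_nonempty α with hα | ⟨⟨x⟩⟩
    · simp [Measure.eq_zero_of_isEmpty μ]
    have hM0 : 0 ≤ M := (abs_nonneg _).trans (hM x)
    refine (norm_setIntegral_le_of_norm_le_const (C := M) (f := F)
      ((measure_mono hS).trans_lt hs.lt_top) fun x _ => hM x).trans ?_
    exact mul_le_mul_of_nonneg_left (ENNReal.toReal_mono hs (measure_mono hS)) hM0
  have h3 := hb (A \ B) (by rw [Set.symmDiff_def]; exact Set.subset_union_left)
  have h4 := hb (B \ A) (by rw [Set.symmDiff_def]; exact Set.subset_union_right)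
  rw [abs_le] at *
  constructor <;> linarith

/-- Translations converge to the identity in the compact-open topology, and preimages of a set of
finite measure depend continuously on such a measure-preserving map. -/
theorem tendsto_volume_symmDiff_cell {v : ℕ → Euc d} (hv : Tendsto v atTop (𝓝 0)) :
    Tendsto (fun n => (volume (symmDiff ((fun x => x - v n) ⁻¹' cell d) (cell d))).toReal) atTop
      (𝓝 0) := by
  let f : Euc d → C(Euc d, Euc d) :=
    (ContinuousMap.mk (fun a : Euc d × Euc d => a.2 - a.1) (by fun_prop)).curry
  have hf : Continuous f := ContinuousMap.continuous _
  have h1 : Tendsto (fun n => f (v n)) atTop (𝓝 (f 0)) := (hf.tendsto 0).comp hv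
  have hcell : volume (cell d) ≠ ⊤ := by
    have := measure_ne_top (cellVol d) Set.univ
    simpa [cellVol] using this
  have h2 := tendsto_measure_symmDiff_preimage_nhds_zero (μ := volume) (ν := volume) h1
    (Eventually.of_forall fun n => measurePreserving_sub_right volume (v n))
    (measurePreserving_sub_right volume 0) measurableSet_cell.nullMeasurableSet hcell
  have h3 := (ENNReal.tendsto_toReal ENNReal.zero_ne_top).comp h2
  have h4 : f 0 ⁻¹' cell d = cell d := by ext; simp [f]
  rw [h4] at h3
  exact h3

theorem tendsto_sup_translate (Ψ : C(Tor d × Tor d, ℝ)) {v : ℕ → Euc d}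
    (hv : Tendsto v atTop (𝓝 0)) {δ : ℝ} (hδ : 0 < δ) :
    ∀ᶠ n in atTop, ∀ a b, |Ψ (a + pr (v n), b) - Ψ (a, b)| < δ := by
  obtain ⟨η, hη, h⟩ := Metric.uniformContinuous_iff.1
    (CompactSpace.uniformContinuous_of_continuous Ψ.continuous) δ hδ
  have h1 : Tendsto (fun n => ‖(pr (v n) : Tor d)‖) atTop (𝓝 0) := by
    have h0 : ‖(pr (0 : Euc d) : Tor d)‖ = 0 := by
      have : (pr (0 : Euc d) : Tor d) = 0 := by ext; simp [pr]
      rw [this, norm_zero]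
    rw [← h0]
    exact ((continuous_pr.norm).tendsto 0).comp hv
  filter_upwards [h1.eventually (gt_mem_nhds hη)] with n hn a b
  refine h ?_
  rw [Prod.dist_eq, dist_self, max_eq_left dist_nonneg, dist_eq_norm, add_sub_cancel_left]
  exact hn

/-- Moving `x` by `ε s` moves the fast variable by exactly `s`. The slow variable and the domain of
integration change only by `o(1)`. Hence the integral is asymptotically insensitive to a shift of
the fast variable, and averaging over all shifts replaces that variable by its Haar mean. No
integrality of `1/ε` is needed. -/
theorem tendsto_integral_oscillating {ε : ℕ → ℝ} (hε : ∀ n, 0 < ε n)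
    (hε0 : Tendsto ε atTop (𝓝 0)) (Ψ : C(Tor d × Tor d, ℝ)) :
    Tendsto (fun n => ∫ x, Ψ (pr x, pr ((ε n)⁻¹ • x)) ∂cellVol d) atTop
      (𝓝 (∫ z, Ψ z ∂(volume.prod volume))) := by
  have hpr : Continuous (pr : Euc d → Tor d) := continuous_pr
  have hM : ∀ z, |Ψ z| ≤ ‖Ψ‖ := Ψ.norm_coe_le_norm
  let D : ℕ → Euc d → ℝ := fun n s => ∫ x, Ψ (pr x, pr ((ε n)⁻¹ • x)) ∂cellVol d
    - ∫ x, Ψ (pr x, pr ((ε n)⁻¹ • x) + pr s) ∂cellVol d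
  have hD : ∀ s, Tendsto (fun n => D n s) atTop (𝓝 0) := by
    intro s
    have hv : Tendsto (fun n => ε n • s) atTop (𝓝 0) := by
      simpa using hε0.smul_const s
    -- Two errors arise: the displaced cell (controlled here) and the displaced slow variable
    -- (uniform continuity of `Ψ`).
    have hb1 := ((tendsto_volume_symmDiff_cell hv).const_mul (2 * ‖Ψ‖))
    rw [mul_zero] at hb1
    rw [Metric.tendsto_atTop']
    intro δ hδ
    obtain ⟨N, hN⟩ := eventually_atTop.1 ((hb1.eventually (gt_mem_nhds (half_pos hδ))).and
      (tendsto_sup_translate Ψ hv (half_pos hδ)))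
    refine ⟨N, fun n hn => ?_⟩
    obtain ⟨h1, h2⟩ := hN n hn.le
    let F : Euc d → ℝ := fun x => Ψ (pr x, pr ((ε n)⁻¹ • x))
    have hFc : Continuous F := by fun_prop
    have h3 : |∫ x, F (x + ε n • s) ∂cellVol d - ∫ x, F x ∂cellVol d| < δ / 2 := by
      refine lt_of_le_of_lt ?_ h1
      have h4 : ∫ x, F (x + ε n • s) ∂cellVol d
          = ∫ x in (fun x => x - ε n • s) ⁻¹' cell d, F x := by
        have := (measurePreserving_sub_right volume (ε n • s)).setIntegral_preimage_emb
          (MeasurableEquiv.subRight (ε n • s)).measurableEmbedding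
          (fun x => F (x + ε n • s)) (cell d)
        rw [cellVol, ← this]
        simp
      have hcell : volume (cell d) ≠ ⊤ := by
        have := measure_ne_top (cellVol d) Set.univ
        simpa [cellVol] using this
      rw [h4]
      refine abs_setIntegral_sub_setIntegral_le
        (measurePreserving_sub_right volume (ε n • s) |>.measurable measurableSet_cell)
        measurableSet_cell ?_ hcell
        hFc.aestronglyMeasurable fun x => hM _
      rw [(measurePreserving_sub_right volume (ε n • s)).measure_preimage
        measurableSet_cell.nullMeasurableSet]
      exact hcell
    have h5 : |∫ x, F (x + ε n • s) ∂cellVol d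
        - ∫ x, Ψ (pr x, pr ((ε n)⁻¹ • x) + pr s) ∂cellVol d| ≤ δ / 2 := by
      rw [← integral_sub (Continuous.integrable_cellVol (by fun_prop))
        (Continuous.integrable_cellVol (by fun_prop))]
      have := norm_integral_le_of_norm_le_const (μ := cellVol d) (C := δ / 2)
        (f := fun x => F (x + ε n • s) - Ψ (pr x, pr ((ε n)⁻¹ • x) + pr s))
        (ae_of_all _ fun x => ?_)
      · simpa using this
      · have h6 : (ε n)⁻¹ • (x + ε n • s) = (ε n)⁻¹ • x + s := by
          rw [smul_add, smul_smul, inv_mul_cancel₀ (hε n).ne', one_smul]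
        simp only [F, h6, pr_add]
        exact (h2 _ _).le
    rw [Real.dist_eq, sub_zero]
    simp only [D]
    rw [abs_le] at h5
    rw [abs_lt] at *
    constructor <;> linarith [h3.1, h3.2, h5.1, h5.2]
  have hDm : ∀ n, Continuous (D n) := by
    intro n
    refine continuous_const.sub ?_
    refine continuous_of_dominated (bound := fun _ => ‖Ψ‖) (fun s => ?_) (fun s => ?_)
      (integrable_const _) (ae_of_all _ fun x => ?_)
    · exact Continuous.aestronglyMeasurable (by fun_prop)
    · exact ae_of_all _ fun x => hM _
    · fun_prop
  have hlim : Tendsto (fun n => ∫ s, D n s ∂cellVol d) atTop (𝓝 (∫ _, (0 : ℝ) ∂cellVol d)) := by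
    refine tendsto_integral_of_dominated_convergence (fun _ => 2 * ‖Ψ‖)
      (fun n => (hDm n).aestronglyMeasurable) (integrable_const _) (fun n => ae_of_all _ fun s => ?_)
      (ae_of_all _ hD)
    have hb : ∀ f : Euc d → Tor d × Tor d, ‖∫ x, Ψ (f x) ∂cellVol d‖ ≤ ‖Ψ‖ := fun f => by
      simpa using norm_integral_le_of_norm_le_const (μ := cellVol d) (C := ‖Ψ‖)
        (f := fun x => Ψ (f x)) (ae_of_all _ fun x => hM _)
    refine (norm_sub_le _ _).trans ?_
    linarith [hb fun x => (pr x, pr ((ε n)⁻¹ • x)), hb fun x => (pr x, pr ((ε n)⁻¹ • x) + pr s)]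
  -- For fixed `x` the average over `s` is the full Haar integral in the fast variable, for every
  -- `n` and not just in the limit.
  have heq : ∀ n, ∫ s, D n s ∂cellVol d = ∫ x, Ψ (pr x, pr ((ε n)⁻¹ • x)) ∂cellVol d
      - ∫ z, Ψ z ∂(volume.prod volume) := by
    intro n
    have hc : Continuous (Function.uncurry fun (s x : Euc d) =>
        Ψ (pr x, pr ((ε n)⁻¹ • x) + pr s)) := by
      simp only [Function.uncurry_def]
      fun_prop
    have hi : Integrable (Function.uncurry fun (s x : Euc d) =>
        Ψ (pr x, pr ((ε n)⁻¹ • x) + pr s)) ((cellVol d).prod (cellVol d)) :=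
      Integrable.of_bound hc.aestronglyMeasurable ‖Ψ‖ (ae_of_all _ fun z => hM _)
    simp only [D]
    have hi' : Integrable (fun s => ∫ x, Ψ (pr x, pr ((ε n)⁻¹ • x) + pr s) ∂cellVol d)
        (cellVol d) := hi.integral_prod_left
    rw [MeasureTheory.integral_sub (integrable_const _) hi', integral_integral_swap hi]
    have h1 : ∀ x : Euc d, ∫ s, Ψ (pr x, pr ((ε n)⁻¹ • x) + pr s) ∂cellVol d
        = ∫ b, Ψ (pr x, b) := by
      intro x
      rw [measurePreserving_pr.integral_comp_of_aesm
        (f := fun b => Ψ (pr x, pr ((ε n)⁻¹ • x) + b))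
        (Continuous.aestronglyMeasurable (by fun_prop))]
      exact integral_add_left_eq_self (fun b => Ψ (pr x, b)) _
    have hΨi : Integrable Ψ ((volume : Measure (Tor d)).prod volume) :=
      Integrable.of_bound Ψ.continuous.aestronglyMeasurable ‖Ψ‖ (ae_of_all _ fun z => hM _)
    simp only [h1]
    rw [measurePreserving_pr.integral_comp_of_aesm (f := fun a => ∫ b, Ψ (a, b))
      hΨi.integral_prod_left.aestronglyMeasurable, integral_prod _ hΨi]
    simp
  simp only [heq, integral_zero] at hlim
  simpa using hlim.add_const (∫ z, Ψ z ∂(volume.prod volume))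

/-! ### Functional-analytic tools -/

/-- Sequential compactness of a countable product of intervals replaces the diagonal argument. -/
theorem exists_common_subseq {ι : Type*} [Countable ι] (a : ι → ℕ → ℝ)
    (hb : ∀ i, ∃ C, ∀ n, |a i n| ≤ C) :
    ∃ σ : ℕ → ℕ, StrictMono σ ∧ ∀ i, ∃ l, Tendsto (fun n => a i (σ n)) atTop (𝓝 l) := by
  choose C hC using hb
  have hK : IsCompact (Set.univ.pi fun i => Set.Icc (-C i) (C i)) :=
    isCompact_univ_pi fun i => isCompact_Icc
  obtain ⟨l, -, σ, hσ, hl⟩ := hK.tendsto_subseq (x := fun n i => a i n)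
    fun n i _ => abs_le.1 (hC i n)
  exact ⟨σ, hσ, fun i => ⟨l i, (tendsto_pi_nhds.1 hl) i⟩⟩

/-- Truncation at height `k`. -/
noncomputable def trunc (k t : ℝ) : ℝ := max (-k) (min t k)

theorem continuous_trunc (k : ℝ) : Continuous (trunc k) := by
  unfold trunc; fun_prop

theorem abs_trunc_le {k : ℝ} (hk : 0 ≤ k) (t : ℝ) : |trunc k t| ≤ k := by
  unfold trunc
  rw [abs_le]
  exact ⟨le_max_left _ _, max_le (by linarith) (min_le_right _ _)⟩

theorem trunc_of_abs_le {k t : ℝ} (h : |t| ≤ k) : trunc k t = t := by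
  rw [abs_le] at h
  unfold trunc
  rw [min_eq_left h.2, max_eq_right h.1]

/-! ### Duality between integrable and continuous functions on a compact probability space. -/

section Compact

variable {X : Type*} [TopologicalSpace X] [MeasurableSpace X] [BorelSpace X] {μ : Measure X}

theorem _root_.ContinuousMap.integrable_of_isProbabilityMeasure [CompactSpace X] [IsProbabilityMeasure μ]
    (Ψ : C(X, ℝ)) :
    Integrable Ψ μ := by
  have := (BoundedContinuousFunction.mkOfCompact Ψ).integrable μ
  exact this

theorem integrable_mul_continuousMap [CompactSpace X] [IsProbabilityMeasure μ]
    {f : X → ℝ} (hf : Integrable f μ) (Ψ : C(X, ℝ)) :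
    Integrable (fun x => f x * Ψ x) μ :=
  hf.mul_bdd (c := ‖Ψ‖) (Ψ.integrable_of_isProbabilityMeasure (μ := μ)).aestronglyMeasurable
    (ae_of_all _ Ψ.norm_coe_le_norm)

theorem exists_continuousMap_integral_sub_le [NormalSpace X] [μ.WeaklyRegular] {f : X → ℝ}
    (hf : Integrable f μ) {η : ℝ} (hη : 0 < η) : ∃ g : C(X, ℝ), ∫ x, |f x - g x| ∂μ ≤ η := by
  obtain ⟨g, hg, -⟩ := hf.exists_boundedContinuous_integral_sub_le hη
  exact ⟨g.toContinuousMap, hg⟩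

/-- The `L¹` norm is the norm of the functional on continuous functions. -/
theorem integral_abs_le_of_forall_continuousMap [CompactSpace X] [IsProbabilityMeasure μ]
    [NormalSpace X] [μ.WeaklyRegular] {f : X → ℝ} (hf : Integrable f μ) {C : ℝ}
    (h : ∀ Ψ : C(X, ℝ), (∀ x, |Ψ x| ≤ 1) → ∫ x, f x * Ψ x ∂μ ≤ C) : ∫ x, |f x| ∂μ ≤ C := by
  refine le_of_forall_pos_le_add fun η hη => ?_
  obtain ⟨g, hg⟩ := exists_continuousMap_integral_sub_le hf (η := η / 3) (by positivity)
  have hden : ∀ x, 0 < |g x| + η / 3 := fun x => by positivity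
  -- A continuous substitute for the sign of `g`: it is bounded by one and satisfies `g Ψ ≥ |g| -
  -- η/3`.
  let Ψ : C(X, ℝ) := ⟨fun x => g x / (|g x| + η / 3), by
    exact g.continuous.div (by fun_prop) fun x => (hden x).ne'⟩
  have hΨ : ∀ x, |Ψ x| ≤ 1 := fun x => by
    simp only [Ψ, ContinuousMap.coe_mk]
    rw [abs_div, abs_of_pos (hden x), div_le_one (hden x)]
    linarith
  have hgi := g.integrable_of_isProbabilityMeasure (μ := μ)
  have hfg : Integrable (fun x => |f x - g x|) μ := (hf.sub hgi).abs
  have hpt : ∀ x, |f x| ≤ f x * Ψ x + 2 * |f x - g x| + η / 3 := by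
    intro x
    have h1 : |g x| - η / 3 ≤ g x * Ψ x := by
      simp only [Ψ, ContinuousMap.coe_mk]
      rw [← mul_div_assoc, le_div_iff₀ (hden x), ← abs_mul_abs_self (g x)]
      nlinarith
    have h2 : g x * Ψ x - f x * Ψ x ≤ |f x - g x| := by
      have : |(g x - f x) * Ψ x| ≤ |f x - g x| := by
        rw [abs_mul, abs_sub_comm]
        exact mul_le_of_le_one_right (abs_nonneg _) (hΨ x)
      linarith [le_abs_self ((g x - f x) * Ψ x)]
    have h3 := abs_sub_abs_le_abs_sub (f x) (g x)
    linarith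
  calc ∫ x, |f x| ∂μ ≤ ∫ x, (f x * Ψ x + 2 * |f x - g x| + η / 3) ∂μ :=
        integral_mono hf.abs (((integrable_mul_continuousMap hf Ψ).add (hfg.const_mul 2)).add
          (integrable_const _)) hpt
    _ = ∫ x, f x * Ψ x ∂μ + 2 * ∫ x, |f x - g x| ∂μ + η / 3 := by
        have hi : Integrable (fun x => f x * Ψ x + 2 * |f x - g x|) μ :=
          (integrable_mul_continuousMap hf Ψ).add (hfg.const_mul 2)
        rw [integral_add hi (integrable_const _), integral_add (integrable_mul_continuousMap hf Ψ)
          (hfg.const_mul 2), integral_const_mul]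
        simp
    _ ≤ C + η := by linarith [h Ψ hΨ]

/-- A linear functional on continuous functions that is bounded for the `L¹` norm is given by
a square integrable function. -/
theorem exists_memLp_two_of_bound [CompactSpace X] [IsProbabilityMeasure μ]
    [SecondCountableTopology X] [μ.IsOpenPosMeasure]
    (L : C(X, ℝ) →ₗ[ℝ] ℝ) {k : ℝ}
    (hL : ∀ Ψ, |L Ψ| ≤ k * ∫ x, |Ψ x| ∂μ) :
    ∃ W : X → ℝ, MemLp W 2 μ ∧ ∀ Ψ, L Ψ = ∫ x, W x * Ψ x ∂μ := by
  have hk : 0 ≤ k := by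
    have := (abs_nonneg _).trans (hL 1)
    simpa using this
  have hnorm : ∀ Ψ : C(X, ℝ), ∫ x, |Ψ x| ∂μ ≤ ‖ContinuousMap.toLp 2 μ ℝ Ψ‖ := by
    intro Ψ
    have h1 : eLpNorm Ψ 1 μ ≤ eLpNorm Ψ 2 μ :=
      eLpNorm_le_eLpNorm_of_exponent_le (by norm_num)
        (Ψ.integrable_of_isProbabilityMeasure (μ := μ)).aestronglyMeasurable
    have h2 : ‖ContinuousMap.toLp 2 μ ℝ Ψ‖ = (eLpNorm Ψ 2 μ).toReal := by
      rw [Lp.norm_def, eLpNorm_congr_ae (ContinuousMap.coeFn_toLp μ Ψ)]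
    have h3 : ∫ x, |Ψ x| ∂μ = (eLpNorm Ψ 1 μ).toReal := by
      rw [eLpNorm_one_eq_lintegral_enorm, ← integral_norm_eq_lintegral_enorm
        (Ψ.integrable_of_isProbabilityMeasure (μ := μ)).aestronglyMeasurable]
      rfl
    rw [h2, h3]
    refine ENNReal.toReal_mono ?_ h1
    rw [← eLpNorm_congr_ae (ContinuousMap.coeFn_toLp (p := 2) (𝕜 := ℝ) μ Ψ)]
    exact Lp.eLpNorm_ne_top _
  -- The measure has full support, so continuous functions embed in `L²` and `L` is a bounded
  -- functional on their image. Hahn–Banach extends it and Riesz represents it.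
  let e := LinearEquiv.ofInjective (ContinuousMap.toLp 2 μ ℝ : C(X, ℝ) →L[ℝ] Lp ℝ 2 μ).toLinearMap
    (ContinuousMap.toLp_injective μ)
  let l : (LinearMap.range (ContinuousMap.toLp 2 μ ℝ : C(X, ℝ) →L[ℝ] Lp ℝ 2 μ).toLinearMap)
      →L[ℝ] ℝ := (L ∘ₗ e.symm.toLinearMap).mkContinuous k fun y => by
    obtain ⟨Ψ, rfl⟩ := e.surjective y
    simp only [LinearMap.comp_apply, LinearEquiv.coe_coe, LinearEquiv.symm_apply_apply]
    exact (hL Ψ).trans (mul_le_mul_of_nonneg_left (hnorm Ψ) hk)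
  obtain ⟨g, hg, -⟩ := exists_extension_norm_eq _ l
  let W := (InnerProductSpace.toDual ℝ (Lp ℝ 2 μ)).symm g
  refine ⟨W, Lp.memLp W, fun Ψ => ?_⟩
  have h1 : g (ContinuousMap.toLp 2 μ ℝ Ψ) = L Ψ := by
    have := hg (e Ψ)
    simp only [l, LinearMap.mkContinuous_apply, LinearMap.comp_apply, LinearEquiv.coe_coe,
      LinearEquiv.symm_apply_apply] at this
    exact this
  have h2 : inner ℝ W (ContinuousMap.toLp 2 μ ℝ Ψ) = g (ContinuousMap.toLp 2 μ ℝ Ψ) := by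
    simp [W]
  rw [← h1, ← h2, L2.inner_def]
  refine integral_congr_ae ?_
  filter_upwards [ContinuousMap.coeFn_toLp (p := 2) (𝕜 := ℝ) μ Ψ] with x hx
  rw [hx]
  simp [mul_comm]

end Compact

/-! ### Two-scale compactness -/

/-- Haar measure on `𝕋^d × 𝕋^d`. -/
noncomputable abbrev torVol₂ (d : ℕ) : Measure (Tor d × Tor d) :=
  (volume : Measure (Tor d)).prod (volume : Measure (Tor d))

/-- Two-scale convergence, tested against continuous functions on `𝕋^d × 𝕋^d`. -/
def TSConv (ε : ℕ → ℝ) (w : ℕ → Euc d → ℝ) (W : Tor d × Tor d → ℝ) : Prop :=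
  ∀ Ψ : C(Tor d × Tor d, ℝ),
    Tendsto (fun n => ∫ x, w n x * Ψ (pr x, pr ((ε n)⁻¹ • x)) ∂cellVol d) atTop
      (𝓝 (∫ z, W z * Ψ z ∂torVol₂ d))

theorem continuous_osc (Ψ : C(Tor d × Tor d, ℝ)) (c : ℝ) :
    Continuous fun x : Euc d => Ψ (pr x, pr (c • x)) := by
  have hpr : Continuous (pr : Euc d → Tor d) := continuous_pr
  fun_prop

theorem abs_integral_mul_osc_le {w : Euc d → ℝ} (hw : Continuous w) {C : ℝ}
    (hC : ∫ x, |w x| ∂cellVol d ≤ C) (Ψ : C(Tor d × Tor d, ℝ)) (c : ℝ) :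
    |∫ x, w x * Ψ (pr x, pr (c • x)) ∂cellVol d| ≤ C * ‖Ψ‖ := by
  have hΨ := continuous_osc Ψ c
  calc |∫ x, w x * Ψ (pr x, pr (c • x)) ∂cellVol d|
      ≤ ∫ x, |w x * Ψ (pr x, pr (c • x))| ∂cellVol d := abs_integral_le_integral_abs
    _ ≤ ∫ x, |w x| * ‖Ψ‖ ∂cellVol d := by
        refine integral_mono (Continuous.integrable_cellVol (by fun_prop))
          (Continuous.integrable_cellVol (by fun_prop)) fun x => ?_
        simp only
        rw [abs_mul]
        exact mul_le_mul_of_nonneg_left (Ψ.norm_coe_le_norm _) (abs_nonneg _)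
    _ ≤ C * ‖Ψ‖ := by
        rw [integral_mul_const]
        exact mul_le_mul_of_nonneg_right hC (norm_nonneg _)

/-- The uniform `L¹` bound makes the functionals equicontinuous, so convergence on a dense set gives
Cauchy sequences everywhere. -/
theorem exists_tendsto_of_dense {ε : ℕ → ℝ} {w : ℕ → Euc d → ℝ} (hw : ∀ n, Continuous (w n))
    {C : ℝ} (hC : ∀ n, ∫ x, |w n x| ∂cellVol d ≤ C) {Ψ : ℕ → C(Tor d × Tor d, ℝ)}
    (hΨ : DenseRange Ψ)
    (h : ∀ j, ∃ l, Tendsto (fun n => ∫ x, w n x * Ψ j (pr x, pr ((ε n)⁻¹ • x)) ∂cellVol d) atTop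
      (𝓝 l)) (Φ : C(Tor d × Tor d, ℝ)) :
    ∃ l, Tendsto (fun n => ∫ x, w n x * Φ (pr x, pr ((ε n)⁻¹ • x)) ∂cellVol d) atTop (𝓝 l) := by
  have hC0 : 0 ≤ C := (integral_nonneg fun x => abs_nonneg _).trans (hC 0)
  refine cauchySeq_tendsto_of_complete (Metric.cauchySeq_iff.2 fun δ hδ => ?_)
  obtain ⟨j, hj⟩ := hΨ.exists_dist_lt Φ (ε := δ / (3 * (C + 1))) (by positivity)
  obtain ⟨l, hl⟩ := h j
  obtain ⟨N, hN⟩ := Metric.cauchySeq_iff.1 hl.cauchySeq (δ / 3) (by positivity)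
  have key : ∀ n, |∫ x, w n x * Φ (pr x, pr ((ε n)⁻¹ • x)) ∂cellVol d
      - ∫ x, w n x * Ψ j (pr x, pr ((ε n)⁻¹ • x)) ∂cellVol d| < δ / 3 := by
    intro n
    have hw' := hw n
    have h1 := continuous_osc Φ (ε n)⁻¹
    have h2 := continuous_osc (Ψ j) (ε n)⁻¹
    rw [← integral_sub (Continuous.integrable_cellVol (by fun_prop))
      (Continuous.integrable_cellVol (by fun_prop))]
    have h3 := abs_integral_mul_osc_le hw' (hC n) (Φ - Ψ j) (ε n)⁻¹
    simp only [ContinuousMap.sub_apply, mul_sub] at h3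
    refine h3.trans_lt ?_
    rw [dist_eq_norm, lt_div_iff₀ (by positivity)] at hj
    nlinarith [norm_nonneg (Φ - Ψ j)]
  refine ⟨N, fun a ha b hb => ?_⟩
  have h1 := key a
  have h2 := key b
  have h3 := hN a ha b hb
  rw [Real.dist_eq] at *
  rw [abs_lt] at *
  constructor <;> linarith

/-- The limit functional satisfies `|ℓ Φ| ≤ k ∫∫ |Φ|`: for each `n` its approximation is at most `k
∫ |Φ|(x, x/ε)`, and these integrals converge to the double integral. -/
theorem exists_tsConv_of_bounded {ε : ℕ → ℝ} (hε : ∀ n, 0 < ε n) (hε0 : Tendsto ε atTop (𝓝 0))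
    {w : ℕ → Euc d → ℝ} (hw : ∀ n, Continuous (w n)) {k : ℝ} (hk : ∀ n x, |w n x| ≤ k)
    (h : ∀ Φ : C(Tor d × Tor d, ℝ), ∃ l,
      Tendsto (fun n => ∫ x, w n x * Φ (pr x, pr ((ε n)⁻¹ • x)) ∂cellVol d) atTop (𝓝 l)) :
    ∃ W, MemLp W 2 (torVol₂ d) ∧ TSConv ε w W := by
  choose L hL using h
  have hi : ∀ n (Φ : C(Tor d × Tor d, ℝ)),
      Integrable (fun x => w n x * Φ (pr x, pr ((ε n)⁻¹ • x))) (cellVol d) := fun n Φ =>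
    ((hw n).mul (continuous_osc Φ _)).integrable_cellVol
  let ℓ : C(Tor d × Tor d, ℝ) →ₗ[ℝ] ℝ :=
    { toFun := L
      map_add' := fun Φ Ψ => by
        refine tendsto_nhds_unique (hL _) (((hL Φ).add (hL Ψ)).congr fun n => ?_)
        rw [← integral_add (hi n Φ) (hi n Ψ)]
        simp [mul_add]
      map_smul' := fun c Φ => by
        refine tendsto_nhds_unique (hL _) (((hL Φ).const_mul c).congr fun n => ?_)
        rw [← integral_const_mul]
        simp [mul_left_comm] }
  have hb : ∀ Φ, |ℓ Φ| ≤ k * ∫ z, |Φ z| ∂torVol₂ d := by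
    intro Φ
    refine le_of_tendsto_of_tendsto' (hL Φ).abs
      ((tendsto_integral_oscillating hε hε0 |Φ|).const_mul k) fun n => ?_
    rw [← integral_const_mul]
    refine abs_integral_le_integral_abs.trans ?_
    refine integral_mono (hi n Φ).abs
      ((continuous_osc |Φ| _).integrable_cellVol.const_mul k) fun x => ?_
    simp only [abs_mul, ContinuousMap.abs_apply]
    exact mul_le_mul_of_nonneg_right (hk n x) (abs_nonneg _)
  obtain ⟨W, hW, hW'⟩ := exists_memLp_two_of_bound ℓ hb
  exact ⟨W, hW, fun Ψ => by rw [← hW']; exact hL Ψ⟩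

/-- Two truncations of the same sequence differ in `L¹` by at most `δ k + δ l`, uniformly in `n`.
Their two-scale limits inherit the bound, hence are Cauchy in `L¹`; their limit is the two-scale
limit of the full sequence. -/
theorem exists_tsConv_of_trunc {ε : ℕ → ℝ} {w : ℕ → Euc d → ℝ} (hw : ∀ n, Continuous (w n))
    {δ : ℕ → ℝ} (hδ : Tendsto δ atTop (𝓝 0))
    (hwδ : ∀ n (k : ℕ), ∫ x, |w n x - trunc k (w n x)| ∂cellVol d ≤ δ k)
    {Wk : ℕ → Tor d × Tor d → ℝ} (hWk : ∀ k, MemLp (Wk k) 2 (torVol₂ d))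
    (hts : ∀ k : ℕ, TSConv ε (fun n x => trunc k (w n x)) (Wk k)) :
    ∃ W, StronglyMeasurable W ∧ Integrable W (torVol₂ d) ∧ TSConv ε w W := by
  have hWi : ∀ k, Integrable (Wk k) (torVol₂ d) := fun k => (hWk k).integrable (by norm_num)
  have htc : ∀ (k : ℕ) n, Continuous fun x => trunc k (w n x) := fun k n =>
    (continuous_trunc k).comp (hw n)
  have hi : ∀ n k (Φ : C(Tor d × Tor d, ℝ)),
      Integrable (fun x => trunc k (w n x) * Φ (pr x, pr ((ε n)⁻¹ • x))) (cellVol d) :=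
    fun n k Φ =>
    (((continuous_trunc k).comp (hw n)).mul (continuous_osc Φ _)).integrable_cellVol
  have hiw : ∀ n (Φ : C(Tor d × Tor d, ℝ)),
      Integrable (fun x => w n x * Φ (pr x, pr ((ε n)⁻¹ • x))) (cellVol d) := fun n Φ =>
    ((hw n).mul (continuous_osc Φ _)).integrable_cellVol
  -- the tail estimate, at the level of the oscillating integrals
  have htail : ∀ n (k : ℕ) (Φ : C(Tor d × Tor d, ℝ)),
      |∫ x, w n x * Φ (pr x, pr ((ε n)⁻¹ • x)) ∂cellVol d
        - ∫ x, trunc k (w n x) * Φ (pr x, pr ((ε n)⁻¹ • x)) ∂cellVol d| ≤ δ k * ‖Φ‖ := by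
    intro n k Φ
    have := abs_integral_mul_osc_le (w := fun x => w n x - trunc k (w n x))
      ((hw n).sub (htc k n)) (hwδ n k) Φ (ε n)⁻¹
    simp only [sub_mul] at this
    rwa [integral_sub (hiw n Φ) (hi n k Φ)] at this
  have hdiff : ∀ k l, ∫ z, |Wk k z - Wk l z| ∂torVol₂ d ≤ δ k + δ l := by
    intro k l
    -- Writing the `L¹` norm by duality lets the bound pass to the limit one test function at a
    -- time.
    refine integral_abs_le_of_forall_continuousMap ((hWi k).sub (hWi l)) fun Φ hΦ => ?_
    have hΦ1 : ‖Φ‖ ≤ 1 := (ContinuousMap.norm_le _ zero_le_one).2 hΦ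
    have h1 := (hts k Φ).sub (hts l Φ)
    rw [← integral_sub (integrable_mul_continuousMap (hWi k) Φ)
      (integrable_mul_continuousMap (hWi l) Φ)] at h1
    simp only [← sub_mul] at h1
    refine le_of_tendsto' h1 fun n => ?_
    have h2 := htail n k Φ
    have h3 := htail n l Φ
    have hk0 : 0 ≤ δ k := (integral_nonneg fun x => abs_nonneg _).trans (hwδ n k)
    have hl0 : 0 ≤ δ l := (integral_nonneg fun x => abs_nonneg _).trans (hwδ n l)
    rw [abs_le] at h2 h3
    nlinarith
  have hdist : ∀ k l, dist ((hWi k).toL1 (Wk k)) ((hWi l).toL1 (Wk l)) ≤ δ k + δ l := by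
    intro k l
    rw [dist_eq_norm, ← Integrable.toL1_sub, L1.norm_of_fun_eq_integral_norm]
    exact hdiff k l
  have hcauchy : CauchySeq fun k => (hWi k).toL1 (Wk k) := by
    refine Metric.cauchySeq_iff.2 fun η hη => ?_
    obtain ⟨N, hN⟩ := eventually_atTop.1 (hδ.eventually (gt_mem_nhds (half_pos hη)))
    exact ⟨N, fun a ha b hb => (hdist a b).trans_lt (by linarith [hN a ha, hN b hb])⟩
  obtain ⟨W, hW⟩ := cauchySeq_tendsto_of_complete hcauchy
  have hWint : Integrable W (torVol₂ d) := L1.integrable_coeFn W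
  -- A genuinely strongly measurable representative is kept because the slices `W (x, ·)` must be
  -- measurable for every `x`.
  refine ⟨W, Lp.stronglyMeasurable W, hWint, fun Φ => ?_⟩
  -- `∫ W_k Φ → ∫ W Φ`
  have hlim : ∀ k, |∫ z, Wk k z * Φ z ∂torVol₂ d - ∫ z, W z * Φ z ∂torVol₂ d|
      ≤ dist ((hWi k).toL1 (Wk k)) W * ‖Φ‖ := by
    intro k
    have h1 : dist ((hWi k).toL1 (Wk k)) W = ∫ z, |Wk k z - W z| ∂torVol₂ d := by
      rw [dist_eq_norm, L1.norm_eq_integral_norm]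
      refine integral_congr_ae ?_
      filter_upwards [Lp.coeFn_sub ((hWi k).toL1 (Wk k)) W, (hWi k).coeFn_toL1] with z h1 h2
      rw [h1, Pi.sub_apply, h2, Real.norm_eq_abs]
    rw [h1, ← integral_sub (integrable_mul_continuousMap (hWi k) Φ)
      (integrable_mul_continuousMap hWint Φ), ← integral_mul_const]
    refine abs_integral_le_integral_abs.trans ?_
    refine integral_mono ((integrable_mul_continuousMap (hWi k) Φ).sub
      (integrable_mul_continuousMap hWint Φ)).abs
      (((hWi k).sub hWint).abs.mul_const _) fun z => ?_
    simp only [← sub_mul, abs_mul]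
    exact mul_le_mul_of_nonneg_left (Φ.norm_coe_le_norm z) (abs_nonneg _)
  have hlim' : Tendsto (fun k => dist ((hWi k).toL1 (Wk k)) W * ‖Φ‖) atTop (𝓝 0) := by
    have := (tendsto_iff_dist_tendsto_zero.1 hW).mul_const ‖Φ‖
    rwa [zero_mul] at this
  have hδΦ : Tendsto (fun k => δ k * ‖Φ‖) atTop (𝓝 0) := by
    have := hδ.mul_const ‖Φ‖
    rwa [zero_mul] at this
  rw [Metric.tendsto_atTop]
  intro η hη
  obtain ⟨k, hk1, hk2⟩ := ((hlim'.eventually (gt_mem_nhds (show 0 < η / 3 by positivity))).and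
    (hδΦ.eventually (gt_mem_nhds (show 0 < η / 3 by positivity)))).exists
  obtain ⟨N, hN⟩ := Metric.tendsto_atTop.1 (hts k Φ) (η / 3) (by positivity)
  refine ⟨N, fun n hn => ?_⟩
  have h1 := hN n hn
  have h2 := (hlim k).trans_lt hk1
  have h3 := (htail n k Φ).trans_lt hk2
  rw [Real.dist_eq] at *
  rw [abs_lt] at *
  constructor <;> linarith

/-- Two-scale compactness of uniformly integrable sequences. -/
theorem exists_subseq_tsConv {ι : Type*} [Countable ι] {ε : ℕ → ℝ} (hε : ∀ n, 0 < ε n)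
    (hε0 : Tendsto ε atTop (𝓝 0)) {w : ι → ℕ → Euc d → ℝ} (hw : ∀ i n, Continuous (w i n))
    {δ : ι → ℕ → ℝ} (hδ : ∀ i, Tendsto (δ i) atTop (𝓝 0))
    (hwδ : ∀ i n (k : ℕ), ∫ x, |w i n x - trunc k (w i n x)| ∂cellVol d ≤ δ i k) :
    ∃ σ : ℕ → ℕ, StrictMono σ ∧ ∀ i, ∃ W, StronglyMeasurable W ∧ Integrable W (torVol₂ d) ∧
      TSConv (fun n => ε (σ n)) (fun n => w i (σ n)) W := by
  let Ψ : ℕ → C(Tor d × Tor d, ℝ) := TopologicalSpace.denseSeq _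
  have htc : ∀ i (k : ℕ) n, Continuous fun x => trunc k (w i n x) := fun i k n =>
    (continuous_trunc k).comp (hw i n)
  have hC : ∀ i (k : ℕ) n, ∫ x, |trunc k (w i n x)| ∂cellVol d ≤ k := fun i k n => by
    have := integral_mono (μ := cellVol d) (htc i k n).integrable_cellVol.abs
      (integrable_const (k : ℝ)) fun x => abs_trunc_le (Nat.cast_nonneg k) (w i n x)
    simpa using this
  -- The indices are the sequence, the truncation height and a member of a dense family of test
  -- functions.
  obtain ⟨σ, hσ, hl⟩ := exists_common_subseq (ι := ι × ℕ × ℕ)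
    (fun p n => ∫ x, trunc p.2.1 (w p.1 n x) * Ψ p.2.2 (pr x, pr ((ε n)⁻¹ • x)) ∂cellVol d)
    fun p => ⟨_, fun n => abs_integral_mul_osc_le (htc _ _ _) (hC _ _ _) _ _⟩
  refine ⟨σ, hσ, fun i => ?_⟩
  have h1 : ∀ k : ℕ, ∃ W, MemLp W 2 (torVol₂ d) ∧
      TSConv (fun n => ε (σ n)) (fun n x => trunc k (w i (σ n) x)) W := fun k =>
    exists_tsConv_of_bounded (fun n => hε _) (hε0.comp hσ.tendsto_atTop) (fun n => htc i k _)
      (k := k) (fun n x => abs_trunc_le (Nat.cast_nonneg k) _)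
      (exists_tendsto_of_dense (fun n => htc i k _) (fun n => hC i k _)
        (TopologicalSpace.denseRange_denseSeq _) fun j => hl (i, k, j))
  choose Wk hWk hts using h1
  exact exists_tsConv_of_trunc (fun n => hw i _) (hδ i) (fun n k => hwδ i _ k) hWk hts

/-! ### Integrability of two-scale limits -/

theorem eLpNorm_le_of_integral_pow_le {α : Type*} [MeasurableSpace α] {μ : Measure α} {f : α → ℝ}
    {p : ℕ} (hp : p ≠ 0) (hf : Integrable (fun x => |f x| ^ p) μ) {C : ℝ}
    (hC : ∫ x, |f x| ^ p ∂μ ≤ C) :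
    eLpNorm f p μ ≤ ENNReal.ofReal C ^ (1 / (p : ℝ)) := by
  rw [eLpNorm_eq_lintegral_rpow_enorm_toReal (by exact_mod_cast hp) (ENNReal.natCast_ne_top p)]
  simp only [ENNReal.toReal_natCast]
  gcongr
  calc ∫⁻ x, ‖f x‖ₑ ^ (p : ℝ) ∂μ = ∫⁻ x, ENNReal.ofReal (|f x| ^ p) ∂μ := by
        congr 1; ext x
        rw [ENNReal.rpow_natCast, ← ofReal_norm, Real.norm_eq_abs,
          ENNReal.ofReal_pow (abs_nonneg _)]
    _ = ENNReal.ofReal (∫ x, |f x| ^ p ∂μ) :=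
        (ofReal_integral_eq_lintegral_ofReal hf (ae_of_all _ fun x => by positivity)).symm
    _ ≤ ENNReal.ofReal C := ENNReal.ofReal_le_ofReal hC

/-- Jensen's inequality for partial integrals against a probability measure. -/
theorem eLpNorm_integral_le {α β : Type*} [MeasurableSpace α] [MeasurableSpace β] {μ : Measure α}
    {ν : Measure β} [IsProbabilityMeasure ν] {E : Type*} [NormedAddCommGroup E] [NormedSpace ℝ E]
    {F : α × β → E} (hF : AEStronglyMeasurable F (μ.prod ν)) {q : ℝ≥0∞} (hq1 : 1 ≤ q)
    (hq : q ≠ ⊤) : eLpNorm (fun a => ∫ b, F (a, b) ∂ν) q μ ≤ eLpNorm F q (μ.prod ν) := by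
  have hq0 : q ≠ 0 := (zero_lt_one.trans_le hq1).ne'
  rw [eLpNorm_eq_lintegral_rpow_enorm_toReal hq0 hq, eLpNorm_eq_lintegral_rpow_enorm_toReal hq0 hq]
  gcongr
  rw [lintegral_prod _ (hF.enorm.pow_const _)]
  refine lintegral_mono_ae ?_
  filter_upwards [hF.prodMk_left] with a ha
  have h1 : ‖∫ b, F (a, b) ∂ν‖ₑ ≤ eLpNorm (fun b => F (a, b)) q ν := by
    refine (enorm_integral_le_lintegral_enorm _).trans ?_
    rw [← eLpNorm_one_eq_lintegral_enorm]
    exact eLpNorm_le_eLpNorm_of_exponent_le hq1 ha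
  calc ‖∫ b, F (a, b) ∂ν‖ₑ ^ q.toReal ≤ eLpNorm (fun b => F (a, b)) q ν ^ q.toReal := by gcongr
    _ = ∫⁻ b, ‖F (a, b)‖ₑ ^ q.toReal ∂ν := by
        rw [eLpNorm_eq_lintegral_rpow_enorm_toReal hq0 hq, ← ENNReal.rpow_mul,
          one_div, inv_mul_cancel₀ (ENNReal.toReal_pos hq0 hq).ne', ENNReal.rpow_one]

theorem memLp_integral_prod {α β : Type*} [MeasurableSpace α] [MeasurableSpace β] {μ : Measure α}
    {ν : Measure β} [IsProbabilityMeasure ν] {E : Type*} [NormedAddCommGroup E] [NormedSpace ℝ E]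
    {F : α × β → E} {q : ℝ≥0∞} (hF : MemLp F q (μ.prod ν)) (hq1 : 1 ≤ q)
    (hq : q ≠ ⊤) : MemLp (fun a => ∫ b, F (a, b) ∂ν) q μ :=
  ⟨hF.1.integral_prod_right', (eLpNorm_integral_le hF.1 hq1 hq).trans_lt hF.2⟩

/-- Bounded functions are almost everywhere limits of equibounded continuous functions. -/
theorem exists_seq_continuousMap_ae {X : Type*} [TopologicalSpace X] [MeasurableSpace X]
    [BorelSpace X] {μ : Measure X} [CompactSpace X] [IsProbabilityMeasure μ] [NormalSpace X]
    [μ.WeaklyRegular] {f : X → ℝ} (hf : AEStronglyMeasurable f μ) {M : ℝ} (hM : 0 ≤ M)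
    (hfM : ∀ᵐ x ∂μ, |f x| ≤ M) :
    ∃ g : ℕ → C(X, ℝ), (∀ n x, |g n x| ≤ M) ∧
      ∀ᵐ x ∂μ, Tendsto (fun n => g n x) atTop (𝓝 (f x)) := by
  have hfi : Integrable f μ := Integrable.of_bound hf M hfM
  have h1 : ∀ n : ℕ, ∃ g : C(X, ℝ), eLpNorm (f - ⇑g) 1 μ ≤ (n + 1 : ℝ≥0∞)⁻¹ := fun n => by
    obtain ⟨g, hg, -⟩ := (memLp_one_iff_integrable.2 hfi).exists_boundedContinuous_eLpNorm_sub_le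
      (ε := (n + 1 : ℝ≥0∞)⁻¹) ENNReal.one_ne_top (by simp)
    exact ⟨g.toContinuousMap, hg⟩
  choose g hg using h1
  have hgm : ∀ n, AEStronglyMeasurable (g n) μ := fun n =>
    ((g n).integrable_of_isProbabilityMeasure (μ := μ)).aestronglyMeasurable
  have h2 : Tendsto (fun n => eLpNorm (⇑(g n) - f) 1 μ) atTop (𝓝 0) := by
    have h3 : Tendsto (fun n : ℕ => (n + 1 : ℝ≥0∞)⁻¹) atTop (𝓝 0) := by
      have := (ENNReal.tendsto_inv_nat_nhds_zero).comp (tendsto_add_atTop_nat 1)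
      simpa [Function.comp_def] using this
    refine tendsto_of_tendsto_of_tendsto_of_le_of_le tendsto_const_nhds h3 (fun n => zero_le)
      fun n => ?_
    simp only
    rw [eLpNorm_sub_comm]
    exact hg n
  obtain ⟨ns, -, hns⟩ := (tendstoInMeasure_of_tendsto_eLpNorm one_ne_zero hgm hf
    h2).exists_seq_tendsto_ae
  -- Truncating the approximants at `M` enforces the bound and does not disturb the limit, which is
  -- already below `M`.
  refine ⟨fun n => ⟨fun x => trunc M (g (ns n) x), (continuous_trunc M).comp (g (ns n)).continuous⟩,
    fun n x => abs_trunc_le hM _, ?_⟩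
  filter_upwards [hns, hfM] with x hx hxM
  have := ((continuous_trunc M).tendsto (f x)).comp hx
  rw [trunc_of_abs_le hxM] at this
  exact this

/-! ### Convexity and lower semicontinuity of `L^p` norms under two-scale convergence. -/

/-- The convex function `a ^ (q + 1)` lies above its tangent at `b`; after taking absolute values
this is Bernoulli's inequality for `|a| / |b|`. -/
theorem tangent_pow_le (q : ℕ) (hq : Odd q) (a b : ℝ) :
    (q + 1) * (b ^ q * a) - q * b ^ (q + 1) ≤ a ^ (q + 1) := by
  have he : Even (q + 1) := hq.add_one
  rw [← he.pow_abs a, ← he.pow_abs b]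
  have h1 : b ^ q * a ≤ |b| ^ q * |a| := by
    rw [← abs_pow, ← abs_mul]; exact le_abs_self _
  have h2 : (q + 1) * (|b| ^ q * |a|) - q * |b| ^ (q + 1) ≤ |a| ^ (q + 1) := by
    rcases (abs_nonneg b).eq_or_lt with hb | hb
    · rw [← hb, zero_pow hq.pos.ne', zero_pow (by omega)]
      simp
    · have h3 := one_add_mul_le_pow (a := |a| / |b| - 1)
        (by have : 0 ≤ |a| / |b| := by positivity
            linarith) (q + 1)
      rw [add_sub_cancel, div_pow, le_div_iff₀ (by positivity)] at h3
      refine le_trans (le_of_eq ?_) h3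
      push_cast
      field_simp
      ring
  have h4 : (q + 1 : ℝ) * (b ^ q * a) ≤ (q + 1) * (|b| ^ q * |a|) :=
    mul_le_mul_of_nonneg_left h1 (by positivity)
  linarith

theorem trunc_pow_le {q : ℕ} (hq : Odd q) {M : ℝ} (hM : 0 ≤ M) (t : ℝ) :
    trunc M t ^ (q + 1) ≤ trunc M t ^ q * t := by
  rw [pow_succ]
  rcases le_or_gt |t| M with h | h
  · rw [trunc_of_abs_le h]
  · unfold trunc
    rcases abs_cases t with ⟨h1, h2⟩ | ⟨h1, h2⟩
    · rw [min_eq_right (by linarith), max_eq_right (by linarith)]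
      exact mul_le_mul_of_nonneg_left (by linarith) (by positivity)
    · rw [min_eq_left (by linarith), max_eq_left (by linarith)]
      have h3 : (-M) ^ q ≤ 0 := hq.pow_nonpos (by linarith)
      nlinarith

/-- The tangent inequality with `b = Ψ(x, x/ε)` is affine in `w`, so it passes to the two-scale
limit. Letting `Ψ` tend to a truncation of `W` bounds the power of that truncation by `C`, and Fatou
removes the truncation. -/
theorem TSConv.memLp {ε : ℕ → ℝ} (hε : ∀ n, 0 < ε n) (hε0 : Tendsto ε atTop (𝓝 0))
    {w : ℕ → Euc d → ℝ} (hw : ∀ n, Continuous (w n)) {W : Tor d × Tor d → ℝ}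
    (hW : Integrable W (torVol₂ d)) (h : TSConv ε w W) {p : ℕ} (hp0 : p ≠ 0) (hp : Even p) {C : ℝ}
    (hC : ∀ n, ∫ x, w n x ^ p ∂cellVol d ≤ C) : MemLp W p (torVol₂ d) := by
  obtain ⟨q, rfl⟩ : ∃ q, p = q + 1 := ⟨p - 1, by omega⟩
  have hq : Odd q := by
    rcases Nat.even_or_odd q with h | h
    · exact absurd hp (Nat.not_even_iff_odd.2 h.add_one)
    · exact h
  have h1 : ∀ Ψ : C(Tor d × Tor d, ℝ),
      (q + 1) * ∫ z, W z * Ψ z ^ q ∂torVol₂ d - q * ∫ z, Ψ z ^ (q + 1) ∂torVol₂ d ≤ C := by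
    intro Ψ
    have ha := (h (Ψ ^ q)).const_mul (q + 1 : ℝ)
    have hb := (tendsto_integral_oscillating hε hε0 (Ψ ^ (q + 1))).const_mul (q : ℝ)
    refine le_of_tendsto' (ha.sub hb) fun n => (le_trans ?_ (hC n))
    have hwn := hw n
    have hΨ := continuous_osc Ψ (ε n)⁻¹
    rw [← integral_const_mul, ← integral_const_mul, ← integral_sub
      (Continuous.integrable_cellVol (by fun_prop)) (Continuous.integrable_cellVol (by fun_prop))]
    refine integral_mono (Continuous.integrable_cellVol (by fun_prop))
      (Continuous.integrable_cellVol (by fun_prop)) fun x => ?_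
    have := tangent_pow_le q hq (w n x) (Ψ (pr x, pr ((ε n)⁻¹ • x)))
    simpa only [ContinuousMap.pow_apply, mul_comm (w n x)] using this
  have h2 : ∀ M : ℝ, 0 ≤ M → ∫ z, |trunc M (W z)| ^ (q + 1) ∂torVol₂ d ≤ C := by
    intro M hM
    have htm : AEStronglyMeasurable (fun z => trunc M (W z)) (torVol₂ d) :=
      (continuous_trunc M).comp_aestronglyMeasurable hW.1
    obtain ⟨g, hgM, hg⟩ := exists_seq_continuousMap_ae htm hM
      (ae_of_all _ fun z => abs_trunc_le hM _)
    have ha : Tendsto (fun n => ∫ z, W z * g n z ^ q ∂torVol₂ d) atTop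
        (𝓝 (∫ z, W z * trunc M (W z) ^ q ∂torVol₂ d)) := by
      refine tendsto_integral_of_dominated_convergence (fun z => |W z| * M ^ q)
        (fun n => (hW.1.mul ((g n).continuous.pow q).aestronglyMeasurable))
        (hW.abs.mul_const _) (fun n => ae_of_all _ fun z => ?_) ?_
      · rw [norm_mul, Real.norm_eq_abs, norm_pow, Real.norm_eq_abs]
        gcongr
        exact hgM n z
      · filter_upwards [hg] with z hz
        exact (hz.pow q).const_mul _
    have hb : Tendsto (fun n => ∫ z, g n z ^ (q + 1) ∂torVol₂ d) atTop
        (𝓝 (∫ z, trunc M (W z) ^ (q + 1) ∂torVol₂ d)) := by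
      refine tendsto_integral_of_dominated_convergence (fun z => M ^ (q + 1))
        (fun n => ((g n).continuous.pow _).aestronglyMeasurable)
        (integrable_const _) (fun n => ae_of_all _ fun z => ?_) ?_
      · rw [norm_pow, Real.norm_eq_abs]
        gcongr
        exact hgM n z
      · filter_upwards [hg] with z hz
        exact hz.pow _
    have hlim := le_of_tendsto' ((ha.const_mul (q + 1 : ℝ)).sub (hb.const_mul (q : ℝ)))
      fun n => h1 (g n)
    -- Together with the limit inequality this leaves the coefficient `(q + 1) - q = 1`.
    have hmono : ∫ z, trunc M (W z) ^ (q + 1) ∂torVol₂ d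
        ≤ ∫ z, W z * trunc M (W z) ^ q ∂torVol₂ d := by
      refine integral_mono ?_ ?_ fun z => ?_
      · refine Integrable.of_bound (htm.pow _) (M ^ (q + 1)) (ae_of_all _ fun z => ?_)
        rw [norm_pow, Real.norm_eq_abs]
        gcongr
        exact abs_trunc_le hM _
      · refine hW.mul_bdd (c := M ^ q) (htm.pow _) (ae_of_all _ fun z => ?_)
        rw [norm_pow, Real.norm_eq_abs]
        gcongr
        exact abs_trunc_le hM _
      · simp only
        rw [mul_comm]
        exact trunc_pow_le hq hM _
    simp only [hp.pow_abs]
    have hq0 : (0 : ℝ) ≤ q := Nat.cast_nonneg q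
    nlinarith
  refine ⟨hW.1, ?_⟩
  have hlim : ∀ z, Tendsto (fun k : ℕ => trunc k (W z)) atTop (𝓝 (W z)) := by
    intro z
    obtain ⟨N, hN⟩ := exists_nat_ge |W z|
    refine tendsto_const_nhds.congr' (eventually_atTop.2 ⟨N, fun n hn => ?_⟩)
    exact (trunc_of_abs_le (hN.trans (by exact_mod_cast hn))).symm
  have htm : ∀ k : ℕ, AEStronglyMeasurable (fun z => trunc k (W z)) (torVol₂ d) := fun k =>
    (continuous_trunc k).comp_aestronglyMeasurable hW.1
  have hb : ∀ k : ℕ, eLpNorm (fun z => trunc k (W z)) ((q + 1 : ℕ) : ℝ≥0∞) (torVol₂ d)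
      ≤ ENNReal.ofReal C ^ (1 / ((q + 1 : ℕ) : ℝ)) := fun k => by
    refine eLpNorm_le_of_integral_pow_le hp0 ?_ (h2 k (Nat.cast_nonneg k))
    refine Integrable.of_bound ((htm k).norm.pow _) ((k : ℝ) ^ (q + 1)) (ae_of_all _ fun z => ?_)
    rw [norm_pow, Real.norm_eq_abs, abs_abs]
    gcongr
    exact abs_trunc_le (Nat.cast_nonneg k) _
  refine (Lp.eLpNorm_lim_le_liminf_eLpNorm htm W (ae_of_all _ hlim)).trans_lt ?_
  refine lt_of_le_of_lt (liminf_le_of_le (by isBoundedDefault) fun b hb' => ?_)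
    (ENNReal.rpow_lt_top_of_nonneg (by positivity) ENNReal.ofReal_ne_top :
      ENNReal.ofReal C ^ (1 / ((q + 1 : ℕ) : ℝ)) < ⊤)
  obtain ⟨k, hk⟩ := hb'.exists
  exact hk.trans (hb k)

/-! ### Weak convergence: from continuous to general test functions -/

/-- The measurable section of `pr` with values in the cell. -/
noncomputable def sec (a : Tor d) : Euc d :=
  WithLp.toLp 2 fun i => (AddCircle.equivIco 1 0 (a i) : ℝ)

theorem measurable_sec : Measurable (sec : Tor d → Euc d) := by
  have h1 : Measurable fun (a : Tor d) (i : Fin d) => (AddCircle.equivIco 1 0 (a i) : ℝ) :=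
    measurable_pi_lambda _ fun i => measurable_subtype_coe.comp
      ((AddCircle.measurableEquivIco 1 0).measurable.comp (measurable_pi_apply i))
  exact (PiLp.volume_preserving_toLp (Fin d)).measurable.comp h1

theorem sec_pr {x : Euc d} (hx : x ∈ cell d) : sec (pr x) = x := by
  ext i
  have : x i ∈ Set.Ico (0 : ℝ) (0 + 1) := by simpa using hx i
  simp only [sec, pr]
  rw [AddCircle.equivIco_coe_eq this]

theorem measurePreserving_sec : MeasurePreserving (sec : Tor d → Euc d) volume (cellVol d) := by
  refine ⟨measurable_sec, ?_⟩
  rw [← measurePreserving_pr.map_eq, Measure.map_map measurable_sec measurable_pr]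
  have : (sec ∘ pr : Euc d → Euc d) =ᵐ[cellVol d] id := by
    filter_upwards [ae_mem_cell] with x hx
    exact sec_pr hx
  rw [Measure.map_congr this, Measure.map_id]

/-- A function on the cell is carried to the torus by `sec`, approximated there, and carried back,
so that the approximants are periodic. -/
theorem exists_continuousMap_eLpNorm_sub_le {p : ℝ≥0∞} (hp : p ≠ ⊤) {g : Euc d → ℝ}
    (hg : MemLp g p (cellVol d)) {δ : ℝ≥0∞} (hδ : δ ≠ 0) :
    ∃ φ : C(Tor d, ℝ), eLpNorm (fun x => g x - φ (pr x)) p (cellVol d) ≤ δ := by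
  have hG : MemLp (g ∘ sec) p (volume : Measure (Tor d)) :=
    hg.comp_measurePreserving measurePreserving_sec
  obtain ⟨φ, hφ, hφm⟩ := hG.exists_boundedContinuous_eLpNorm_sub_le hp hδ
  refine ⟨φ.toContinuousMap, ?_⟩
  rw [← eLpNorm_comp_measurePreserving (hG.1.sub hφm.1) measurePreserving_pr] at hφ
  refine le_of_eq_of_le (eLpNorm_congr_ae ?_) hφ
  filter_upwards [ae_mem_cell] with x hx
  simp [sec_pr hx]

theorem abs_integral_mul_le {α : Type*} [MeasurableSpace α] {μ : Measure α} {p p' : ℝ≥0∞}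
    [p.HolderConjugate p'] {f g : α → ℝ} (hf : MemLp f p μ) (hg : MemLp g p' μ) :
    |∫ x, f x * g x ∂μ| ≤ (eLpNorm f p μ).toReal * (eLpNorm g p' μ).toReal := by
  rw [← ENNReal.toReal_mul]
  have h1 : eLpNorm (f • g) 1 μ ≤ eLpNorm f p μ * eLpNorm g p' μ :=
    eLpNorm_smul_le_mul_eLpNorm hg.1 hf.1
  have h2 : ‖∫ x, f x * g x ∂μ‖ₑ ≤ eLpNorm (f • g) 1 μ := by
    rw [eLpNorm_one_eq_lintegral_enorm]
    exact enorm_integral_le_lintegral_enorm _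
  rw [← Real.norm_eq_abs, ← toReal_enorm]
  exact ENNReal.toReal_mono (ENNReal.mul_ne_top hf.2.ne hg.2.ne) (h2.trans h1)

theorem tendsto_integral_mul_of_memLp {p p' : ℝ≥0∞} [p.HolderConjugate p'] (hp' : p' ≠ ⊤)
    {f : ℕ → Euc d → ℝ} {f₀ : Euc d → ℝ} (hf : ∀ n, MemLp (f n) p (cellVol d))
    (hf₀ : MemLp f₀ p (cellVol d)) {C : ℝ≥0∞} (hC : C ≠ ⊤)
    (hb : ∀ n, eLpNorm (f n) p (cellVol d) ≤ C)
    (h : ∀ φ : C(Tor d, ℝ), Tendsto (fun n => ∫ x, f n x * φ (pr x) ∂cellVol d) atTop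
      (𝓝 (∫ x, f₀ x * φ (pr x) ∂cellVol d)))
    {g : Euc d → ℝ} (hg : MemLp g p' (cellVol d)) :
    Tendsto (fun n => ∫ x, f n x * g x ∂cellVol d) atTop (𝓝 (∫ x, f₀ x * g x ∂cellVol d)) := by
  set B : ℝ := C.toReal + (eLpNorm f₀ p (cellVol d)).toReal + 1 with hB
  have hB0 : 0 < B := by positivity
  rw [Metric.tendsto_atTop]
  intro η hη
  have hη' : 0 < η / (3 * B) := by positivity
  obtain ⟨φ, hφ⟩ := exists_continuousMap_eLpNorm_sub_le hp' hg
    (δ := ENNReal.ofReal (η / (3 * B))) (by simpa using hη')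
  have hφm : MemLp (fun x => φ (pr x)) p' (cellVol d) :=
    Continuous.memLp_cellVol (by fun_prop) p'
  have hgφ : MemLp (fun x => g x - φ (pr x)) p' (cellVol d) := hg.sub hφm
  have hφr : (eLpNorm (fun x => g x - φ (pr x)) p' (cellVol d)).toReal ≤ η / (3 * B) := by
    have := ENNReal.toReal_mono ENNReal.ofReal_ne_top hφ
    rwa [ENNReal.toReal_ofReal hη'.le] at this
  have key : ∀ k : Euc d → ℝ, MemLp k p (cellVol d) → (eLpNorm k p (cellVol d)).toReal < B →
      |∫ x, k x * g x ∂cellVol d - ∫ x, k x * φ (pr x) ∂cellVol d| < η / 3 := by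
    intro k hk hkB
    have h1 := abs_integral_mul_le hk hgφ
    have h2 : ∫ x, k x * (g x - φ (pr x)) ∂cellVol d
        = ∫ x, k x * g x ∂cellVol d - ∫ x, k x * φ (pr x) ∂cellVol d := by
      simp only [mul_sub]
      exact integral_sub (hk.integrable_mul hg) (hk.integrable_mul hφm)
    rw [← h2]
    calc _ ≤ _ := h1
      _ ≤ (eLpNorm k p (cellVol d)).toReal * (η / (3 * B)) := by gcongr
      _ < B * (η / (3 * B)) := by gcongr
      _ = η / 3 := by field_simp
  obtain ⟨N, hN⟩ := Metric.tendsto_atTop.1 (h φ) (η / 3) (by positivity)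
  refine ⟨N, fun n hn => ?_⟩
  have h1 := hN n hn
  have h2 := key (f n) (hf n) (by
    have := ENNReal.toReal_mono hC (hb n)
    have h0 : 0 ≤ (eLpNorm f₀ p (cellVol d)).toReal := ENNReal.toReal_nonneg
    linarith)
  have h3 := key f₀ hf₀ (by
    have h0 : 0 ≤ C.toReal := ENNReal.toReal_nonneg
    linarith)
  rw [Real.dist_eq] at *
  rw [abs_lt] at *
  constructor <;> linarith

/-- Continuous functions are not dense in `L^∞`, so uniform integrability takes over. With `g` an
almost everywhere limit of equibounded continuous `φ j`, the part of `f n` below height `k`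
contributes at most `k ‖g - φ j‖₁`, and the tail at most `2 M δ k`. -/
theorem tendsto_integral_mul_of_bounded {f : ℕ → Euc d → ℝ} {f₀ : Euc d → ℝ}
    (hf : ∀ n, Continuous (f n)) (hf₀ : Integrable f₀ (cellVol d))
    {δ : ℕ → ℝ} (hδ : Tendsto δ atTop (𝓝 0))
    (hfδ : ∀ n (k : ℕ), ∫ x, |f n x - trunc k (f n x)| ∂cellVol d ≤ δ k)
    (h : ∀ φ : C(Tor d, ℝ), Tendsto (fun n => ∫ x, f n x * φ (pr x) ∂cellVol d) atTop
      (𝓝 (∫ x, f₀ x * φ (pr x) ∂cellVol d)))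
    {g : Euc d → ℝ} (hg : MemLp g ⊤ (cellVol d)) :
    Tendsto (fun n => ∫ x, f n x * g x ∂cellVol d) atTop (𝓝 (∫ x, f₀ x * g x ∂cellVol d)) := by
  obtain ⟨M, hM0, hM⟩ : ∃ M : ℝ, 0 ≤ M ∧ ∀ᵐ x ∂cellVol d, |g x| ≤ M := by
    refine ⟨(eLpNormEssSup g (cellVol d)).toReal, ENNReal.toReal_nonneg, ?_⟩
    have htop : eLpNormEssSup g (cellVol d) ≠ ⊤ := by
      have := hg.2.ne
      rwa [eLpNorm_exponent_top] at this
    filter_upwards [ae_le_eLpNormEssSup (f := g) (μ := cellVol d)] with x hx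
    have := ENNReal.toReal_mono htop hx
    simpa using this
  have hGm : AEStronglyMeasurable (g ∘ sec) (volume : Measure (Tor d)) :=
    hg.1.comp_measurePreserving measurePreserving_sec
  obtain ⟨φ, hφM, hφ⟩ := exists_seq_continuousMap_ae hGm hM0
    (measurePreserving_sec.quasiMeasurePreserving.ae hM)
  have hφ' : ∀ᵐ x ∂cellVol d, Tendsto (fun j => φ j (pr x)) atTop (𝓝 (g x)) := by
    filter_upwards [measurePreserving_pr.quasiMeasurePreserving.ae hφ, ae_mem_cell] with x hx hxc
    simpa [sec_pr hxc] using hx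
  have hφc : ∀ j, Continuous fun x : Euc d => φ j (pr x) := fun j => by fun_prop
  have hgi : Integrable g (cellVol d) := hg.integrable (by simp)
  have h1 : Tendsto (fun j => ∫ x, |g x - φ j (pr x)| ∂cellVol d) atTop (𝓝 0) := by
    have := tendsto_integral_of_dominated_convergence (μ := cellVol d)
      (F := fun j x => |g x - φ j (pr x)|) (f := fun _ => (0 : ℝ)) (fun _ => 2 * M)
      (fun j => (hg.1.sub (hφc j).aestronglyMeasurable).norm) (integrable_const _)
      (fun j => by
        filter_upwards [hM] with x hx
        rw [Real.norm_eq_abs, abs_abs]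
        have := hφM j (pr x)
        exact (abs_sub _ _).trans (by linarith))
      (by
        filter_upwards [hφ'] with x hx
        have := (hx.const_sub (g x)).abs
        simpa using this)
    simpa using this
  have h2 : Tendsto (fun j => ∫ x, f₀ x * φ j (pr x) ∂cellVol d) atTop
      (𝓝 (∫ x, f₀ x * g x ∂cellVol d)) := by
    refine tendsto_integral_of_dominated_convergence (fun x => |f₀ x| * M)
      (fun j => hf₀.1.mul (hφc j).aestronglyMeasurable) (hf₀.abs.mul_const _)
      (fun j => ae_of_all _ fun x => ?_) ?_
    · rw [norm_mul]
      exact mul_le_mul_of_nonneg_left (hφM j _) (norm_nonneg _)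
    · filter_upwards [hφ'] with x hx
      exact hx.const_mul _
  have hfg : ∀ n, Integrable (fun x => f n x * g x) (cellVol d) := fun n =>
    (hf n).integrable_cellVol.mul_bdd (c := M) hg.1 hM
  have hfφ : ∀ n j, Integrable (fun x => f n x * φ j (pr x)) (cellVol d) := fun n j =>
    ((hf n).mul (hφc j)).integrable_cellVol
  have h3 : ∀ n (k : ℕ) j, |∫ x, f n x * g x ∂cellVol d - ∫ x, f n x * φ j (pr x) ∂cellVol d|
      ≤ k * ∫ x, |g x - φ j (pr x)| ∂cellVol d + 2 * M * δ k := by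
    intro n k j
    have htc : Continuous fun x => f n x - trunc k (f n x) :=
      (hf n).sub ((continuous_trunc k).comp (hf n))
    have hI1 : Integrable (fun x => k * |g x - φ j (pr x)|) (cellVol d) :=
      (hgi.sub (hφc j).integrable_cellVol).abs.const_mul _
    have hI2 : Integrable (fun x => 2 * M * |f n x - trunc k (f n x)|) (cellVol d) :=
      htc.integrable_cellVol.abs.const_mul _
    rw [← integral_sub (hfg n) (hfφ n j)]
    calc |∫ x, (f n x * g x - f n x * φ j (pr x)) ∂cellVol d|
        ≤ ∫ x, |f n x * g x - f n x * φ j (pr x)| ∂cellVol d := abs_integral_le_integral_abs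
      _ ≤ ∫ x, (k * |g x - φ j (pr x)| + 2 * M * |f n x - trunc k (f n x)|) ∂cellVol d := by
          refine integral_mono_ae ((hfg n).sub (hfφ n j)).abs (hI1.add hI2) ?_
          filter_upwards [hM] with x hx
          have ha : |g x - φ j (pr x)| ≤ 2 * M :=
            (abs_sub _ _).trans (by linarith [hφM j (pr x)])
          have hb : |f n x| ≤ k + |f n x - trunc k (f n x)| := by
            have h4 := abs_trunc_le (Nat.cast_nonneg k) (f n x)
            have h5 := abs_add_le (trunc k (f n x)) (f n x - trunc k (f n x))
            rw [add_sub_cancel] at h5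
            linarith
          rw [← mul_sub, abs_mul]
          nlinarith [abs_nonneg (g x - φ j (pr x)), abs_nonneg (f n x - trunc k (f n x))]
      _ = k * ∫ x, |g x - φ j (pr x)| ∂cellVol d
          + 2 * M * ∫ x, |f n x - trunc k (f n x)| ∂cellVol d := by
          rw [integral_add hI1 hI2, integral_const_mul, integral_const_mul]
      _ ≤ _ := by
          gcongr
          exact hfδ n k
  rw [Metric.tendsto_atTop]
  intro η hη
  have hδM : Tendsto (fun k => 2 * M * δ k) atTop (𝓝 0) := by
    simpa using hδ.const_mul (2 * M)
  -- The order matters: `k` is fixed first, then `j` is chosen to beat the factor `k`, then `N`.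
  obtain ⟨k, hk⟩ := (hδM.eventually (gt_mem_nhds (show 0 < η / 4 by positivity))).exists
  have h1k : Tendsto (fun j => k * ∫ x, |g x - φ j (pr x)| ∂cellVol d) atTop (𝓝 0) := by
    simpa using h1.const_mul (k : ℝ)
  obtain ⟨j, hj1, hj2⟩ := ((h1k.eventually (gt_mem_nhds (show 0 < η / 4 by positivity))).and
    (Metric.tendsto_nhds.1 h2 (η / 4) (by positivity))).exists
  obtain ⟨N, hN⟩ := Metric.tendsto_atTop.1 (h (φ j)) (η / 4) (by positivity)
  refine ⟨N, fun n hn => ?_⟩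
  have e1 := hN n hn
  have e2 := h3 n k j
  rw [Real.dist_eq] at *
  rw [abs_le] at e2
  rw [abs_lt] at *
  constructor <;> linarith

/-! ### Two-scale limits of gradients are curl free in the fast variable -/

theorem integral_prod_pr {W : Tor d × Tor d → ℝ} (hW : Integrable W (torVol₂ d)) :
    ∫ z, W z ∂torVol₂ d = ∫ x, (∫ b, W (pr x, b)) ∂cellVol d := by
  rw [integral_prod _ hW, measurePreserving_pr.integral_comp_of_aesm
    (f := fun a => ∫ b, W (a, b)) hW.integral_prod_left.aestronglyMeasurable]

theorem TSConv.tendsto_marginal {ε : ℕ → ℝ} {w : ℕ → Euc d → ℝ} {W : Tor d × Tor d → ℝ}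
    (hW : Integrable W (torVol₂ d)) (h : TSConv ε w W) (θ φ : C(Tor d, ℝ)) :
    Tendsto (fun n => ∫ x, (w n x * θ (pr ((ε n)⁻¹ • x))) * φ (pr x) ∂cellVol d) atTop
      (𝓝 (∫ x, (∫ b, W (pr x, b) * θ b) * φ (pr x) ∂cellVol d)) := by
  have h1 := h ⟨fun z => θ z.2 * φ z.1, by fun_prop⟩
  rw [integral_prod_pr (integrable_mul_continuousMap hW _)] at h1
  simpa only [ContinuousMap.coe_mk, ← mul_assoc, integral_mul_const] using h1

theorem pd_comm {u : Euc d → ℝ} (hu : ContDiff ℝ ∞ u) (i j : Fin d) (x : Euc d) :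
    pd i (pd j u) x = pd j (pd i u) x := by
  have hd : Differentiable ℝ (fderiv ℝ u) :=
    (hu.fderiv_right (m := ∞) (by simp)).differentiable (by simp)
  have key : ∀ i j : Fin d, pd i (pd j u) x
      = fderiv ℝ (fderiv ℝ u) x (EuclideanSpace.single i 1) (EuclideanSpace.single j 1) := by
    intro i j
    have h := (hd x).hasFDerivAt.clm_apply (hasFDerivAt_const (EuclideanSpace.single j (1 : ℝ)) x)
    show fderiv ℝ (fun y => fderiv ℝ u y (EuclideanSpace.single j 1)) x
      (EuclideanSpace.single i 1) = _
    rw [h.fderiv]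
    simp
  rw [key, key]
  exact second_derivative_symmetric (fun y => (hu.differentiable (by simp) y).hasFDerivAt)
    (hd x).hasFDerivAt _ _

theorem pd_comp_smul {θ : Euc d → ℝ} (hθ : Differentiable ℝ θ) (c : ℝ) (i : Fin d) (x : Euc d) :
    pd i (fun x => θ (c • x)) x = c * pd i θ (c • x) := by
  have h1 : HasFDerivAt (fun x : Euc d => c • x) (c • ContinuousLinearMap.id ℝ (Euc d)) x :=
    (hasFDerivAt_id x).const_smul c
  have h2 : HasFDerivAt (fun x => θ (c • x)) _ x := (hθ (c • x)).hasFDerivAt.comp x h1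
  unfold pd
  rw [h2.fderiv]
  simp

theorem integral_pd_eq_zero_of_hasCompactSupport {F : Euc d → ℝ} (hF : ContDiff ℝ ∞ F)
    (hs : HasCompactSupport F) (i : Fin d) : ∫ x, pd i F x = 0 := by
  have hpd : HasCompactSupport (pd i F) := hs.fderiv_apply (𝕜 := ℝ) _
  have h := integral_mul_fderiv_eq_neg_fderiv_mul_of_integrable (μ := (volume : Measure (Euc d)))
    (f := fun _ => (1 : ℝ)) (g := F) (v := EuclideanSpace.single i 1) (by simp)
    (by simpa using! (contDiff_pd hF i).continuous.integrable_of_hasCompactSupport hpd)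
    (by simpa using hF.continuous.integrable_of_hasCompactSupport hs)
    (fun x _ => by fun_prop) (fun x _ => hF.differentiable (by simp) x)
  simpa [pd] using h

/-- The open cell `(0,1)^d`. -/
def openCell (d : ℕ) : Set (Euc d) := {x | ∀ i, x i ∈ Set.Ioo (0 : ℝ) 1}

theorem isOpen_openCell : IsOpen (openCell d) := by
  have : openCell d = ⋂ i, (fun x : Euc d => x i) ⁻¹' Set.Ioo (0 : ℝ) 1 := by
    ext x; simp [openCell]
  rw [this]
  exact isOpen_iInter_of_finite fun i => isOpen_Ioo.preimage (by fun_prop)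

theorem openCell_subset_cell : openCell d ⊆ cell d := fun _ hx i => ⟨(hx i).1.le, (hx i).2⟩

theorem ae_mem_openCell : ∀ᵐ x ∂cellVol d, x ∈ openCell d := by
  have h0 : ∀ i, ∀ᵐ x ∂cellVol d, x i ≠ 0 := by
    intro i
    refine ae_restrict_of_ae ?_
    have h1 : ∀ᵐ f : Fin d → ℝ, f i ≠ 0 := by
      rw [ae_iff]
      simpa [volume_pi] using Measure.pi_hyperplane (fun _ : Fin d => (volume : Measure ℝ)) i 0
    exact (PiLp.volume_preserving_ofLp (Fin d)).quasiMeasurePreserving.ae h1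
  filter_upwards [ae_mem_cell, ae_all_iff.2 h0] with x hx hx0 i
  exact ⟨lt_of_le_of_ne (hx i).1 (Ne.symm (hx0 i)), (hx i).2⟩

theorem integral_cellVol_of_support {f : Euc d → ℝ} (hf : ∀ x, x ∉ cell d → f x = 0) :
    ∫ x, f x ∂cellVol d = ∫ x, f x :=
  setIntegral_eq_integral_of_forall_compl_eq_zero hf

/-- Set `F_k = θ(x/ε) η ∂_k u` and integrate `∂_i F_j - ∂_j F_i`. The second derivatives of `u`
cancel, and only derivatives of `θ(x/ε)` carry `1/ε`, so the remainder gains a factor `ε`. The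
cutoff `η` is supported in the cell because `θ(x/ε)` need not be periodic in `x`. -/
theorem integral_curl_eq {u θ η : Euc d → ℝ} (hu : ContDiff ℝ ∞ u) (hθ : ContDiff ℝ ∞ θ)
    (hη : ContDiff ℝ ∞ η) (hs : HasCompactSupport η) (hsub : tsupport η ⊆ cell d) {ε : ℝ}
    (hε : 0 < ε) (i j : Fin d) :
    ∫ x, (pd j u x * pd i θ (ε⁻¹ • x) - pd i u x * pd j θ (ε⁻¹ • x)) * η x ∂cellVol d
      = -ε * ∫ x, θ (ε⁻¹ • x) * (pd i η x * pd j u x - pd j η x * pd i u x) ∂cellVol d := by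
  have hθc : ContDiff ℝ ∞ fun x => θ (ε⁻¹ • x) := hθ.comp (by fun_prop)
  have hη0 : ∀ x, x ∉ cell d → η x = 0 := fun x hx =>
    image_eq_zero_of_notMem_tsupport fun h => hx (hsub h)
  have hηd : ∀ k x, x ∉ cell d → pd k η x = 0 := fun k x hx => by
    have : fderiv ℝ η x = 0 :=
      image_eq_zero_of_notMem_tsupport fun h => hx (hsub (tsupport_fderiv_subset ℝ h))
    simp [pd, this]
  have hF : ∀ k, ContDiff ℝ ∞ fun x => (θ (ε⁻¹ • x) * η x) * pd k u x := fun k =>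
    (hθc.mul hη).mul (contDiff_pd hu k)
  have hFs : ∀ k, HasCompactSupport fun x => (θ (ε⁻¹ • x) * η x) * pd k u x := fun k =>
    (hs.mul_left).mul_right
  have hI : ∀ k l, Integrable (pd l fun x => (θ (ε⁻¹ • x) * η x) * pd k u x) := fun k l =>
    (contDiff_pd (hF k) l).continuous.integrable_of_hasCompactSupport
      ((hFs k).fderiv_apply (𝕜 := ℝ) _)
  have hexp : ∀ k l x, pd l (fun x => (θ (ε⁻¹ • x) * η x) * pd k u x) x
      = (ε⁻¹ * pd l θ (ε⁻¹ • x) * η x + θ (ε⁻¹ • x) * pd l η x) * pd k u x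
        + (θ (ε⁻¹ • x) * η x) * pd l (pd k u) x := by
    intro k l x
    have d1 := hθc.differentiable (by simp) x
    have d2 := hη.differentiable (by simp) x
    rw [pd_mul (d1.fun_mul d2) ((contDiff_pd hu k).differentiable (by simp) x), pd_mul d1 d2,
      pd_comp_smul (hθ.differentiable (by simp))]
  have h0 : ∫ x, (pd i (fun x => (θ (ε⁻¹ • x) * η x) * pd j u x) x
      - pd j (fun x => (θ (ε⁻¹ • x) * η x) * pd i u x) x) = 0 := by
    rw [integral_sub (hI j i) (hI i j), integral_pd_eq_zero_of_hasCompactSupport (hF j) (hFs j),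
      integral_pd_eq_zero_of_hasCompactSupport (hF i) (hFs i), sub_zero]
  have hc1 : Continuous fun x =>
      (pd j u x * pd i θ (ε⁻¹ • x) - pd i u x * pd j θ (ε⁻¹ • x)) * η x := by
    have a1 := (contDiff_pd hu i).continuous
    have a2 := (contDiff_pd hu j).continuous
    have a3 := (contDiff_pd hθ i).continuous
    have a4 := (contDiff_pd hθ j).continuous
    have a5 := hη.continuous
    fun_prop
  have hc2 : Continuous fun x =>
      θ (ε⁻¹ • x) * (pd i η x * pd j u x - pd j η x * pd i u x) := by
    have a1 := (contDiff_pd hu i).continuous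
    have a2 := (contDiff_pd hu j).continuous
    have a3 := (contDiff_pd hη i).continuous
    have a4 := (contDiff_pd hη j).continuous
    have a5 := hθ.continuous
    fun_prop
  rw [← integral_cellVol_of_support] at h0
  · have h1 : ∀ x, pd i (fun x => (θ (ε⁻¹ • x) * η x) * pd j u x) x
        - pd j (fun x => (θ (ε⁻¹ • x) * η x) * pd i u x) x
        = ε⁻¹ * ((pd j u x * pd i θ (ε⁻¹ • x) - pd i u x * pd j θ (ε⁻¹ • x)) * η x)
          + θ (ε⁻¹ • x) * (pd i η x * pd j u x - pd j η x * pd i u x) := by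
      intro x
      rw [hexp, hexp, pd_comm hu i j]
      ring
    simp only [h1] at h0
    rw [integral_add (hc1.integrable_cellVol.const_mul _) hc2.integrable_cellVol,
      integral_const_mul] at h0
    rw [← mul_right_inj' hε.ne', mul_add, ← mul_assoc, mul_inv_cancel₀ hε.ne', one_mul,
      mul_zero] at h0
    linarith
  · intro x hx
    rw [hexp, hexp, hη0 x hx, hηd i x hx, hηd j x hx]
    simp

/-- The curl identity has a right side of order `ε`, so its limit vanishes for every cutoff `η`. The
fundamental lemma of the calculus of variations on the open cell then gives a pointwise identity,
with a null set that depends on `θ`. -/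
theorem ae_curl_eq {ε : ℕ → ℝ} (hε : ∀ n, 0 < ε n) (hε0 : Tendsto ε atTop (𝓝 0))
    {u : ℕ → Euc d → ℝ} (hu : ∀ n, SmoothPeriodic (u n)) {C : ℝ}
    (hC : ∀ n i, ∫ x, pd i (u n) x ^ 2 ∂cellVol d ≤ C) {W : Fin d → Tor d × Tor d → ℝ}
    (hWm : ∀ i, StronglyMeasurable (W i)) (hW2 : ∀ i, MemLp (W i) 2 (torVol₂ d))
    (hts : ∀ i, TSConv ε (fun n => pd i (u n)) (W i)) {θ : Euc d → ℝ} (hθ : SmoothPeriodic θ)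
    (i j : Fin d) :
    ∀ᵐ x ∂cellVol d, ∫ y, W j (pr x, pr y) * pd i θ y ∂cellVol d
      = ∫ y, W i (pr x, pr y) * pd j θ y ∂cellVol d := by
  have hlift : ∀ k, ∃ Θ : C(Tor d, ℝ), ∀ y, Θ (pr y) = pd k θ y := fun k =>
    (hθ.pd k).periodic.exists_lift (hθ.pd k).continuous
  choose Θ hΘ using hlift
  let K : Fin d → Fin d → Euc d → ℝ := fun k l x => ∫ b, W k (pr x, b) * Θ l b
  have hK : ∀ k l x, ∫ y, W k (pr x, pr y) * pd l θ y ∂cellVol d = K k l x := by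
    intro k l x
    simp only [← hΘ]
    exact measurePreserving_pr.integral_comp_of_aesm (f := fun b => W k (pr x, b) * Θ l b)
      (((hWm k).comp_measurable measurable_prodMk_left).aestronglyMeasurable.mul
        (Θ l).continuous.aestronglyMeasurable)
  have hWi : ∀ k, Integrable (W k) (torVol₂ d) := fun k => (hW2 k).integrable (by norm_num)
  have hKm : ∀ k l, MemLp (K k l) 2 (cellVol d) := by
    intro k l
    have h1 : MemLp (fun z : Tor d × Tor d => W k z * Θ l z.2) 2 (torVol₂ d) :=
      (hW2 k).of_le_mul (c := ‖Θ l‖)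
        ((hW2 k).1.mul ((Θ l).continuous.comp continuous_snd).aestronglyMeasurable)
        (ae_of_all _ fun z => by
          rw [norm_mul, mul_comm]
          exact mul_le_mul_of_nonneg_right ((Θ l).norm_coe_le_norm _) (norm_nonneg _))
    exact (memLp_integral_prod h1 (by norm_num) (by norm_num)).comp_measurePreserving
      measurePreserving_pr
  have hpc : ∀ n k, Continuous (pd k (u n)) := fun n k => ((hu n).pd k).continuous
  have hfc : ∀ n k l, Continuous fun x => pd k (u n) x * Θ l (pr ((ε n)⁻¹ • x)) := fun n k l => by
    have := hpc n k
    fun_prop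
  have hfb : ∀ n k l, eLpNorm (fun x => pd k (u n) x * Θ l (pr ((ε n)⁻¹ • x))) 2 (cellVol d)
      ≤ ENNReal.ofReal (C * ‖Θ l‖ ^ 2) ^ (1 / ((2 : ℕ) : ℝ)) := by
    intro n k l
    have h1 := hfc n k l
    have h2 := hpc n k
    refine eLpNorm_le_of_integral_pow_le (p := 2) two_ne_zero
      (Continuous.integrable_cellVol (by fun_prop)) ?_
    calc ∫ x, |pd k (u n) x * Θ l (pr ((ε n)⁻¹ • x))| ^ 2 ∂cellVol d
        ≤ ∫ x, pd k (u n) x ^ 2 * ‖Θ l‖ ^ 2 ∂cellVol d := by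
          refine integral_mono (Continuous.integrable_cellVol (by fun_prop))
            (Continuous.integrable_cellVol (by fun_prop)) fun x => ?_
          simp only
          rw [abs_mul, mul_pow, sq_abs]
          gcongr
          exact (Θ l).norm_coe_le_norm _
      _ ≤ C * ‖Θ l‖ ^ 2 := by
          rw [integral_mul_const]
          gcongr
          exact hC n k
  -- Two-scale convergence tests periodic functions only; the uniform `L²` bound extends it to
  -- cutoffs regarded as functions on the cell.
  have hlim : ∀ k l (η : Euc d → ℝ), Continuous η →
      Tendsto (fun n => ∫ x, (pd k (u n) x * Θ l (pr ((ε n)⁻¹ • x))) * η x ∂cellVol d) atTop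
        (𝓝 (∫ x, K k l x * η x ∂cellVol d)) := fun k l η hη =>
    tendsto_integral_mul_of_memLp (p := 2) (p' := 2) (by norm_num)
      (fun n => (hfc n k l).memLp_cellVol 2) (hKm k l)
      (ENNReal.rpow_ne_top_of_nonneg (by positivity) ENNReal.ofReal_ne_top)
      (fun n => hfb n k l) (fun φ => (hts k).tendsto_marginal (hWi k) (Θ l) φ)
      (hη.memLp_cellVol 2)
  have hKi : ∀ k l, Integrable (K k l) (cellVol d) := fun k l => (hKm k l).integrable (by norm_num)
  have hzero : ∀ η : Euc d → ℝ, ContDiff ℝ ∞ η → HasCompactSupport η → tsupport η ⊆ openCell d →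
      ∫ x, η x • (K j i x - K i j x) = 0 := by
    intro η hη hs hsub
    have hsub' : tsupport η ⊆ cell d := hsub.trans openCell_subset_cell
    have hηc := hη.continuous
    have hKη : ∀ k l, Integrable (fun x => K k l x * η x) (cellVol d) := fun k l =>
      (hKm k l).integrable_mul (hηc.memLp_cellVol 2)
    rw [← integral_cellVol_of_support]
    · have h1 := (hlim j i η hηc).sub (hlim i j η hηc)
      rw [← integral_sub (hKη j i) (hKη i j)] at h1
      have h2 : ∫ x, η x • (K j i x - K i j x) ∂cellVol d
          = ∫ x, (K j i x * η x - K i j x * η x) ∂cellVol d := by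
        congr 1; ext x; rw [smul_eq_mul]; ring
      rw [h2]
      refine tendsto_nhds_unique h1 ?_
      obtain ⟨Mθ, hMθ⟩ := hθ.periodic.exists_bound hθ.continuous
      have hη' : ∀ k, ∃ M, ∀ x, |pd k η x| ≤ M := fun k => by
        obtain ⟨M, hM⟩ := (contDiff_pd hη k).continuous.bounded_above_of_compact_support
          (hs.fderiv_apply (𝕜 := ℝ) _)
        exact ⟨M, hM⟩
      obtain ⟨Mi, hMi⟩ := hη' i
      obtain ⟨Mj, hMj⟩ := hη' j
      have hMθ0 : 0 ≤ Mθ := (abs_nonneg _).trans (hMθ 0)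
      have hMi0 : 0 ≤ Mi := (abs_nonneg _).trans (hMi 0)
      have hMj0 : 0 ≤ Mj := (abs_nonneg _).trans (hMj 0)
      have hbound : ∀ n, |∫ x, (pd j (u n) x * Θ i (pr ((ε n)⁻¹ • x))) * η x ∂cellVol d
          - ∫ x, (pd i (u n) x * Θ j (pr ((ε n)⁻¹ • x))) * η x ∂cellVol d|
          ≤ ε n * (Mθ * (Mi * (1 + C) + Mj * (1 + C))) := by
        intro n
        have h3 := integral_curl_eq (hu n).smooth hθ.smooth hη hs hsub' (hε n) i j
        have hpi := hpc n i
        have hpj := hpc n j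
        have hθc := hθ.continuous
        have hηi := (contDiff_pd hη i).continuous
        have hηj := (contDiff_pd hη j).continuous
        have hfη : ∀ k l, Integrable (fun x => (pd k (u n) x * Θ l (pr ((ε n)⁻¹ • x))) * η x)
            (cellVol d) := fun k l => ((hfc n k l).mul hηc).integrable_cellVol
        rw [← integral_sub (hfη j i) (hfη i j)]
        simp only [hΘ, ← sub_mul]
        rw [h3, abs_mul, abs_neg, abs_of_pos (hε n)]
        refine mul_le_mul_of_nonneg_left ?_ (hε n).le
        have hI : ∀ k, Integrable (fun x => 1 + pd k (u n) x ^ 2) (cellVol d) := fun k => by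
          have := hpc n k
          exact Continuous.integrable_cellVol (by fun_prop)
        have hIb : ∀ k, ∫ x, (1 + pd k (u n) x ^ 2) ∂cellVol d ≤ 1 + C := fun k => by
          have := hpc n k
          rw [integral_add (integrable_const _) (Continuous.integrable_cellVol (by fun_prop))]
          simpa using hC n k
        have habs : ∀ t : ℝ, |t| ≤ 1 + t ^ 2 := fun t => by
          rw [abs_le]; constructor <;> nlinarith [sq_nonneg (t - 1), sq_nonneg (t + 1)]
        calc |∫ x, θ ((ε n)⁻¹ • x) * (pd i η x * pd j (u n) x - pd j η x * pd i (u n) x)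
              ∂cellVol d|
            ≤ ∫ x, |θ ((ε n)⁻¹ • x) * (pd i η x * pd j (u n) x - pd j η x * pd i (u n) x)|
              ∂cellVol d := abs_integral_le_integral_abs
          _ ≤ ∫ x, Mθ * (Mi * (1 + pd j (u n) x ^ 2) + Mj * (1 + pd i (u n) x ^ 2))
              ∂cellVol d := by
              refine integral_mono (Continuous.integrable_cellVol (by fun_prop))
                (Continuous.integrable_cellVol (by fun_prop)) fun x => ?_
              simp only
              rw [abs_mul]
              refine mul_le_mul (hMθ _) ?_ (abs_nonneg _) hMθ0
              refine (abs_sub _ _).trans ?_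
              rw [abs_mul, abs_mul]
              exact add_le_add (mul_le_mul (hMi x) (habs _) (abs_nonneg _) hMi0)
                (mul_le_mul (hMj x) (habs _) (abs_nonneg _) hMj0)
          _ = Mθ * (Mi * ∫ x, (1 + pd j (u n) x ^ 2) ∂cellVol d
              + Mj * ∫ x, (1 + pd i (u n) x ^ 2) ∂cellVol d) := by
              rw [integral_const_mul, integral_add ((hI j).const_mul _) ((hI i).const_mul _),
                integral_const_mul, integral_const_mul]
          _ ≤ _ := by
              gcongr
              · exact hIb j
              · exact hIb i
      refine squeeze_zero_norm hbound ?_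
      simpa using hε0.mul_const (Mθ * (Mi * (1 + C) + Mj * (1 + C)))
    · intro x hx
      rw [image_eq_zero_of_notMem_tsupport fun h => hx (hsub' h), zero_smul]
  have hloc : LocallyIntegrableOn (fun x => K j i x - K i j x) (openCell d) volume := by
    have h1 : IntegrableOn (fun x => K j i x - K i j x) (cell d) volume :=
      (hKi j i).sub (hKi i j)
    exact (h1.mono_set openCell_subset_cell).locallyIntegrableOn
  have hae := isOpen_openCell.ae_eq_zero_of_integral_contDiff_smul_eq_zero hloc hzero
  filter_upwards [ae_restrict_of_ae (s := cell d) hae, ae_mem_openCell] with x hx hxo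
  rw [hK, hK]
  exact sub_eq_zero.1 (hx hxo)

/-! ### Potentials of smooth curl-free periodic fields -/

/-- Uniform measure on the pairs `(s, t)`, `s` in the cell and `t ∈ (0,1]`. -/
noncomputable def rayVol (d : ℕ) : Measure (Euc d × ℝ) :=
  (cellVol d).prod (volume.restrict (Set.Ioc (0 : ℝ) 1))

instance isProbabilityMeasure_rayVol : IsProbabilityMeasure (rayVol d) := by
  have : IsProbabilityMeasure (volume.restrict (Set.Ioc (0 : ℝ) 1)) := ⟨by simp⟩
  unfold rayVol
  infer_instance

theorem ae_rayVol_mem_cell : ∀ᵐ p ∂rayVol d, p.1 ∈ cell d :=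
  Measure.quasiMeasurePreserving_fst.ae ae_mem_cell

theorem fderiv_apply_eq_sum (f : Euc d → ℝ) (x v : Euc d) :
    fderiv ℝ f x v = ∑ i, pd i f x * v i := by
  conv_lhs => rw [show v = ∑ i, v i • EuclideanSpace.single i (1 : ℝ) by
    ext j; simp [Pi.single_apply]]
  simp [pd, mul_comm]

theorem SmoothPeriodic.exists_bound_fderiv {f : Euc d → ℝ} (hf : SmoothPeriodic f) :
    ∃ C, ∀ x, ‖fderiv ℝ f x‖ ≤ C := by
  have hg := continuous_gradient hf.smooth
  obtain ⟨C, hC⟩ := hf.periodic.norm_gradient.exists_bound (by fun_prop)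
  exact ⟨C, fun x => by rw [← norm_gradient]; simpa using hC x⟩

/-- The average over the cell of the line integrals of the field `h`. -/
noncomputable def rayIntegral (h : Fin d → Euc d → ℝ) (y : Euc d) : ℝ :=
  ∫ p, ∑ i, h i (y - p.2 • p.1) * p.1 i ∂rayVol d

/-- Curl-freeness turns the `j`-th derivative of the integrand into the derivative of `h j` in the
direction `s`. Integration in `t` gives `h j y - h j (y - s)`, and the average over `s` removes the
second term since `h j` has mean zero. Averaging over starting points also keeps the potential
visibly periodic. -/
theorem hasFDerivAt_rayIntegral {h : Fin d → Euc d → ℝ} (hh : ∀ i, SmoothPeriodic (h i))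
    (hcurl : ∀ i j x, pd i (h j) x = pd j (h i) x) (hmean : ∀ i, ∫ x, h i x ∂cellVol d = 0)
    (y : Euc d) :
    HasFDerivAt (rayIntegral h) (∑ j, h j y • (EuclideanSpace.proj j : Euc d →L[ℝ] ℝ)) y := by
  have hhc : ∀ i, Continuous (h i) := fun i => (hh i).continuous
  have hhf : ∀ i, Continuous (fderiv ℝ (h i)) := fun i =>
    (hh i).smooth.continuous_fderiv (by simp)
  choose C hC using fun i => (hh i).exists_bound_fderiv
  choose B hB using fun i => (hh i).periodic.exists_bound (hhc i)
  let F' : Euc d → Euc d × ℝ → (Euc d →L[ℝ] ℝ) := fun y p =>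
    ∑ i, p.1 i • fderiv ℝ (h i) (y - p.2 • p.1)
  have hF'c : ∀ y, Continuous (F' y) := fun y => by
    refine continuous_finsetSum _ fun i _ => ?_
    have h1 : Continuous fun p : Euc d × ℝ => fderiv ℝ (h i) (y - p.2 • p.1) :=
      (hhf i).comp (f := fun p : Euc d × ℝ => y - p.2 • p.1) (by fun_prop)
    have h2 : Continuous fun p : Euc d × ℝ => p.1 i := by fun_prop
    exact h2.smul h1
  have hF'b : ∀ y, ∀ p : Euc d × ℝ, p.1 ∈ cell d → ‖F' y p‖ ≤ ∑ i, C i := fun y p hp => by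
    refine (norm_sum_le _ _).trans (Finset.sum_le_sum fun i _ => ?_)
    rw [norm_smul]
    have h1 := norm_le_of_mem_cell hp i
    calc ‖p.1 i‖ * ‖fderiv ℝ (h i) (y - p.2 • p.1)‖ ≤ 1 * C i :=
          mul_le_mul h1 (hC i _) (norm_nonneg _) zero_le_one
      _ = C i := one_mul _
  have hmain : HasFDerivAt (rayIntegral h) (∫ p, F' y p ∂rayVol d) y := by
    refine hasFDerivAt_integral_of_dominated_of_fderiv_le (s := Set.univ)
      (bound := fun _ => ∑ i, C i) univ_mem ?_ ?_ (hF'c y).aestronglyMeasurable ?_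
      (integrable_const _) ?_
    · refine Eventually.of_forall fun x => Continuous.aestronglyMeasurable ?_
      fun_prop
    · refine Integrable.of_bound (Continuous.aestronglyMeasurable (by fun_prop)) (∑ i, B i) ?_
      filter_upwards [ae_rayVol_mem_cell] with p hp
      refine (norm_sum_le _ _).trans (Finset.sum_le_sum fun i _ => ?_)
      rw [norm_mul]
      calc ‖h i (y - p.2 • p.1)‖ * ‖p.1 i‖ ≤ B i * 1 :=
            mul_le_mul (hB i _) (norm_le_of_mem_cell hp i) (norm_nonneg _)
              ((abs_nonneg _).trans (hB i 0))
        _ = B i := mul_one _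
    · filter_upwards [ae_rayVol_mem_cell] with p hp x _ using hF'b x p hp
    · refine ae_of_all _ fun p x _ => ?_
      refine HasFDerivAt.fun_sum fun i _ => ?_
      have h1 : HasFDerivAt (fun x => h i (x - p.2 • p.1)) (fderiv ℝ (h i) (x - p.2 • p.1)) x := by
        have := ((hh i).differentiable (x - p.2 • p.1)).hasFDerivAt.comp x
          ((hasFDerivAt_id x).sub_const (p.2 • p.1))
        simpa using! this
      exact h1.mul_const (p.1 i)
  have hF'i : Integrable (F' y) (rayVol d) := by
    refine Integrable.of_bound (hF'c y).aestronglyMeasurable (∑ i, C i) ?_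
    filter_upwards [ae_rayVol_mem_cell] with p hp using hF'b y p hp
  have hcomp : ∀ j, ∫ p, F' y p (EuclideanSpace.single j 1) ∂rayVol d = h j y := by
    intro j
    have h1 : ∀ p : Euc d × ℝ, F' y p (EuclideanSpace.single j 1)
        = fderiv ℝ (h j) (y - p.2 • p.1) p.1 := by
      intro p
      rw [fderiv_apply_eq_sum]
      simp only [F', sum_apply, smul_apply, smul_eq_mul]
      refine Finset.sum_congr rfl fun i _ => ?_
      rw [hcurl i j, mul_comm]
      rfl
    have hi : Integrable (fun p : Euc d × ℝ => fderiv ℝ (h j) (y - p.2 • p.1) p.1)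
        (rayVol d) := by
      simp only [← h1]
      exact hF'i.apply_continuousLinearMap _
    simp only [h1]
    unfold rayVol at hi ⊢
    rw [integral_prod _ hi]
    have h2 : ∀ s : Euc d, ∫ t in Set.Ioc (0 : ℝ) 1, fderiv ℝ (h j) (y - t • s) s
        = h j y - h j (y - s) := by
      intro s
      have := sub_eq_integral_fderiv ((hh j).smooth.of_le (by simp)) y (-s)
      rw [intervalIntegral.integral_of_le zero_le_one] at this
      simp only [smul_neg, ← sub_eq_add_neg, map_neg] at this
      rw [integral_neg] at this
      linarith
    simp only [h2]
    have hjc := hhc j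
    rw [integral_sub (integrable_const _) (Continuous.integrable_cellVol (by fun_prop)),
      (hh j).periodic.integral_sub hjc, hmean]
    simp
  have heq : ∫ p, F' y p ∂rayVol d = ∑ j, h j y • (EuclideanSpace.proj j : Euc d →L[ℝ] ℝ) := by
    ext v
    rw [ContinuousLinearMap.integral_apply hF'i]
    conv_lhs => rw [show v = ∑ i, v i • EuclideanSpace.single i (1 : ℝ) by
      ext j; simp [Pi.single_apply]]
    simp only [map_sum, map_smul, smul_eq_mul]
    rw [integral_finsetSum _ fun i _ => (hF'i.apply_continuousLinearMap _).const_mul _]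
    simp only [integral_const_mul, hcomp]
    simp [mul_comm]
  rwa [heq] at hmain

theorem smoothPeriodic_rayIntegral {h : Fin d → Euc d → ℝ} (hh : ∀ i, SmoothPeriodic (h i))
    (hcurl : ∀ i j x, pd i (h j) x = pd j (h i) x) (hmean : ∀ i, ∫ x, h i x ∂cellVol d = 0) :
    SmoothPeriodic (rayIntegral h) := by
  have hd := hasFDerivAt_rayIntegral hh hcurl hmean
  refine ⟨contDiff_infty_iff_fderiv.2 ⟨fun y => (hd y).differentiableAt, ?_⟩, fun i x => ?_⟩
  · have : fderiv ℝ (rayIntegral h)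
        = fun y => ∑ j, h j y • (EuclideanSpace.proj j : Euc d →L[ℝ] ℝ) := by
      ext1 y; exact (hd y).fderiv
    rw [this]
    exact ContDiff.sum fun j _ => (hh j).smooth.smul contDiff_const
  · unfold rayIntegral
    congr 1; ext p
    refine Finset.sum_congr rfl fun j _ => ?_
    rw [add_sub_right_comm, (hh j).periodic]

theorem gradient_rayIntegral {h : Fin d → Euc d → ℝ} (hh : ∀ i, SmoothPeriodic (h i))
    (hcurl : ∀ i j x, pd i (h j) x = pd j (h i) x) (hmean : ∀ i, ∫ x, h i x ∂cellVol d = 0)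
    (y : Euc d) (i : Fin d) : gradient (rayIntegral h) y i = h i y := by
  rw [gradient_apply, pd, (hasFDerivAt_rayIntegral hh hcurl hmean y).fderiv]
  simp

/-! ### A peak kernel that is a finite sum of products -/

/-- `k (z - y)` is a finite sum of products of smooth periodic functions of `z` and of `y`. -/
def Separated (k : Euc d → ℝ) : Prop :=
  ∃ (ι : Type) (_ : Fintype ι) (a b : ι → Euc d → ℝ), (∀ l, SmoothPeriodic (a l)) ∧
    (∀ l, SmoothPeriodic (b l)) ∧ ∀ z y, k (z - y) = ∑ l, a l z * b l y

theorem Separated.const (c : ℝ) : Separated fun _ : Euc d => c :=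
  ⟨Unit, inferInstance, fun _ _ => c, fun _ _ => 1, fun _ => SmoothPeriodic.const c,
    fun _ => SmoothPeriodic.const 1, fun z y => by simp⟩

theorem Separated.add {k k' : Euc d → ℝ} (h : Separated k) (h' : Separated k') :
    Separated fun x => k x + k' x := by
  obtain ⟨ι, _, a, b, ha, hb, hk⟩ := h
  obtain ⟨ι', _, a', b', ha', hb', hk'⟩ := h'
  refine ⟨ι ⊕ ι', inferInstance, Sum.elim a a', Sum.elim b b', ?_, ?_, fun z y => ?_⟩
  · rintro (l | l); exacts [ha l, ha' l]
  · rintro (l | l); exacts [hb l, hb' l]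
  · simp [hk, hk']

theorem Separated.mul {k k' : Euc d → ℝ} (h : Separated k) (h' : Separated k') :
    Separated fun x => k x * k' x := by
  obtain ⟨ι, _, a, b, ha, hb, hk⟩ := h
  obtain ⟨ι', _, a', b', ha', hb', hk'⟩ := h'
  refine ⟨ι × ι', inferInstance, fun l x => a l.1 x * a' l.2 x, fun l x => b l.1 x * b' l.2 x,
    fun l => (ha _).mul (ha' _), fun l => (hb _).mul (hb' _), fun z y => ?_⟩
  simp only [hk, hk', Finset.sum_mul_sum, Fintype.sum_prod_type]
  refine Finset.sum_congr rfl fun l _ => Finset.sum_congr rfl fun l' _ => ?_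
  ring

theorem Separated.pow {k : Euc d → ℝ} (h : Separated k) (n : ℕ) : Separated fun x => k x ^ n := by
  induction n with
  | zero => simpa using Separated.const (d := d) 1
  | succ n ih => simpa only [pow_succ] using ih.mul h

theorem Separated.sum {ι : Type*} {k : ι → Euc d → ℝ} (h : ∀ i, Separated (k i)) (s : Finset ι) :
    Separated fun x => ∑ i ∈ s, k i x := by
  classical
  induction s using Finset.induction_on with
  | empty => simpa using Separated.const (d := d) 0
  | insert i s hi ih => simpa only [Finset.sum_insert hi] using (h i).add ih

theorem smoothPeriodic_cos (i : Fin d) :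
    SmoothPeriodic fun x : Euc d => Real.cos (2 * Real.pi * x i) := by
  refine ⟨by fun_prop, fun j x => ?_⟩
  by_cases hij : i = j
  · subst hij
    simp [mul_add]
  · simp [hij]

theorem smoothPeriodic_sin (i : Fin d) :
    SmoothPeriodic fun x : Euc d => Real.sin (2 * Real.pi * x i) := by
  refine ⟨by fun_prop, fun j x => ?_⟩
  by_cases hij : i = j
  · subst hij
    simp [mul_add]
  · simp [hij]

theorem separated_cos (i : Fin d) : Separated fun x : Euc d => Real.cos (2 * Real.pi * x i) := by
  refine ⟨Bool, inferInstance,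
    fun l x => if l then Real.cos (2 * Real.pi * x i) else Real.sin (2 * Real.pi * x i),
    fun l x => if l then Real.cos (2 * Real.pi * x i) else Real.sin (2 * Real.pi * x i),
    ?_, ?_, fun z y => ?_⟩
  · rintro (_ | _)
    · simpa using smoothPeriodic_sin i
    · simpa using smoothPeriodic_cos i
  · rintro (_ | _)
    · simpa using smoothPeriodic_sin i
    · simpa using smoothPeriodic_cos i
  · simp [mul_sub, Real.cos_sub]

/-- The peak is `∑ (1 + cos 2π x_i)`. The cosine of a difference splits into products, so each power
is separated. Convolution with a power therefore depends on only finitely many moments of the field.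
-/
theorem exists_peak (hd : 0 < d) : ∃ c : C(Tor d, ℝ), (∀ a, 0 ≤ c a) ∧ 0 < c 0 ∧
    (∀ a, a ≠ 0 → c a < c 0) ∧ ∀ n : ℕ, Separated fun x : Euc d => c (pr x) ^ n := by
  let k : Euc d → ℝ := fun x => ∑ i, (1 + Real.cos (2 * Real.pi * x i))
  have hk : Separated k :=
    Separated.sum (fun i => (Separated.const 1).add (separated_cos i)) Finset.univ
  have hkp : IsPeriodic k := fun j x => by
    refine Finset.sum_congr rfl fun i _ => ?_
    have := (smoothPeriodic_cos i).periodic j x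
    simp only at this
    rw [this]
  obtain ⟨c, hc⟩ := hkp.exists_lift (by fun_prop)
  have hpr0 : pr (0 : Euc d) = 0 := by ext i; simp [pr]
  have hc0 : c 0 = 2 * d := by
    rw [← hpr0, hc]
    simp only [k, PiLp.zero_apply, mul_zero, Real.cos_zero, Finset.sum_const, Finset.card_univ,
      Fintype.card_fin, nsmul_eq_mul]
    ring
  refine ⟨c, fun a => ?_, ?_, fun a ha => ?_, fun n => ?_⟩
  · obtain ⟨x, rfl⟩ := pr_surjective a
    rw [hc]
    exact Finset.sum_nonneg fun i _ => by linarith [Real.neg_one_le_cos (2 * Real.pi * x i)]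
  · rw [hc0]; positivity
  · obtain ⟨x, rfl⟩ := pr_surjective a
    have h0 : ∃ i, Real.cos (2 * Real.pi * x i) ≠ 1 := by
      by_contra! hcon
      refine ha ?_
      ext i
      obtain ⟨m, hm⟩ := (Real.cos_eq_one_iff _).1 (hcon i)
      have hx : x i = m := by
        have := Real.pi_pos
        field_simp at hm
        linarith
      simp only [pr, hx, Pi.zero_apply]
      rw [QuotientAddGroup.eq_zero_iff, AddSubgroup.mem_zmultiples_iff]
      exact ⟨m, by simp⟩
    obtain ⟨i, hi⟩ := h0
    rw [hc, ← hpr0, hc]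
    refine Finset.sum_lt_sum (fun j _ => ?_) ⟨i, Finset.mem_univ _, ?_⟩
    · simpa using Real.cos_le_one (2 * Real.pi * x j)
    · simpa using lt_of_le_of_ne (Real.cos_le_one (2 * Real.pi * x i)) hi
  · simp only [hc]
    exact hk.pow n

/-! ### Mollification on the torus -/

theorem eLpNorm_translate_ne_top {q : ℝ≥0∞} {k : Tor d → ℝ} (hk : MemLp k q volume) (s : Tor d) :
    eLpNorm (fun a => k (a - s) - k a) q volume ≠ ⊤ :=
  ((hk.comp_measurePreserving (measurePreserving_sub_right volume s)).sub hk).2.ne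

theorem continuous_eLpNorm_translate {q : ℝ≥0∞} (hq1 : 1 ≤ q) (hq : q ≠ ⊤) {k : Tor d → ℝ}
    (hk : MemLp k q volume) :
    Continuous fun s : Tor d => (eLpNorm (fun a => k (a - s) - k a) q volume).toReal := by
  have : Fact (1 ≤ q) := ⟨hq1⟩
  let g : Tor d → C(Tor d, Tor d) := fun s => ⟨fun a => a - s, by fun_prop⟩
  have hg : Continuous g := ContinuousMap.continuous_of_continuous_uncurry _ (by
    change Continuous fun p : Tor d × Tor d => p.2 - p.1
    fun_prop)
  have hgm : ∀ s, MeasurePreserving (g s) (volume : Measure (Tor d)) volume := fun s =>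
    measurePreserving_sub_right volume s
  have h1 : Continuous fun s => ‖Lp.compMeasurePreserving (g s) (hgm s) (hk.toLp k) - hk.toLp k‖ :=
    ((continuous_const.compMeasurePreservingLp hg hgm hq).sub continuous_const).norm
  refine h1.congr fun s => ?_
  rw [Lp.toLp_compMeasurePreserving, ← MemLp.toLp_sub, Lp.norm_toLp]
  rfl

/-- A continuous function attaining its maximum exactly at the origin. -/
structure IsPeak (c : C(Tor d, ℝ)) : Prop where
  nonneg : ∀ a, 0 ≤ c a
  pos : 0 < c 0
  lt : ∀ a, a ≠ 0 → c a < c 0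

theorem IsPeak.integral_pos {c : C(Tor d, ℝ)} (hc : IsPeak c) (n : ℕ) :
    0 < ∫ s, c s ^ n := by
  have hcont : Continuous fun s => c s ^ n := by fun_prop
  refine hcont.integral_pos_of_hasCompactSupport_nonneg_nonzero
    (HasCompactSupport.of_compactSpace _) (fun a => pow_nonneg (hc.nonneg a) n) (x := 0) ?_
  exact (pow_pos hc.pos n).ne'

/-- The probability measure with density proportional to `c ^ n`. -/
noncomputable def peakVol (c : C(Tor d, ℝ)) (n : ℕ) : Measure (Tor d) :=
  volume.withDensity fun s => ENNReal.ofReal ((∫ s, c s ^ n)⁻¹ * c s ^ n)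

theorem IsPeak.isProbabilityMeasure_peakVol {c : C(Tor d, ℝ)} (hc : IsPeak c) (n : ℕ) :
    IsProbabilityMeasure (peakVol c n) := by
  have hcont : Continuous fun s => (∫ s, c s ^ n)⁻¹ * c s ^ n := by fun_prop
  refine ⟨?_⟩
  rw [peakVol, withDensity_apply _ MeasurableSet.univ, Measure.restrict_univ,
    ← ofReal_integral_eq_lintegral_ofReal, integral_const_mul,
    inv_mul_cancel₀ (hc.integral_pos n).ne', ENNReal.ofReal_one]
  · exact ContinuousMap.integrable_of_isProbabilityMeasure ⟨_, hcont⟩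
  · exact ae_of_all _ fun s => mul_nonneg (inv_nonneg.2 (hc.integral_pos n).le)
      (pow_nonneg (hc.nonneg s) n)

theorem IsPeak.integral_peakVol {c : C(Tor d, ℝ)} (hc : IsPeak c) (n : ℕ) (g : Tor d → ℝ) :
    ∫ s, g s ∂peakVol c n = (∫ s, c s ^ n)⁻¹ * ∫ s, c s ^ n * g s := by
  have hcont : Continuous fun s => (∫ s, c s ^ n)⁻¹ * c s ^ n := by fun_prop
  rw [peakVol, integral_withDensity_eq_integral_toReal_smul (by fun_prop)
    (ae_of_all _ fun s => ENNReal.ofReal_lt_top), ← integral_const_mul]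
  congr 1; ext s
  rw [ENNReal.toReal_ofReal (mul_nonneg (inv_nonneg.2 (hc.integral_pos n).le)
      (pow_nonneg (hc.nonneg s) n)), smul_eq_mul, mul_assoc]

theorem IsPeak.lintegral_peakVol {c : C(Tor d, ℝ)} (hc : IsPeak c) (n : ℕ) {g : Tor d → ℝ}
    (hg : Continuous g) (hg0 : ∀ s, 0 ≤ g s) :
    ∫⁻ s, ENNReal.ofReal (g s) ∂peakVol c n
      = ENNReal.ofReal ((∫ s, c s ^ n)⁻¹ * ∫ s, c s ^ n * g s) := by
  have := hc.isProbabilityMeasure_peakVol n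
  have hi : Integrable g (peakVol c n) :=
    ContinuousMap.integrable_of_isProbabilityMeasure ⟨g, hg⟩
  rw [← hc.integral_peakVol, ofReal_integral_eq_lintegral_ofReal hi (ae_of_all _ hg0)]

/-- Normalised powers of a function with a unique maximum concentrate at that maximum. -/
theorem IsPeak.tendsto_average {c : C(Tor d, ℝ)} (hc : IsPeak c) {g : Tor d → ℝ}
    (hg : Continuous g) :
    Tendsto (fun n : ℕ => (∫ s, c s ^ n)⁻¹ * ∫ s, c s ^ n * g s) atTop (𝓝 (g 0)) := by
  have := tendsto_setIntegral_pow_smul_of_unique_maximum_of_isCompact_of_continuousOn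
    (μ := (volume : Measure (Tor d))) (s := Set.univ) (x₀ := 0) isCompact_univ
    (c.continuous.continuousOn) (fun y _ hy => hc.lt y hy) (fun x _ => hc.nonneg x) hc.pos
    (by simp) hg.continuousOn
  simpa using this

/-- Averages of the translates of `k` with weight `c ^ n`. -/
noncomputable def mollify (c : C(Tor d, ℝ)) (n : ℕ) (k : Tor d → ℝ) (a : Tor d) : ℝ :=
  ∫ s, k (a - s) ∂peakVol c n

/-- By Jensen and Fubini, the `q`-th power of the error is at most the average over `s` of `‖k(· -
s) - k‖_q^q`. This function of `s` is continuous and vanishes at `0`, where the weights concentrate.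
-/
theorem IsPeak.tendsto_mollify {c : C(Tor d, ℝ)} (hc : IsPeak c) {q : ℝ≥0∞} (hq1 : 1 ≤ q)
    (hq : q ≠ ⊤) {k : Tor d → ℝ} (hkm : StronglyMeasurable k) (hk : MemLp k q volume) :
    Tendsto (fun n => eLpNorm (fun a => mollify c n k a - k a) q volume) atTop (𝓝 0) := by
  have hq0 : q ≠ 0 := (zero_lt_one.trans_le hq1).ne'
  have hqr : 0 < q.toReal := ENNReal.toReal_pos hq0 hq
  set g : Tor d → ℝ := fun s => (eLpNorm (fun a => k (a - s) - k a) q volume).toReal ^ q.toReal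
    with hgdef
  have hg : Continuous g :=
    (continuous_eLpNorm_translate hq1 hq hk).rpow_const fun _ => Or.inr hqr.le
  have hg0 : ∀ s, 0 ≤ g s := fun s => Real.rpow_nonneg ENNReal.toReal_nonneg _
  have hg00 : g 0 = 0 := by simp [hgdef, hqr.ne']
  have hki : Integrable k volume := hk.integrable hq1
  have hle : ∀ n, eLpNorm (fun a => mollify c n k a - k a) q volume
      ≤ ENNReal.ofReal ((∫ s, c s ^ n)⁻¹ * ∫ s, c s ^ n * g s) ^ (1 / q.toReal) := by
    intro n
    have := hc.isProbabilityMeasure_peakVol n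
    let F : Tor d × Tor d → ℝ := fun p => k (p.1 - p.2) - k p.1
    have hF : StronglyMeasurable F :=
      (hkm.comp_measurable (measurable_fst.sub measurable_snd)).sub
        (hkm.comp_measurable measurable_fst)
    have h1 : ∀ᵐ a : Tor d, mollify c n k a - k a = ∫ s, F (a, s) ∂peakVol c n := by
      refine ae_of_all _ fun a => ?_
      have hac : Integrable (fun s => k (a - s)) (peakVol c n) := by
        rw [peakVol, integrable_withDensity_iff_integrable_smul₀' (by fun_prop)
          (ae_of_all _ fun s => ENNReal.ofReal_lt_top)]
        have h2 : Integrable (fun s => k (a - s)) volume :=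
          (Measure.measurePreserving_sub_left volume a).integrable_comp_of_integrable hki
        have h3 := integrable_mul_continuousMap h2
          ⟨fun s => (∫ s, c s ^ n)⁻¹ * c s ^ n, by fun_prop⟩
        refine h3.congr (ae_of_all _ fun s => ?_)
        simp only [ContinuousMap.coe_mk, smul_eq_mul]
        rw [ENNReal.toReal_ofReal (mul_nonneg (inv_nonneg.2 (hc.integral_pos n).le)
          (pow_nonneg (hc.nonneg s) n)), mul_comm]
      simp only [F]
      rw [integral_sub hac (integrable_const _)]
      simp [mollify]
    rw [eLpNorm_congr_ae h1]
    refine (eLpNorm_integral_le hF.aestronglyMeasurable hq1 hq).trans ?_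
    rw [eLpNorm_eq_lintegral_rpow_enorm_toReal hq0 hq]
    gcongr
    rw [lintegral_prod_symm' _ (by fun_prop), ← hc.lintegral_peakVol n hg hg0]
    refine le_of_eq (lintegral_congr fun s => ?_)
    rw [hgdef]
    simp only
    rw [← ENNReal.ofReal_rpow_of_nonneg ENNReal.toReal_nonneg hqr.le,
      ENNReal.ofReal_toReal (eLpNorm_translate_ne_top hk s),
      eLpNorm_eq_lintegral_rpow_enorm_toReal hq0 hq, ← ENNReal.rpow_mul,
      one_div, inv_mul_cancel₀ hqr.ne', ENNReal.rpow_one]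
  have hlim : Tendsto (fun n : ℕ => ENNReal.ofReal ((∫ s, c s ^ n)⁻¹ * ∫ s, c s ^ n * g s)
      ^ (1 / q.toReal)) atTop (𝓝 0) := by
    have h1 := ENNReal.tendsto_ofReal (hc.tendsto_average hg)
    rw [hg00, ENNReal.ofReal_zero] at h1
    have h2 := ((ENNReal.continuous_rpow_const (y := 1 / q.toReal)).tendsto 0).comp h1
    rwa [ENNReal.zero_rpow_of_pos (by positivity)] at h2
  exact tendsto_of_tendsto_of_tendsto_of_le_of_le tendsto_const_nhds hlim (fun _ => zero_le) hle

theorem integrable_comp_pr {k : Tor d → ℝ} (hk : Integrable k volume) :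
    Integrable (fun y : Euc d => k (pr y)) (cellVol d) :=
  measurePreserving_pr.integrable_comp_of_integrable hk

theorem integrable_mul_comp_pr {k : Tor d → ℝ} (hk : Integrable k volume) {b : Euc d → ℝ}
    (hb : SmoothPeriodic b) : Integrable (fun y => k (pr y) * b y) (cellVol d) := by
  obtain ⟨B, hB⟩ := hb.periodic.exists_lift hb.continuous
  have := integrable_comp_pr (integrable_mul_continuousMap hk B)
  simpa only [hB] using this

/-- The separated kernel makes the mollification a finite combination of the `a l`, with moments of
`k` as coefficients; all dependence on `z` is in the `a l`. -/
theorem IsPeak.mollify_pr {c : C(Tor d, ℝ)} (hc : IsPeak c) {n : ℕ} {k : Tor d → ℝ}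
    (hk : Integrable k volume) {ι : Type*} [Fintype ι] {a b : ι → Euc d → ℝ}
    (hb : ∀ l, SmoothPeriodic (b l))
    (hab : ∀ z y, c (pr (z - y)) ^ n = ∑ l, a l z * b l y) (z : Euc d) :
    mollify c n k (pr z)
      = ∑ l, a l z * ((∫ s, c s ^ n)⁻¹ * ∫ y, k (pr y) * b l y ∂cellVol d) := by
  have h1 : ∫ s, c s ^ n * k (pr z - s) = ∫ s, c (pr z - s) ^ n * k s := by
    rw [← integral_sub_left_eq_self _ _ (pr z)]
    simp
  have hi : Integrable (fun s => c (pr z - s) ^ n * k s) volume := by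
    have := integrable_mul_continuousMap hk ⟨fun s => c (pr z - s) ^ n, by fun_prop⟩
    simpa only [ContinuousMap.coe_mk, mul_comm] using this
  rw [mollify, hc.integral_peakVol, h1, ← measurePreserving_pr.integral_comp_of_aesm hi.1]
  simp only [← pr_sub, hab, Finset.sum_mul]
  rw [integral_finsetSum]
  · rw [Finset.mul_sum]
    refine Finset.sum_congr rfl fun l _ => ?_
    rw [mul_left_comm, ← integral_const_mul (a l z)]
    congr 2; ext y; ring
  · intro l _
    refine ((integrable_mul_comp_pr hk (hb l)).const_mul (a l z)).congr (ae_of_all _ fun y => ?_)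
    simp only; ring

theorem SmoothPeriodic.sum {ι : Type*} [Fintype ι] {f : ι → Euc d → ℝ}
    (hf : ∀ l, SmoothPeriodic (f l)) : SmoothPeriodic fun x => ∑ l, f l x :=
  ⟨ContDiff.sum fun l _ => (hf l).smooth, fun i x => Finset.sum_congr rfl fun l _ =>
    (hf l).periodic i x⟩

theorem pd_sum_mul_const {ι : Type*} [Fintype ι] {a : ι → Euc d → ℝ}
    (ha : ∀ l, Differentiable ℝ (a l)) (β : ι → ℝ) (i : Fin d) (z : Euc d) :
    pd i (fun x => ∑ l, a l x * β l) z = ∑ l, pd i (a l) z * β l := by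
  have h : HasFDerivAt (fun x => ∑ l, a l x * β l) (∑ l, β l • fderiv ℝ (a l) z) z :=
    HasFDerivAt.fun_sum fun l _ => (ha l z).hasFDerivAt.mul_const (β l)
  rw [pd, h.fderiv]
  simp [pd, mul_comm]

/-- The derivatives of a separated kernel in its two variables are opposite. -/
theorem sum_pd_mul_eq_neg {κ : Euc d → ℝ} {ι : Type*} [Fintype ι] {a b : ι → Euc d → ℝ}
    (ha : ∀ l, SmoothPeriodic (a l)) (hb : ∀ l, SmoothPeriodic (b l))
    (hab : ∀ z y, κ (z - y) = ∑ l, a l z * b l y) (i : Fin d) (z y : Euc d) :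
    ∑ l, pd i (a l) z * b l y = -∑ l, a l z * pd i (b l) y := by
  have hκ : Differentiable ℝ κ := by
    have h1 : κ = fun x => ∑ l, a l x * b l 0 := by ext x; simpa using hab x 0
    rw [h1]
    exact (SmoothPeriodic.sum fun l => (ha l).mul (SmoothPeriodic.const (b l 0))).differentiable
  have h1 : pd i (fun x => ∑ l, a l x * b l y) z = pd i κ (z - y) := by
    have h2 : (fun x => ∑ l, a l x * b l y) = fun x => κ (x - y) := by ext x; rw [hab]
    rw [h2, pd, fderiv_comp_sub, pd]
  have h3 : pd i (fun x => ∑ l, b l x * a l z) y = -pd i κ (z - y) := by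
    have h2 : (fun x => ∑ l, b l x * a l z) = fun x => κ (z - x) := by
      ext x; rw [hab]; simp only [mul_comm]
    have h4 : HasFDerivAt (fun x : Euc d => z - x) (-ContinuousLinearMap.id ℝ (Euc d)) y := by
      simpa using (hasFDerivAt_id y).const_sub z
    have h5 : HasFDerivAt (fun x => κ (z - x)) _ y := (hκ (z - y)).hasFDerivAt.comp y h4
    rw [h2, pd, h5.fderiv]
    simp [pd]
  rw [pd_sum_mul_const fun l => (ha l).differentiable] at h1
  rw [pd_sum_mul_const fun l => (hb l).differentiable] at h3
  rw [h1, ← neg_eq_iff_eq_neg.2 h3]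
  simp only [mul_comm]

/-- A countable family of test functions and a smoothing procedure on the torus that preserves
means, converges in `L^q`, and maps fields whose curl vanishes against the test functions to
curl-free fields. -/
theorem exists_mollifier (hd : 0 < d) :
    ∃ (L : Type) (_ : Countable L) (Θ : L → Euc d → ℝ) (Λ : ℕ → (Tor d → ℝ) → Tor d → ℝ),
      (∀ l, SmoothPeriodic (Θ l)) ∧
      (∀ (q : ℝ≥0∞) (_ : 1 ≤ q) (_ : q ≠ ⊤) (k : Tor d → ℝ), StronglyMeasurable k →
        MemLp k q volume →
        Tendsto (fun n => eLpNorm (fun a => Λ n k a - k a) q volume) atTop (𝓝 0)) ∧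
      (∀ n (k : Tor d → ℝ), Integrable k volume → SmoothPeriodic fun y => Λ n k (pr y)) ∧
      (∀ n (k : Tor d → ℝ), StronglyMeasurable k → Integrable k volume →
        ∫ a, Λ n k a = ∫ a, k a) ∧
      ∀ (k : Fin d → Tor d → ℝ), (∀ i, Integrable (k i) volume) →
        (∀ l i j, ∫ y, k j (pr y) * pd i (Θ l) y ∂cellVol d
          = ∫ y, k i (pr y) * pd j (Θ l) y ∂cellVol d) →
        ∀ n i j z, pd i (fun y => Λ n (k j) (pr y)) z = pd j (fun y => Λ n (k i) (pr y)) z := by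
  obtain ⟨c, hc0, hcpos, hclt, hsep⟩ := exists_peak hd
  have hc : IsPeak c := ⟨hc0, hcpos, hclt⟩
  choose ι hι a b ha hb hab using hsep
  -- The test functions are the factors in `y` of all the separated powers: finitely many for each
  -- `n`.
  refine ⟨Σ n, ι n, inferInstance, fun l => b l.1 l.2, mollify c, fun l => hb _ _,
    fun q hq1 hq k hkm hk => hc.tendsto_mollify hq1 hq hkm hk, fun n k hk => ?_,
    fun n k hkm hk => ?_, fun k hk hcurl n i j z => ?_⟩
  · simp only [hc.mollify_pr hk (hb n) (hab n)]
    exact SmoothPeriodic.sum fun l => (ha n l).mul (SmoothPeriodic.const _)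
  · have := hc.isProbabilityMeasure_peakVol n
    have hac : peakVol c n ≪ volume := withDensity_absolutelyContinuous _ _
    have hmp : MeasurePreserving (fun p : Tor d × Tor d => p.1 - p.2)
        (volume.prod (peakVol c n)) volume := by
      have h1 : MeasurePreserving (fun p : Tor d × Tor d => (p.1, p.2 - p.1))
          ((peakVol c n).prod volume) ((peakVol c n).prod volume) :=
        MeasurePreserving.skew_product (MeasurePreserving.id _)
          (g := fun s a => a - s) (measurable_snd.sub measurable_fst)
          (ae_of_all _ fun s => (measurePreserving_sub_right volume s).map_eq)
      exact (measurePreserving_snd.comp h1).comp Measure.measurePreserving_swap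
    have hi : Integrable (fun p : Tor d × Tor d => k (p.1 - p.2)) (volume.prod (peakVol c n)) :=
      hmp.integrable_comp_of_integrable hk
    have h2 := integral_prod _ hi
    rw [hmp.integral_comp_of_aesm hk.1] at h2
    exact h2.symm
  -- The derivative is moved from the factors in `z` to those in `y`. It then falls on the test
  -- functions, where the curl hypothesis exchanges `i` and `j`.
  · have key : ∀ i j, pd i (fun y => mollify c n (k j) (pr y)) z
        = -((∫ s, c s ^ n)⁻¹ * ∑ l, a n l z * ∫ y, k j (pr y) * pd i (b n l) y ∂cellVol d) := by
      intro i j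
      simp only [hc.mollify_pr (hk j) (hb n) (hab n)]
      rw [pd_sum_mul_const fun l => (ha n l).differentiable]
      have h1 : ∑ l, pd i (a n l) z * ∫ y, k j (pr y) * b n l y ∂cellVol d
          = -∑ l, a n l z * ∫ y, k j (pr y) * pd i (b n l) y ∂cellVol d := by
        simp only [← integral_const_mul]
        rw [← integral_finsetSum _ fun l _ => (integrable_mul_comp_pr (hk j) (hb n l)).const_mul _,
          ← integral_finsetSum _ fun l _ =>
            (integrable_mul_comp_pr (hk j) ((hb n l).pd i)).const_mul _, ← integral_neg]
        congr 1; ext y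
        have := sum_pd_mul_eq_neg (κ := fun x => c (pr x) ^ n) (ha n) (hb n) (hab n) i z y
        simp only [mul_left_comm _ (k j (pr y)), ← Finset.mul_sum]
        rw [this, mul_neg]
      simp only [mul_left_comm _ (∫ s, c s ^ n)⁻¹, ← Finset.mul_sum]
      rw [h1, mul_neg]
    rw [key, key]
    congr 3; ext l
    rw [hcurl ⟨n, l⟩ i j]

/-! ### Potentials of integrable fields -/

section Potential

-- A general group serves two uses: the torus, for a single slice, and the product of two tori with
-- rays in the second factor, for measurability in `(x, y)` jointly.
variable {G : Type*} [AddCommGroup G] [MeasurableSpace G] [MeasurableAdd₂ G] [MeasurableNeg G]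
  {μ : Measure G} [SFinite μ] [μ.IsAddRightInvariant]

/-- The average of the integrals of the field `k` along the rays `t ↦ -σ (s, t)`. -/
noncomputable def potential (σ : Euc d × ℝ → G) (k : Fin d → G → ℝ) (g : G) : ℝ :=
  ∫ p, ∑ i, k i (g - σ p) * p.1 i ∂rayVol d

theorem measurePreserving_sub_ray {σ : Euc d × ℝ → G} (hσ : Measurable σ) :
    MeasurePreserving (fun z : G × (Euc d × ℝ) => z.1 - σ z.2) (μ.prod (rayVol d)) μ := by
  have h1 : MeasurePreserving (fun z : (Euc d × ℝ) × G => (z.1, z.2 - σ z.1))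
      ((rayVol d).prod μ) ((rayVol d).prod μ) :=
    MeasurePreserving.skew_product (MeasurePreserving.id _)
      (g := fun p a => a - σ p) (measurable_snd.sub (hσ.comp measurable_fst))
      (ae_of_all _ fun p => (measurePreserving_sub_right μ (σ p)).map_eq)
  exact (measurePreserving_snd.comp h1).comp Measure.measurePreserving_swap

theorem eLpNorm_ray_le {σ : Euc d × ℝ → G} (hσ : Measurable σ) {k : G → ℝ} (q : ℝ≥0∞)
    (hk : AEStronglyMeasurable k μ) (i : Fin d) :
    eLpNorm (fun z : G × (Euc d × ℝ) => k (z.1 - σ z.2) * z.2.1 i) q (μ.prod (rayVol d))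
      ≤ eLpNorm k q μ := by
  rw [← eLpNorm_comp_measurePreserving hk (measurePreserving_sub_ray hσ)]
  refine eLpNorm_mono_ae ?_
  have h1 : ∀ᵐ z ∂μ.prod (rayVol d), z.2.1 ∈ cell d :=
    Measure.quasiMeasurePreserving_snd.ae ae_rayVol_mem_cell
  filter_upwards [h1] with z hz
  rw [norm_mul]
  exact mul_le_of_le_one_right (norm_nonneg _) (norm_le_of_mem_cell hz i)

theorem memLp_ray {σ : Euc d × ℝ → G} (hσ : Measurable σ) {k : G → ℝ} {q : ℝ≥0∞}
    (hk : MemLp k q μ) (i : Fin d) :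
    MemLp (fun z : G × (Euc d × ℝ) => k (z.1 - σ z.2) * z.2.1 i) q (μ.prod (rayVol d)) := by
  refine ⟨?_, (eLpNorm_ray_le hσ q hk.1 i).trans_lt hk.2⟩
  have h1 := hk.1.comp_measurePreserving (measurePreserving_sub_ray (d := d) (μ := μ) hσ)
  refine h1.mul (Measurable.aestronglyMeasurable ?_)
  fun_prop

theorem memLp_potential {σ : Euc d × ℝ → G} (hσ : Measurable σ) {k : Fin d → G → ℝ} {q : ℝ≥0∞}
    (hq1 : 1 ≤ q) (hq : q ≠ ⊤) (hk : ∀ i, MemLp (k i) q μ) : MemLp (potential σ k) q μ := by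
  have h1 : MemLp (fun z : G × (Euc d × ℝ) => ∑ i, k i (z.1 - σ z.2) * z.2.1 i) q
      (μ.prod (rayVol d)) := memLp_finsetSum _ fun i _ => memLp_ray hσ (hk i) i
  exact memLp_integral_prod h1 hq1 hq

/-- Jensen reduces to translates of `k i` weighted by coordinates of points in the cell, which are
at most one. -/
theorem eLpNorm_potential_le {σ : Euc d × ℝ → G} (hσ : Measurable σ) {k : Fin d → G → ℝ}
    {q : ℝ≥0∞} (hq1 : 1 ≤ q) (hq : q ≠ ⊤) (hk : ∀ i, MemLp (k i) q μ) :
    eLpNorm (potential σ k) q μ ≤ ∑ i, eLpNorm (k i) q μ := by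
  have h1 : MemLp (fun z : G × (Euc d × ℝ) => ∑ i, k i (z.1 - σ z.2) * z.2.1 i) q
      (μ.prod (rayVol d)) := memLp_finsetSum _ fun i _ => memLp_ray hσ (hk i) i
  refine (eLpNorm_integral_le h1.1 hq1 hq).trans ?_
  refine le_trans (le_of_eq ?_) ((eLpNorm_sum_le (fun i _ => (memLp_ray hσ (hk i) i).1) hq1).trans
    (Finset.sum_le_sum fun i _ => eLpNorm_ray_le hσ q (hk i).1 i))
  congr 1; ext z; simp

theorem potential_sub {σ : Euc d × ℝ → G} (hσ : Measurable σ) {k k' : Fin d → G → ℝ}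
    (hk : ∀ i, Integrable (k i) μ) (hk' : ∀ i, Integrable (k' i) μ) :
    ∀ᵐ g ∂μ, potential σ (fun i g => k i g - k' i g) g = potential σ k g - potential σ k' g := by
  have h : ∀ {k : Fin d → G → ℝ}, (∀ i, Integrable (k i) μ) →
      ∀ᵐ g ∂μ, Integrable (fun p => ∑ i, k i (g - σ p) * p.1 i) (rayVol d) := fun {k} hk => by
    have h1 : Integrable (fun z : G × (Euc d × ℝ) => ∑ i, k i (z.1 - σ z.2) * z.2.1 i)
        (μ.prod (rayVol d)) := integrable_finsetSum _ fun i _ =>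
      memLp_one_iff_integrable.1 (memLp_ray hσ (memLp_one_iff_integrable.2 (hk i)) i)
    exact h1.prod_right_ae
  filter_upwards [h hk, h hk'] with g h1 h2
  rw [potential, potential, potential, ← integral_sub h1 h2]
  simp only [sub_mul, Finset.sum_sub_distrib]

theorem integral_potential {σ : Euc d × ℝ → G} (hσ : Measurable σ) {k : Fin d → G → ℝ}
    (hk : ∀ i, Integrable (k i) μ) (hmean : ∀ i, ∫ g, k i g ∂μ = 0) :
    ∫ g, potential σ k g ∂μ = 0 := by
  have h1 : Integrable (fun z : G × (Euc d × ℝ) => ∑ i, k i (z.1 - σ z.2) * z.2.1 i)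
      (μ.prod (rayVol d)) := integrable_finsetSum _ fun i _ =>
    memLp_one_iff_integrable.1 (memLp_ray hσ (memLp_one_iff_integrable.2 (hk i)) i)
  unfold potential
  rw [integral_integral_swap h1]
  refine (integral_congr_ae (ae_of_all _ fun p => ?_)).trans (integral_zero _ ℝ)
  simp only
  rw [integral_finsetSum]
  · refine Finset.sum_eq_zero fun i _ => ?_
    rw [integral_mul_const, integral_sub_right_eq_self (k i), hmean, zero_mul]
  · exact fun i _ => ((measurePreserving_sub_right μ (σ p)).integrable_comp_of_integrable
      (hk i)).mul_const _

end Potential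

/-! ### The corrector -/

theorem norm_le_sum_abs (v : Euc d) : ‖v‖ ≤ ∑ i, |v i| := by
  conv_lhs => rw [show v = ∑ i, v i • EuclideanSpace.single i (1 : ℝ) by
    ext j; simp [Pi.single_apply]]
  refine (norm_sum_le _ _).trans (Finset.sum_le_sum fun i _ => ?_)
  rw [norm_smul]
  simp

theorem aestronglyMeasurable_euc {α : Type*} [MeasurableSpace α] {μ : Measure α} {F : α → Euc d}
    (hF : ∀ i, AEStronglyMeasurable (fun x => F x i) μ) : AEStronglyMeasurable F μ := by
  have h1 : F = fun x => ∑ i, F x i • EuclideanSpace.single i (1 : ℝ) := by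
    ext x j; simp [Pi.single_apply]
  rw [h1]
  exact Finset.aestronglyMeasurable_fun_sum _ fun i _ => (hF i).smul_const _

theorem eLpNorm_euc_le {α : Type*} [MeasurableSpace α] {μ : Measure α} {F : α → Euc d}
    {q : ℝ≥0∞} (hq1 : 1 ≤ q) (hF : ∀ i, AEStronglyMeasurable (fun x => F x i) μ) :
    eLpNorm F q μ ≤ ∑ i, eLpNorm (fun x => F x i) q μ := by
  calc eLpNorm F q μ ≤ eLpNorm (∑ i, fun x => |F x i|) q μ := by
        refine eLpNorm_mono_ae_real (ae_of_all _ fun x => ?_)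
        simpa using norm_le_sum_abs (F x)
    _ ≤ ∑ i, eLpNorm (fun x => |F x i|) q μ :=
        eLpNorm_sum_le (fun i _ => (hF i).norm) hq1
    _ = ∑ i, eLpNorm (fun x => F x i) q μ :=
        Finset.sum_congr rfl fun i _ => eLpNorm_norm fun x => F x i

theorem memLp_euc {α : Type*} [MeasurableSpace α] {μ : Measure α} {F : α → Euc d}
    {q : ℝ≥0∞} (hq1 : 1 ≤ q) (hF : ∀ i, MemLp (fun x => F x i) q μ) : MemLp F q μ :=
  ⟨aestronglyMeasurable_euc fun i => (hF i).1,
    (eLpNorm_euc_le hq1 fun i => (hF i).1).trans_lt (ENNReal.sum_lt_top.2 fun i _ => (hF i).2)⟩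

/-- The projections to the torus of the segments from the origin to the points of the cell. -/
def torRay (p : Euc d × ℝ) : Tor d := pr (p.2 • p.1)

theorem measurable_torRay : Measurable (torRay : Euc d × ℝ → Tor d) :=
  measurable_pr.comp (by fun_prop)

instance measurableAdd₂_tor₂ : MeasurableAdd₂ (Tor d × Tor d) where
  measurable_add := ((measurable_fst.comp measurable_fst).add
    (measurable_fst.comp measurable_snd)).prodMk ((measurable_snd.comp measurable_fst).add
    (measurable_snd.comp measurable_snd))

instance measurableNeg_tor₂ : MeasurableNeg (Tor d × Tor d) where
  measurable_neg := measurable_fst.neg.prodMk measurable_snd.neg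

instance isAddRightInvariant_torVol₂ : (torVol₂ d).IsAddRightInvariant where
  map_add_right_eq_self g := ((measurePreserving_add_right volume g.1).prod
    (measurePreserving_add_right volume g.2)).map_eq

theorem tendsto_sum_zero {ι : Type*} [Fintype ι] {f : ι → ℕ → ℝ≥0∞}
    (hf : ∀ i, Tendsto (f i) atTop (𝓝 0)) : Tendsto (fun n => ∑ i, f i n) atTop (𝓝 0) := by
  simpa using tendsto_finsetSum Finset.univ fun i _ => hf i

/-- An `L^q` field on the torus that is approximated by smooth curl-free fields of mean zero is the
gradient of a periodic Sobolev function. -/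
theorem memSobolevPer_potential {q : ℝ≥0∞} (hq1 : 1 ≤ q) (hq : q ≠ ⊤) {k : Fin d → Tor d → ℝ}
    (hk : ∀ i, MemLp (k i) q volume) {Λ : ℕ → (Tor d → ℝ) → Tor d → ℝ}
    (hΛ : ∀ i, Tendsto (fun n => eLpNorm (fun a => Λ n (k i) a - k i a) q volume) atTop (𝓝 0))
    (hΛs : ∀ n i, SmoothPeriodic fun y => Λ n (k i) (pr y))
    (hΛm : ∀ n i, ∫ a, Λ n (k i) a = 0)
    (hΛc : ∀ n i j z, pd i (fun y => Λ n (k j) (pr y)) z = pd j (fun y => Λ n (k i) (pr y)) z)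
    {G : Euc d → Euc d} (hG : ∀ y i, G y i = k i (pr y)) :
    MemSobolevPer q (fun y => potential torRay k (pr y)) G := by
  have hΛcont : ∀ n i, Continuous (Λ n (k i)) := fun n i =>
    isOpenQuotientMap_pr.isQuotientMap.continuous_iff.2 (hΛs n i).continuous
  have hΛLp : ∀ n i, MemLp (Λ n (k i)) q volume := fun n i => by
    obtain ⟨C, hC⟩ := (hΛs n i).periodic.exists_bound (hΛs n i).continuous
    refine MemLp.of_bound (hΛcont n i).aestronglyMeasurable C (ae_of_all _ fun a => ?_)
    obtain ⟨y, rfl⟩ := pr_surjective a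
    exact hC y
  have hΛi : ∀ n i, Integrable (Λ n (k i)) volume := fun n i => (hΛLp n i).integrable hq1
  have hki : ∀ i, Integrable (k i) volume := fun i => (hk i).integrable hq1
  have hsm : ∀ n i, ∫ y, Λ n (k i) (pr y) ∂cellVol d = 0 := fun n i => by
    rw [measurePreserving_pr.integral_comp_of_aesm (hΛi n i).1, hΛm]
  -- On the smooth approximants the potential is the averaged line integral, so its gradient is
  -- known; the `L^q` bound carries this to the limit.
  have hpot : ∀ n y, rayIntegral (fun i y => Λ n (k i) (pr y)) y
      = potential torRay (fun i => Λ n (k i)) (pr y) := fun n y => by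
    simp only [rayIntegral, potential, pr_sub, torRay]
  have hmem := memLp_potential (μ := (volume : Measure (Tor d))) measurable_torRay hq1 hq hk
  have hgrad : ∀ n y, gradient (rayIntegral fun i y => Λ n (k i) (pr y)) y - G y
      = WithLp.toLp 2 fun i => Λ n (k i) (pr y) - k i (pr y) := fun n y => by
    ext i
    simp [gradient_rayIntegral (hΛs n) (hΛc n) (hsm n), hG]
  refine ⟨hmem.comp_measurePreserving measurePreserving_pr, ?_,
    fun n => rayIntegral fun i y => Λ n (k i) (pr y),
    fun n => smoothPeriodic_rayIntegral (hΛs n) (hΛc n) (hsm n), ?_, ?_⟩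
  · refine memLp_euc hq1 fun i => ?_
    simp only [hG]
    exact (hk i).comp_measurePreserving measurePreserving_pr
  · refine tendsto_of_tendsto_of_tendsto_of_le_of_le tendsto_const_nhds (tendsto_sum_zero hΛ)
      (fun _ => zero_le) fun n => ?_
    have hmemn := memLp_potential (μ := (volume : Measure (Tor d))) measurable_torRay hq1 hq
      (hΛLp n)
    simp only [hpot]
    calc eLpNorm (fun y : Euc d => potential torRay
            (fun i => Λ n (k i)) (pr y) - potential torRay k (pr y))
            q (cellVol d) = eLpNorm (fun a => potential torRay
            (fun i => Λ n (k i)) a - potential torRay k a) q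
            volume :=
          eLpNorm_comp_measurePreserving (g := fun a => potential torRay (fun i => Λ n (k i)) a
            - potential torRay k a) (hmemn.sub hmem).1 measurePreserving_pr
      _ = eLpNorm (potential torRay
            (fun i a => Λ n (k i) a - k i a)) q volume :=
          (eLpNorm_congr_ae (potential_sub measurable_torRay (hΛi n) hki)).symm
      _ ≤ _ := eLpNorm_potential_le measurable_torRay hq1 hq fun i => (hΛLp n i).sub (hk i)
  · refine tendsto_of_tendsto_of_tendsto_of_le_of_le tendsto_const_nhds (tendsto_sum_zero hΛ)
      (fun _ => zero_le) fun n => ?_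
    simp only [hgrad]
    have h1 : ∀ i, MemLp (fun y : Euc d => Λ n (k i) (pr y) - k i (pr y)) q (cellVol d) :=
      fun i => ((hΛLp n i).sub (hk i)).comp_measurePreserving measurePreserving_pr
    refine (eLpNorm_euc_le hq1 fun i => (h1 i).1).trans (Finset.sum_le_sum fun i _ => le_of_eq ?_)
    exact eLpNorm_comp_measurePreserving (g := fun a => Λ n (k i) a - k i a)
      ((hΛLp n i).sub (hk i)).1 measurePreserving_pr

/-- The corrector is the potential on the product torus with rays `(0, torRay)`. It is in `L^q`
jointly, and its slice at `x` is the potential of the slice of `K`, to which the one-variable result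
applies for almost every `x`. -/
theorem exists_memLpSobolevPer (hd : 0 < d) {q : ℝ≥0∞} (hq1 : 1 ≤ q) (hq : q ≠ ⊤)
    {K : Fin d → Tor d × Tor d → ℝ} (hKm : ∀ i, StronglyMeasurable (K i))
    (hK : ∀ i, MemLp (K i) q (torVol₂ d))
    (hmean : ∀ᵐ x ∂cellVol d, ∀ i, ∫ b, K i (pr x, b) = 0)
    (hcurl : ∀ θ, SmoothPeriodic θ → ∀ i j, ∀ᵐ x ∂cellVol d,
      ∫ y, K j (pr x, pr y) * pd i θ y ∂cellVol d = ∫ y, K i (pr x, pr y) * pd j θ y ∂cellVol d)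
    {G : Euc d × Euc d → Euc d} (hG : ∀ z i, G z i = K i (pr z.1, pr z.2)) :
    ∃ w, MemLpSobolevPer q w G := by
  obtain ⟨L, _, Θ, Λ, hΘ, hΛ, hΛs, hΛm, hΛc⟩ := exists_mollifier hd
  have hσ : Measurable fun p : Euc d × ℝ => ((0 : Tor d), torRay p) :=
    measurable_const.prodMk measurable_torRay
  have hq0 : q ≠ 0 := (zero_lt_one.trans_le hq1).ne'
  have hKi : ∀ i, Integrable (K i) (torVol₂ d) := fun i => (hK i).integrable hq1
  have hmem := memLp_potential (μ := torVol₂ d) hσ hq1 hq hK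
  have hsec : ∀ᵐ x ∂cellVol d, ∀ i, MemLp (fun b => K i (pr x, b)) q volume := by
    rw [ae_all_iff]
    intro i
    have h1 : Integrable (fun z => ‖K i z‖ ^ q.toReal) (torVol₂ d) :=
      (hK i).integrable_norm_rpow hq0 hq
    filter_upwards [measurePreserving_pr.quasiMeasurePreserving.ae h1.prod_right_ae] with x hx
    exact (integrable_norm_rpow_iff ((hKm i).comp_measurable
      measurable_prodMk_left).aestronglyMeasurable hq0 hq).1 hx
  -- Countability of the test family lets the quantifiers be exchanged, giving one null set for all
  -- `l`.
  have hcurl' : ∀ᵐ x ∂cellVol d, ∀ l i j,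
      ∫ y, K j (pr x, pr y) * pd i (Θ l) y ∂cellVol d
        = ∫ y, K i (pr x, pr y) * pd j (Θ l) y ∂cellVol d := by
    simp only [ae_all_iff]
    exact fun l => hcurl _ (hΘ l)
  have heq : ∀ x y : Euc d, potential (fun p : Euc d × ℝ => ((0 : Tor d), torRay p)) K
      (pr x, pr y) = potential torRay (fun i b => K i (pr x, b))
        (pr y) := fun x y => by
    simp only [potential, Prod.mk_sub_mk, sub_zero]
  refine ⟨fun z => potential (fun p : Euc d × ℝ => ((0 : Tor d), torRay p)) K
    (pr z.1, pr z.2), hmem.comp_measurePreserving measurePreserving_pr_prod,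
    memLp_euc hq1 fun i => ?_, ?_, ?_⟩
  · simp only [hG]
    exact (hK i).comp_measurePreserving measurePreserving_pr_prod
  · filter_upwards [hmean, hsec, hcurl'] with x h1 h2 h3
    have hm : ∀ i, StronglyMeasurable fun b => K i (pr x, b) := fun i =>
      (hKm i).comp_measurable measurable_prodMk_left
    have hi : ∀ i, Integrable (fun b => K i (pr x, b)) volume := fun i => (h2 i).integrable hq1
    simp only [heq]
    exact memSobolevPer_potential hq1 hq h2 (fun i => hΛ q hq1 hq _ (hm i) (h2 i))
      (fun n i => hΛs n _ (hi i)) (fun n i => by rw [hΛm n _ (hm i) (hi i), h1])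
      (hΛc _ hi h3) (fun y i => hG _ _)
  · filter_upwards [hmean, hsec] with x h1 h2
    have hi : ∀ i, Integrable (fun b => K i (pr x, b)) volume := fun i => (h2 i).integrable hq1
    simp only [heq]
    rw [measurePreserving_pr.integral_comp_of_aesm (memLp_potential measurable_torRay hq1 hq h2).1]
    exact integral_potential measurable_torRay hi h1

/-! ### Compactness of the sequence of solutions -/

/-- Arzelà–Ascoli is applied on the compact torus; openness of `pr` transfers neighbourhoods, hence
equicontinuity. -/
theorem exists_subseq_tendstoUniformly {u : ℕ → Euc d → ℝ} (hper : ∀ n, IsPeriodic (u n))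
    (hcont : ∀ n, Continuous (u n)) {A K : ℝ} (hA : ∀ n y, |u n y| ≤ A)
    (hK : ∀ n y z, |u n y - u n z| ≤ K * √‖y - z‖) :
    ∃ (u₀ : Euc d → ℝ) (σ : ℕ → ℕ), StrictMono σ ∧ IsPeriodic u₀ ∧
      (∀ y z, |u₀ y - u₀ z| ≤ K * √‖y - z‖) ∧ TendstoUniformly (fun n => u (σ n)) u₀ atTop := by
  choose U hU using fun n => (hper n).exists_lift (hcont n)
  let U' : ℕ → BoundedContinuousFunction (Tor d) ℝ := fun n =>
    BoundedContinuousFunction.mkOfCompact (U n)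
  have hU' : ∀ n x, U' n (pr x) = u n x := hU
  have hcpt : IsCompact (closure (Set.range U')) := by
    refine BoundedContinuousFunction.arzela_ascoli (Set.Icc (-A) A) isCompact_Icc _ ?_ fun a => ?_
    · rintro _ a ⟨n, rfl⟩
      obtain ⟨x, rfl⟩ := pr_surjective a
      rw [hU']
      exact abs_le.1 (hA n x)
    · obtain ⟨x, rfl⟩ := pr_surjective a
      rw [Metric.equicontinuousAt_iff_right]
      intro η hη
      rw [← isOpenQuotientMap_pr.map_nhds_eq, eventually_map]
      have h1 : Tendsto (fun y => K * √‖x - y‖) (𝓝 x) (𝓝 0) := by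
        have : Continuous fun y => K * √‖x - y‖ := by fun_prop
        simpa using this.tendsto x
      filter_upwards [h1.eventually (gt_mem_nhds hη)] with y hy
      rintro ⟨_, n, rfl⟩
      rw [Real.dist_eq, hU', hU']
      exact (hK n x y).trans_lt hy
  obtain ⟨U₀, -, σ, hσ, hlim⟩ := hcpt.tendsto_subseq fun n => subset_closure (Set.mem_range_self n)
  have hunif : TendstoUniformly (fun n => u (σ n)) (fun x => U₀ (pr x)) atTop := by
    have h1 := (BoundedContinuousFunction.tendsto_iff_tendstoUniformly.1 hlim).comp pr
    have h2 : (fun n => u (σ n)) = fun n => ⇑((U' ∘ σ) n) ∘ pr := by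
      ext n x; exact (hU' (σ n) x).symm
    rw [h2]
    exact h1
  refine ⟨fun x => U₀ (pr x), σ, hσ, IsPeriodic.comp_pr U₀, fun y z => ?_, hunif⟩
  exact le_of_tendsto ((hunif.tendsto_at y).sub (hunif.tendsto_at z)).abs
    (Eventually.of_forall fun n => hK (σ n) y z)

theorem holderWith_half {u : Euc d → ℝ} {K : ℝ} (hK : ∀ y z, |u y - u z| ≤ K * √‖y - z‖) :
    HolderWith K.toNNReal (1 / 2) u := by
  intro y z
  rw [edist_dist, edist_dist, Real.dist_eq, dist_eq_norm, NNReal.coe_div, NNReal.coe_one,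
    NNReal.coe_ofNat, ENNReal.ofReal_rpow_of_nonneg (norm_nonneg _) (by norm_num),
    ← Real.sqrt_eq_rpow, ← ENNReal.ofReal, ← ENNReal.ofReal_mul' (Real.sqrt_nonneg _)]
  exact ENNReal.ofReal_le_ofReal (hK y z)

/-! ### Tail bounds for truncations from second moments and from entropy. -/

theorem abs_sub_trunc_le_sq (k : ℕ) (t : ℝ) : |t - trunc k t| ≤ (t ^ 2 + 1) / (k + 1) := by
  have hk : (0 : ℝ) ≤ k := Nat.cast_nonneg k
  rcases le_or_gt |t| k with h | h
  · rw [trunc_of_abs_le h, sub_self, abs_zero]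
    positivity
  · have h1 : |t - trunc k t| ≤ |t| - k := by
      unfold trunc
      rcases le_total 0 t with ht | ht
      · rw [abs_of_nonneg ht] at h ⊢
        rw [min_eq_right h.le, max_eq_right (by linarith), abs_of_nonneg (by linarith)]
      · rw [abs_of_nonpos ht] at h ⊢
        rw [min_eq_left (by linarith), max_eq_left (by linarith), abs_of_nonpos (by linarith)]
        linarith
    refine h1.trans ?_
    rw [le_div_iff₀ (by positivity), ← sq_abs t]
    nlinarith [sq_nonneg (|t| - 2 * k), sq_nonneg (3 * |t| - 2)]

theorem tendsto_div_natCast_add_one (C : ℝ) :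
    Tendsto (fun k : ℕ => C / ((k : ℝ) + 1)) atTop (𝓝 0) :=
  tendsto_const_nhds.div_atTop (tendsto_natCast_atTop_atTop.atTop_add tendsto_const_nhds)

theorem integral_abs_sub_trunc_le_sq {w : Euc d → ℝ} (hw : Continuous w) {C : ℝ}
    (hC : ∫ x, w x ^ 2 ∂cellVol d ≤ C) (k : ℕ) :
    ∫ x, |w x - trunc k (w x)| ∂cellVol d ≤ (C + 1) / (k + 1) := by
  have ht := continuous_trunc k
  calc ∫ x, |w x - trunc k (w x)| ∂cellVol d
      ≤ ∫ x, (w x ^ 2 + 1) / ((k : ℝ) + 1) ∂cellVol d := by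
        refine integral_mono (Continuous.integrable_cellVol (by fun_prop))
          (Continuous.integrable_cellVol (by fun_prop)) fun x => abs_sub_trunc_le_sq k (w x)
    _ = (∫ x, w x ^ 2 ∂cellVol d + 1) / (k + 1) := by
        rw [integral_div, integral_add (Continuous.integrable_cellVol (by fun_prop))
          (integrable_const _)]
        simp
    _ ≤ (C + 1) / (k + 1) := by gcongr

/-- Above height `k` the bound follows from `ln s ≤ s - 1` at `s = (k + 2) / t`. The shift by `2`
keeps the logarithm positive at `k = 0`. -/
theorem abs_sub_trunc_le_mul_log (k : ℕ) {t : ℝ} (ht : 0 < t) :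
    |t - trunc k t| ≤ (t * Real.log t + 2) / Real.log (k + 2) := by
  have hk : (0 : ℝ) ≤ k := Nat.cast_nonneg k
  have hL : 0 < Real.log (k + 2) := Real.log_pos (by linarith)
  have hlog : t - 1 ≤ t * Real.log t := by
    have := Real.one_sub_inv_le_log_of_pos ht
    calc t - 1 = t * (1 - t⁻¹) := by field_simp
      _ ≤ t * Real.log t := by gcongr
  rw [le_div_iff₀ hL]
  rcases le_or_gt t k with h | h
  · rw [trunc_of_abs_le (by rwa [abs_of_pos ht]), sub_self, abs_zero, zero_mul]
    linarith
  · have h1 : |t - trunc k t| = t - k := by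
      unfold trunc
      rw [min_eq_right h.le, max_eq_right (by linarith), abs_of_nonneg (by linarith)]
    have h2 : t * Real.log (k + 2) ≤ t * Real.log t - t + (k + 2) := by
      have h3 := Real.log_le_sub_one_of_pos (show 0 < ((k : ℝ) + 2) / t by positivity)
      rw [Real.log_div (by positivity) ht.ne'] at h3
      have h4 := mul_le_mul_of_nonneg_left h3 ht.le
      have h5 : t * (((k : ℝ) + 2) / t - 1) = k + 2 - t := by field_simp
      linarith
    rw [h1]
    nlinarith [mul_nonneg hk hL.le]

theorem tendsto_div_log (C : ℝ) :
    Tendsto (fun k : ℕ => C / Real.log ((k : ℝ) + 2)) atTop (𝓝 0) :=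
  tendsto_const_nhds.div_atTop (Real.tendsto_log_atTop.comp
    (tendsto_natCast_atTop_atTop.atTop_add tendsto_const_nhds))

theorem integral_abs_sub_trunc_le_mul_log {w : Euc d → ℝ} (hw : Continuous w)
    (hpos : ∀ x, 0 < w x) {C : ℝ} (hC : ∫ x, w x * Real.log (w x) ∂cellVol d ≤ C) (k : ℕ) :
    ∫ x, |w x - trunc k (w x)| ∂cellVol d ≤ (C + 2) / Real.log (k + 2) := by
  have ht := continuous_trunc k
  have hl : Continuous fun x => Real.log (w x) := hw.log fun x => (hpos x).ne'
  have hL : 0 < Real.log ((k : ℝ) + 2) :=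
    Real.log_pos (by linarith [(Nat.cast_nonneg k : (0 : ℝ) ≤ k)])
  calc ∫ x, |w x - trunc k (w x)| ∂cellVol d
      ≤ ∫ x, (w x * Real.log (w x) + 2) / Real.log ((k : ℝ) + 2) ∂cellVol d := by
        refine integral_mono (Continuous.integrable_cellVol (by fun_prop))
          (Continuous.integrable_cellVol ((hw.mul hl).add continuous_const |>.div_const _))
          fun x => abs_sub_trunc_le_mul_log k (hpos x)
    _ = (∫ x, w x * Real.log (w x) ∂cellVol d + 2) / Real.log ((k : ℝ) + 2) := by
        rw [integral_div, integral_add (Continuous.integrable_cellVol (hw.fun_mul hl))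
          (integrable_const _)]
        simp
    _ ≤ (C + 2) / Real.log (k + 2) := by gcongr

/-! ### Passage to the limit -/

theorem TSConv.twoScale {ε : ℕ → ℝ} {w : ℕ → Euc d → ℝ} {W : Tor d × Tor d → ℝ}
    (h : TSConv ε w W) (hw : ∀ n, Continuous (w n)) {q : ℝ≥0∞} (hq1 : 1 ≤ q)
    (hW : MemLp W q (torVol₂ d)) : TwoScale q ε w fun z => W (pr z.1, pr z.2) := by
  refine ⟨fun n => (hw n).memLp_cellVol q, hW.comp_measurePreserving measurePreserving_pr_prod,
    fun ψ hψ => ?_⟩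
  obtain ⟨Ψ, hΨ⟩ := exists_lift₂ hψ.smooth.continuous hψ.periodic_fst hψ.periodic_snd
  have hi : Integrable (fun z => W z * Ψ z) (torVol₂ d) :=
    integrable_mul_continuousMap (hW.integrable hq1) Ψ
  have h1 := h Ψ
  simp only [hΨ] at h1
  convert! h1 using 2
  have hi' : Integrable (fun z : Euc d × Euc d => W (Prod.map pr pr z) * Ψ (Prod.map pr pr z))
      ((cellVol d).prod (cellVol d)) :=
    measurePreserving_pr_prod.integrable_comp_of_integrable hi
  rw [← measurePreserving_pr_prod.integral_comp_of_aesm hi.1, integral_prod _ hi']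
  simp only [Prod.map, hΨ]

theorem TSConv.tendsto_integral_mul {ε : ℕ → ℝ} {w : ℕ → Euc d → ℝ} {W : Tor d × Tor d → ℝ}
    (h : TSConv ε w W) (hW : Integrable W (torVol₂ d)) (φ : C(Tor d, ℝ)) :
    Tendsto (fun n => ∫ x, w n x * φ (pr x) ∂cellVol d) atTop
      (𝓝 (∫ x, (∫ b, W (pr x, b)) * φ (pr x) ∂cellVol d)) := by
  simpa using h.tendsto_marginal hW 1 φ

theorem weakLp_of_tendsto {f : ℕ → Euc d → ℝ} {f₀ : Euc d → ℝ} (hf : ∀ n, Continuous (f n))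
    (hf₀ : ∀ p : ℝ≥0∞, 1 ≤ p → p ≠ ⊤ → MemLp f₀ p (cellVol d))
    (hb : ∀ p : ℝ≥0∞, p ≠ ⊤ → ∃ C : ℝ≥0∞, C ≠ ⊤ ∧ ∀ n, eLpNorm (f n) p (cellVol d) ≤ C)
    (h : ∀ φ : C(Tor d, ℝ), Tendsto (fun n => ∫ x, f n x * φ (pr x) ∂cellVol d) atTop
      (𝓝 (∫ x, f₀ x * φ (pr x) ∂cellVol d)))
    {q : ℝ≥0∞} (hq1 : 1 ≤ q) (hq : q ≠ ⊤) : WeakLp q f f₀ := by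
  refine ⟨fun n => (hf n).memLp_cellVol q, hf₀ q hq1 hq, fun q' hqq g hg => ?_⟩
  -- For `q = 1` the dual exponent is infinite and density fails; bounded functions are then tested
  -- in the `L²` pairing.
  by_cases hq' : q' = ⊤
  · obtain ⟨C, hC, hbC⟩ := hb 2 (by simp)
    exact tendsto_integral_mul_of_memLp (p := 2) (p' := 2) (by simp)
      (fun n => (hf n).memLp_cellVol 2) (hf₀ 2 (by norm_num) (by simp)) hC hbC h
      (hg.mono_exponent (by simp [hq']))
  · obtain ⟨C, hC, hbC⟩ := hb q hq
    exact tendsto_integral_mul_of_memLp hq' (fun n => (hf n).memLp_cellVol q) (hf₀ q hq1 hq) hC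
      hbC h hg

theorem tendsto_integral_mul_of_tendstoUniformly {f : ℕ → Euc d → ℝ} {f₀ : Euc d → ℝ}
    (hf : ∀ n, Continuous (f n)) {A : ℝ} (hA : ∀ n x, |f n x| ≤ A)
    (h : TendstoUniformly f f₀ atTop) {g : Euc d → ℝ} (hg : Integrable g (cellVol d)) :
    Tendsto (fun n => ∫ x, f n x * g x ∂cellVol d) atTop (𝓝 (∫ x, f₀ x * g x ∂cellVol d)) := by
  refine tendsto_integral_of_dominated_convergence (fun x => A * |g x|)
    (fun n => (hf n).aestronglyMeasurable.mul hg.1) (hg.abs.const_mul A) (fun n => ?_) ?_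
  · refine ae_of_all _ fun x => ?_
    rw [Real.norm_eq_abs, abs_mul]
    exact mul_le_mul_of_nonneg_right (hA n x) (abs_nonneg _)
  · exact ae_of_all _ fun x => (h.tendsto_at x).mul_const _

theorem weakLp_of_tendstoUniformly {f : ℕ → Euc d → ℝ} {f₀ : Euc d → ℝ}
    (hf : ∀ n, Continuous (f n)) {A : ℝ} (hA : ∀ n x, |f n x| ≤ A)
    (h : TendstoUniformly f f₀ atTop) (q : ℝ≥0∞) : WeakLp q f f₀ := by
  refine ⟨fun n => (hf n).memLp_cellVol q,
    (h.continuous (Frequently.of_forall hf)).memLp_cellVol q, fun q' hqq g hg =>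
    tendsto_integral_mul_of_tendstoUniformly hf hA h (hg.integrable ?_)⟩
  exact ENNReal.HolderConjugate.one_le q' q

theorem exists_eLpNorm_le {f : ℕ → Euc d → ℝ} (hf : ∀ n, Continuous (f n))
    (hb : ∀ r : ℕ, ∃ C, ∀ n, ∫ x, f n x ^ (2 * r) ∂cellVol d ≤ C) {p : ℝ≥0∞} (hp : p ≠ ⊤) :
    ∃ C : ℝ≥0∞, C ≠ ⊤ ∧ ∀ n, eLpNorm (f n) p (cellVol d) ≤ C := by
  obtain ⟨r, hr⟩ := ENNReal.exists_nat_gt hp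
  have hr0 : r ≠ 0 := by rintro rfl; simp at hr
  obtain ⟨C, hC⟩ := hb r
  refine ⟨ENNReal.ofReal C ^ (1 / ((2 * r : ℕ) : ℝ)),
    ENNReal.rpow_ne_top_of_nonneg (by positivity) ENNReal.ofReal_ne_top, fun n => ?_⟩
  have hfn := hf n
  refine (eLpNorm_le_eLpNorm_of_exponent_le (q := ((2 * r : ℕ) : ℝ≥0∞)) ?_
    hfn.aestronglyMeasurable).trans
    (eLpNorm_le_of_integral_pow_le (by positivity) (Continuous.integrable_cellVol (by fun_prop)) ?_)
  · refine hr.le.trans ?_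
    exact_mod_cast Nat.le_mul_of_pos_left r two_pos
  · simpa only [(even_two_mul r).pow_abs] using hC n

theorem TSConv.memLp_of_ne_top {ε : ℕ → ℝ} (hε : ∀ n, 0 < ε n) (hε0 : Tendsto ε atTop (𝓝 0))
    {w : ℕ → Euc d → ℝ} (hw : ∀ n, Continuous (w n)) {W : Tor d × Tor d → ℝ}
    (hW : Integrable W (torVol₂ d)) (h : TSConv ε w W)
    (hb : ∀ r : ℕ, ∃ C, ∀ n, ∫ x, w n x ^ (2 * r) ∂cellVol d ≤ C) {p : ℝ≥0∞} (hp : p ≠ ⊤) :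
    MemLp W p (torVol₂ d) := by
  obtain ⟨r, hr⟩ := ENNReal.exists_nat_gt hp
  have hr0 : r ≠ 0 := by rintro rfl; simp at hr
  obtain ⟨C, hC⟩ := hb r
  refine (TSConv.memLp hε hε0 hw hW h (p := 2 * r) (by positivity) (even_two_mul r)
    hC).mono_exponent (hr.le.trans ?_)
  exact_mod_cast Nat.le_mul_of_pos_left r two_pos

theorem memLp_marginal {W : Tor d × Tor d → ℝ} {q : ℝ≥0∞} (hq1 : 1 ≤ q) (hq : q ≠ ⊤)
    (hW : MemLp W q (torVol₂ d)) : MemLp (fun x => ∫ b, W (pr x, b)) q (cellVol d) :=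
  (memLp_integral_prod hW hq1 hq).comp_measurePreserving measurePreserving_pr

/-- Subtracting the `y`-mean supplies the mean-zero condition. It leaves the curl pairings unchanged
because derivatives of periodic functions integrate to zero. -/
theorem exists_corrector (hd : 0 < d) {ε : ℕ → ℝ} (hε : ∀ n, 0 < ε n)
    (hε0 : Tendsto ε atTop (𝓝 0)) {u : ℕ → Euc d → ℝ} (hu : ∀ n, SmoothPeriodic (u n)) {C : ℝ}
    (hC : ∀ n i, ∫ x, pd i (u n) x ^ 2 ∂cellVol d ≤ C) {W : Fin d → Tor d × Tor d → ℝ}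
    (hWm : ∀ i, StronglyMeasurable (W i)) (hW2 : ∀ i, MemLp (W i) 2 (torVol₂ d))
    (hts : ∀ i, TSConv ε (fun n => pd i (u n)) (W i))
    {q : ℝ≥0∞} (hq1 : 1 ≤ q) (hq : q ≠ ⊤) (hWq : ∀ i, MemLp (W i) q (torVol₂ d))
    {G : Euc d × Euc d → Euc d}
    (hG : ∀ z i, G z i = W i (pr z.1, pr z.2) - ∫ b, W i (pr z.1, b)) :
    ∃ w, MemLpSobolevPer q w G := by
  have hsec : ∀ i, ∀ᵐ x ∂cellVol d, Integrable (fun b => W i (pr x, b)) volume := fun i =>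
    measurePreserving_pr.quasiMeasurePreserving.ae ((hWq i).integrable hq1).prod_right_ae
  refine exists_memLpSobolevPer hd hq1 hq
    (K := fun i z => W i z - ∫ b, W i (z.1, b)) (fun i => ?_) (fun i => ?_) ?_
    (fun θ hθ i j => ?_) hG
  · exact (hWm i).sub ((hWm i).integral_prod_right'.comp_measurable measurable_fst)
  · exact (hWq i).sub
      ((memLp_integral_prod (hWq i) hq1 hq).comp_measurePreserving measurePreserving_fst)
  · filter_upwards [ae_all_iff.2 hsec] with x hx i
    rw [integral_sub (hx i) (integrable_const _)]
    simp
  · have key : ∀ i j : Fin d, ∀ᵐ x ∂cellVol d,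
        ∫ y, (W j (pr x, pr y) - ∫ b, W j (pr x, b)) * pd i θ y ∂cellVol d
          = ∫ y, W j (pr x, pr y) * pd i θ y ∂cellVol d := fun i j => by
      filter_upwards [hsec j] with x hx
      simp only [sub_mul]
      rw [integral_sub (integrable_mul_comp_pr hx (hθ.pd i))
        ((hθ.pd i).continuous.integrable_cellVol.const_mul _), integral_const_mul,
        integral_pd_eq_zero hθ, mul_zero, sub_zero]
    filter_upwards [key i j, key j i, ae_curl_eq hε hε0 hu hC hWm hW2 hts hθ i j] with x h1 h2 h3
    rw [h1, h2, h3]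

end TwoScaleMFG

/-! ### Assembly of the limits along one subsequence. -/

theorem mainTheorem6 (d : ℕ) (hd : 0 < d) (P : Euc d)
    (V : Euc d × Euc d → ℝ) (hV : SmoothPeriodic₂ V)
    (ε : ℕ → ℝ) (hε : ∀ n, 0 < ε n) (hε0 : Tendsto ε atTop (𝓝 0))
    (u m : ℕ → Euc d → ℝ) (H : ℕ → ℝ)
    (hsol : ∀ n, SolvesMFG V P (ε n) (u n) (m n) (H n))
    (q : ℝ≥0∞) (hq1 : 1 ≤ q) (hq : q ≠ ⊤) :
    ∃ (α : ℝ≥0) (u₀ : Euc d → ℝ) (g₀ : Euc d → Euc d)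
      (u₁ : Euc d × Euc d → ℝ) (G₁ : Euc d × Euc d → Euc d)
      (m₂ : Euc d × Euc d → ℝ) (Hbar : ℝ) (σ : ℕ → ℕ),
      -- `α ∈ (0,1)`, `u₀ ∈ C^{0,α}(𝕋^d) ∩ W^{1,q}(𝕋^d)`, `∇u₀ = g₀`, `∫ u₀ = 0`
      (0 < α ∧ α < 1) ∧
      IsPeriodic u₀ ∧ (∃ C : ℝ≥0, HolderWith C α u₀) ∧ MemSobolev q u₀ g₀ ∧
      ∫ x, u₀ x ∂cellVol d = 0 ∧
      -- `u₁ ∈ L^q(𝕋^d; W^{1,q}_#(𝒴^d)/ℝ)`, `∇_y u₁ = G₁`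
      MemLpSobolevPer q u₁ G₁ ∧
      -- `m₂ ∈ L¹(𝕋^d × 𝒴^d)` has total integral one
      MemLp m₂ 1 ((cellVol d).prod (cellVol d)) ∧
      ∫ x, ∫ y, m₂ (x, y) ∂cellVol d ∂cellVol d = 1 ∧
      -- the convergences, all along the same subsequence `σ`
      StrictMono σ ∧
      TendstoUniformly (fun n => u (σ n)) u₀ atTop ∧
      WeakSobolev q (fun n => u (σ n)) u₀ g₀ ∧
      (∀ i, TwoScale q (fun n => ε (σ n)) (fun n x => gradient (u (σ n)) x i)
        (fun z => g₀ z.1 i + G₁ z i)) ∧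
      TwoScale 1 (fun n => ε (σ n)) (fun n => m (σ n)) m₂ ∧
      WeakLp 1 (fun n => m (σ n)) (fun x => ∫ y, m₂ (x, y) ∂cellVol d) ∧
      Tendsto (fun n => H (σ n)) atTop (𝓝 Hbar) := by
  obtain ⟨M, hM⟩ := hV.exists_bound
  have hus : ∀ n, SmoothPeriodic (u n) := fun n => (hsol n).smooth_u
  have hms : ∀ n, SmoothPeriodic (m n) := fun n => (hsol n).smooth_m
  -- bounds on all moments of the derivatives
  have hmom : ∀ i (r : ℕ), ∃ C, ∀ n, ∫ x, pd i (u n) x ^ (2 * r) ∂cellVol d ≤ C := fun i r => by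
    refine ⟨_, fun n => le_trans ?_ ((hsol n).integral_norm_gradient_pow_le hM r)⟩
    have hg := continuous_gradient (hus n).smooth
    have hp := ((hus n).pd i).continuous
    refine integral_mono (Continuous.integrable_cellVol (by fun_prop))
      (Continuous.integrable_cellVol (by fun_prop)) fun x => ?_
    simp only
    rw [← (even_two_mul r).pow_abs, ← gradient_apply]
    exact pow_le_pow_left₀ (abs_nonneg _) (PiLp.norm_apply_le (gradient (u n) x) i) _
  -- uniform convergence of `u`
  obtain ⟨B, hB0, hB⟩ : ∃ B : ℝ, 0 ≤ B ∧
      ∀ n, ∫ x, ‖gradient (u n) x‖ ^ (2 * d) ∂cellVol d ≤ B ^ (2 * d) := by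
    -- Adding `1` to the moment bound makes the base at least one, so the bound is below its own
    -- power `2d` and no root is needed.
    refine ⟨1 + 2 ^ (2 * d - 1) * (2 ^ d * d.factorial * Real.exp (‖P‖ ^ 2 / 2 + 2 * M)
      + ‖P‖ ^ (2 * d)), by positivity, fun n =>
      ((hsol n).integral_norm_gradient_pow_le hM d).trans ?_⟩
    have h1 : (0 : ℝ) ≤ 2 ^ (2 * d - 1) * (2 ^ d * d.factorial * Real.exp (‖P‖ ^ 2 / 2 + 2 * M)
      + ‖P‖ ^ (2 * d)) := by positivity
    exact le_trans (by linarith) (le_self_pow₀ (by linarith) (by omega))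
  have hA : ∀ n y, |u n y| ≤ 2 * √d * B := fun n y =>
    abs_le_of_integral_eq_zero hd (hus n) hB0 (hB n) (hsol n).integral_u y
  obtain ⟨u₀, σ₁, hσ₁, hu₀p, hu₀K, hu₀⟩ := exists_subseq_tendstoUniformly
    (fun n => (hus n).periodic) (fun n => (hus n).continuous) hA
    fun n y z => abs_sub_le_sqrt hd (hus n) hB0 (hB n) (hsol n).integral_u y z
  -- convergence of the effective Hamiltonians
  obtain ⟨σ₂, hσ₂, hH⟩ := exists_common_subseq (fun (_ : Unit) n => H (σ₁ n)) fun _ =>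
    ⟨‖P‖ ^ 2 / 2 + M, fun n => abs_le.2
      ⟨by linarith [(hsol (σ₁ n)).neg_le_H hM, sq_nonneg ‖P‖], (hsol (σ₁ n)).H_le hM⟩⟩
  obtain ⟨Hbar, hH⟩ := hH ()
  -- two-scale compactness
  have hent : ∀ n (k : ℕ), ∫ x, |m n x - trunc k (m n x)| ∂cellVol d
      ≤ (‖P‖ ^ 2 / 2 + 2 * M + 2) / Real.log (k + 2) := fun n k => by
    refine integral_abs_sub_trunc_le_mul_log (hms n).continuous (hsol n).m_pos ?_ k
    linarith [(hsol n).integral_mul_log_le hM, (hsol n).neg_le_H hM]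
  choose C hC using fun i => hmom i 1
  simp only [mul_one] at hC
  -- The index `none` stands for `m` and `some i` for the `i`-th derivative of `u`, so one
  -- extraction serves all.
  obtain ⟨σ₃, hσ₃, hW⟩ := exists_subseq_tsConv (ι := Option (Fin d))
    (ε := fun n => ε (σ₁ (σ₂ n))) (fun n => hε _)
    (hε0.comp (hσ₁.tendsto_atTop.comp hσ₂.tendsto_atTop))
    (w := fun o n => o.elim (m (σ₁ (σ₂ n))) fun i => pd i (u (σ₁ (σ₂ n))))
    (δ := fun o k => o.elim ((‖P‖ ^ 2 / 2 + 2 * M + 2) / Real.log (k + 2))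
      fun i => (C i + 1) / (k + 1))
    (by
      rintro (_ | i) n
      exacts [(hms _).continuous, ((hus _).pd i).continuous])
    (by
      rintro (_ | i)
      exacts [tendsto_div_log _, tendsto_div_natCast_add_one _])
    (by
      rintro (_ | i) n k
      exacts [hent _ k, integral_abs_sub_trunc_le_sq ((hus _).pd i).continuous (hC i _) k])
  obtain ⟨Wm, hWmm, hWmi, hWmt⟩ := hW none
  choose W hWs hWi hWt using fun i => hW (some i)
  simp only [Option.elim] at hWmt hWt
  set σ : ℕ → ℕ := fun n => σ₁ (σ₂ (σ₃ n)) with hσdef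
  have hσ : StrictMono σ := hσ₁.comp (hσ₂.comp hσ₃)
  have hεσ0 : Tendsto (fun n => ε (σ n)) atTop (𝓝 0) := hε0.comp hσ.tendsto_atTop
  have hpc : ∀ i n, Continuous (pd i (u (σ n))) := fun i n => ((hus _).pd i).continuous
  have hmomσ : ∀ i (r : ℕ), ∃ C, ∀ n, ∫ x, pd i (u (σ n)) x ^ (2 * r) ∂cellVol d ≤ C :=
    fun i r => (hmom i r).imp fun _ h n => h _
  have hWp : ∀ i (p : ℝ≥0∞), p ≠ ⊤ → MemLp (W i) p (torVol₂ d) := fun i p hp =>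
    TSConv.memLp_of_ne_top (fun n => hε _) hεσ0 (hpc i) (hWi i) (hWt i) (hmomσ i) hp
  have hunif : TendstoUniformly (fun n => u (σ n)) u₀ atTop := fun V hV =>
    (hσ₂.comp hσ₃).tendsto_atTop.eventually (hu₀ V hV)
  have hucont : ∀ n, Continuous (u (σ n)) := fun n => (hus _).continuous
  have hgrad : ∀ i (φ : C(Tor d, ℝ)), Tendsto
      (fun n => ∫ x, pd i (u (σ n)) x * φ (pr x) ∂cellVol d) atTop
      (𝓝 (∫ x, (∫ b, W i (pr x, b)) * φ (pr x) ∂cellVol d)) := fun i φ =>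
    (hWt i).tendsto_integral_mul (hWi i) φ
  -- The two-scale limit splits into its `y`-mean, the gradient of `u₀`, and the remainder, the
  -- `y`-gradient of the corrector.
  let g₀ : Euc d → Euc d := fun x => WithLp.toLp 2 fun i => ∫ b, W i (pr x, b)
  let G₁ : Euc d × Euc d → Euc d := fun z =>
    WithLp.toLp 2 fun i => W i (pr z.1, pr z.2) - ∫ b, W i (pr z.1, b)
  have hu₀W : WeakLp q (fun n => u (σ n)) u₀ :=
    weakLp_of_tendstoUniformly hucont (fun n => hA _) hunif q
  have hsob : MemSobolev q u₀ g₀ := by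
    refine ⟨hu₀W.memLp_lim, memLp_euc hq1 fun i => memLp_marginal hq1 hq (hWp i q hq),
      fun φ hφ i => ?_⟩
    obtain ⟨Φ, hΦ⟩ := hφ.periodic.exists_lift hφ.continuous
    have h1 := tendsto_integral_mul_of_tendstoUniformly hucont (fun n => hA _) hunif
      (hφ.pd i).continuous.integrable_cellVol
    have h2 := (hgrad i Φ).neg
    simp only [hΦ] at h2
    simp only [integral_mul_pd (hus _) hφ] at h1
    simp only [gradient_apply]
    exact tendsto_nhds_unique h1 h2
  obtain ⟨u₁, hu₁⟩ := exists_corrector hd (fun n => hε (σ n)) hεσ0 (fun n => hus (σ n))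
    (C := ∑ i, |C i|) (fun n i => (hC i _).trans ((le_abs_self _).trans
      (Finset.single_le_sum (f := fun i => |C i|) (fun j _ => abs_nonneg _) (Finset.mem_univ i))))
    hWs (fun i => hWp i 2 (by simp)) hWt hq1 hq (fun i => hWp i q hq) (G := G₁) fun z i => rfl
  have hWm1 : MemLp Wm 1 (torVol₂ d) := memLp_one_iff_integrable.2 hWmi
  have hm₂ : TwoScale 1 (fun n => ε (σ n)) (fun n => m (σ n)) fun z => Wm (pr z.1, pr z.2) :=
    TSConv.twoScale hWmt (fun n => (hms _).continuous) le_rfl hWm1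
  have hmarg : ∀ x : Euc d, ∫ y, Wm (pr x, pr y) ∂cellVol d = ∫ b, Wm (pr x, b) := fun x =>
    measurePreserving_pr.integral_comp_of_aesm (f := fun b => Wm (pr x, b))
      (hWmm.comp_measurable measurable_prodMk_left).aestronglyMeasurable
  refine ⟨1 / 2, u₀, g₀, u₁, G₁, fun z => Wm (pr z.1, pr z.2), Hbar, σ,
    ⟨by norm_num, NNReal.half_lt_self one_ne_zero⟩, hu₀p, ⟨_, holderWith_half hu₀K⟩, hsob, ?_, hu₁,
    hm₂.memLp_lim, ?_, hσ, hunif, ⟨hsob, hu₀W, fun i => ?_⟩, fun i => ?_, hm₂, ?_,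
    hH.comp hσ₃.tendsto_atTop⟩
  · have h1 := tendsto_integral_mul_of_tendstoUniformly hucont (fun n => hA _) hunif
      (integrable_const (1 : ℝ))
    simp only [mul_one, (hsol _).integral_u] at h1
    exact tendsto_nhds_unique h1 tendsto_const_nhds
  -- Mass is preserved in the limit because the constant `1` is an admissible test function.
  · have h1 := hm₂.tendsto (fun _ => 1) ⟨contDiff_const, fun _ _ _ => rfl, fun _ _ _ => rfl⟩
    simp only [mul_one, (hsol _).integral_m] at h1
    exact tendsto_nhds_unique h1 tendsto_const_nhds
  · simp only [gradient_apply]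
    exact weakLp_of_tendsto (hpc i) (fun p hp1 hp => memLp_marginal hp1 hp (hWp i p hp))
      (fun p hp => exists_eLpNorm_le (hpc i) (hmomσ i) hp) (hgrad i) hq1 hq
  · have h1 : (fun z : Euc d × Euc d => g₀ z.1 i + G₁ z i) = fun z => W i (pr z.1, pr z.2) := by
      ext z
      simp [g₀, G₁]
    rw [h1]
    simp only [gradient_apply]
    exact TSConv.twoScale (hWt i) (hpc i) hq1 (hWp i q hq)
  · simp only [hmarg]
    refine ⟨fun n => (hms _).continuous.memLp_cellVol 1,
      memLp_marginal le_rfl ENNReal.one_ne_top hWm1, fun q' hq' g hg => ?_⟩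
    have hq'top : q' = ⊤ := by
      have h1 := hq'.inv_add_inv_eq_one
      simpa using h1
    subst hq'top
    exact tendsto_integral_mul_of_bounded (fun n => (hms _).continuous)
      (memLp_one_iff_integrable.1 (memLp_marginal le_rfl ENNReal.one_ne_top hWm1))
      (tendsto_div_log _) (fun n => hent _) (hWmt.tendsto_integral_mul hWmi) hg
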